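/- Let $A,E,C$ be finite-dimensional quantum systems with $|A|=\dim A$. Let $\rho_{AE}$ be a density operator on $A\otimes E$ with marginal $\rho_E=\operatorname{tr}_A\rho_{AE}$. Let $\mathcal T_{A\to C}$ be a completely positive, trace non-increasing linear map, let $A'\cong A$, let $\Phi_{A'A}=\frac1{|A|}\sum_{i,j}|i\rangle\langle j|_{A'}\otimes|i\rangle\langle j|_{A}$ be the normalized maximally entangled state, and put $\omega_{A'C}=\mathcal T_{A\to C}(\Phi_{A'A})$ and $\omega_C=\operatorname{tr}_{A'}\omega_{A'C}=\mathcal T(I_A/|A|)$. Let $D(\tau\|\sigma)=\operatorname{tr}\big(\tau(\ln\tau-\ln\sigma)\big)$ if $\operatorname{supp}\tau\subseteq\operatorname{supp}\sigma$, and $D(\tau\|\sigma)=+\infty$ otherwise (natural logarithm). For $\alpha>1$ and positive semidefinite $\tau,\sigma$ with $\operatorname{supp}\tau\subseteq\operatorname{supp}\sigma$ let $$\widetilde D_\alpha(\tau\|\sigma)=\tfrac1{\alpha-1}\log_2\operatorname{tr}\Big(\sigma^{\frac{1-\alpha}{2\alpha}}\tau\,\sigma^{\frac{1-\alpha}{2\alpha}}\Big)^{\alpha}-\tfrac1{\alpha-1}\log_2\operatorname{tr}\tau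 ,$$ with $\widetilde D_\alpha(0\|\sigma)=0$ by convention (and $\widetilde D_\alpha(\tau\|\sigma)=+\infty$ if the supports are not nested), and let $\widetilde H_\alpha(A|B)_\tau=-\widetilde D_\alpha(\tau_{AB}\|I_A\otimes\tau_B)$. Then for every $s\in(0,1]$ (with $0^0=1$) $$\mathbb E_{U}\,D\big(\mathcal T(U\rho_{AE}U^*)\,\big\|\,\omega_C\otimes\rho_E\big)\;\le\;\frac{s^s(1-s)^{1-s}}{s}\;2^{-s\widetilde H_{1+s}(A|E)_\rho-s\widetilde H_{1+s}(A'|C)_\omega},$$ where $U$ is Haar-distributed on the unitary group of $A$ (acting as $U_A\otimes I_E$), the relative entropy is finite for every $U$ and integrable, and both Rényi entropies are finite. Moreover, the bound still holds with its right-hand side multiplied by $\operatorname{tr}\omega_{A'C}\le 1$, i.e. when the term $\frac1{\alpha-1}\log_2\operatorname{tr}\tau$ is omitted from the Rényi divergence of $\omega$. -/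

import Mathlib

open scoped Kronecker ComplexOrder

noncomputable section

/-! ### States, maps, partial traces (finite-dimensional systems, in an orthonormal basis) -/

/-- Density operators: positive semidefinite of trace one. -/
def IsState {H : Type*} [Fintype H] (ρ : Matrix H H ℂ) : Prop :=
  ρ.PosSemidef ∧ ρ.trace = 1

/-- `T ⊗ id` applied to an operator on the bipartite system `A ⊗ E`. -/
def applyFirst {A C : Type*} (E : Type*) (T : Matrix A A ℂ →ₗ[ℂ] Matrix C C ℂ)
    (X : Matrix (A × E) (A × E) ℂ) : Matrix (C × E) (C × E) ℂ :=
  Matrix.of fun p q => T (Matrix.of fun a b => X (a, p.2) (b, q.2)) p.1 q.1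

/-- Complete positivity: `T ⊗ id_k` preserves positive semidefiniteness for every `k`. -/
def IsCompletelyPositive {A C : Type*} [Fintype A] [Fintype C]
    (T : Matrix A A ℂ →ₗ[ℂ] Matrix C C ℂ) : Prop :=
  ∀ (k : ℕ) (X : Matrix (A × Fin k) (A × Fin k) ℂ),
    X.PosSemidef → (applyFirst (Fin k) T X).PosSemidef

/-- `T` does not increase the trace of positive semidefinite operators. -/
def IsTraceNonincreasing {A C : Type*} [Fintype A] [Fintype C]
    (T : Matrix A A ℂ →ₗ[ℂ] Matrix C C ℂ) : Prop :=
  ∀ X : Matrix A A ℂ, X.PosSemidef → (T X).trace.re ≤ X.trace.re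

/-- The marginal `X_B = tr_A X_{AB}`. -/
def marginalSnd {A B : Type*} [Fintype A] (X : Matrix (A × B) (A × B) ℂ) : Matrix B B ℂ :=
  Matrix.of fun b b' => ∑ a, X (a, b) (a, b')

/-- The normalized maximally entangled state `Φ = |A|⁻¹ ∑ i j, |i⟩⟨j| ⊗ |i⟩⟨j|`. -/
def maxEntangled (A : Type*) [Fintype A] [DecidableEq A] : Matrix (A × A) (A × A) ℂ :=
  (Fintype.card A : ℂ)⁻¹ • ∑ i, ∑ j, (Matrix.single i j (1 : ℂ) ⊗ₖ Matrix.single i j (1 : ℂ))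

/-- The normalized Choi operator `ω_{A'C} = T_{A → C}(Φ_{A'A})`, an operator on `A' ⊗ C`.
(`applyFirst` yields an operator on `C ⊗ A'`; the two factors are then exchanged.) -/
def choi {A C : Type*} [Fintype A] [DecidableEq A] (T : Matrix A A ℂ →ₗ[ℂ] Matrix C C ℂ) :
    Matrix (A × C) (A × C) ℂ :=
  (applyFirst A T (maxEntangled A)).submatrix Prod.swap Prod.swap

/-- The image `ω_C = T(I_A / |A|)` of the maximally mixed state. -/
def imageOfMixed {A C : Type*} [Fintype A] [DecidableEq A]
    (T : Matrix A A ℂ →ₗ[ℂ] Matrix C C ℂ) : Matrix C C ℂ :=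
  T ((Fintype.card A : ℂ)⁻¹ • (1 : Matrix A A ℂ))

/-! ### Divergences -/

/-- `supp ρ ⊆ supp σ` for positive semidefinite operators, whose supports are the orthogonal
complements of their kernels. -/
def SuppLE {H : Type*} [Fintype H] (ρ σ : Matrix H H ℂ) : Prop :=
  ∀ v : H → ℂ, σ.mulVec v = 0 → ρ.mulVec v = 0

open Classical in
/-- Umegaki's relative entropy `D(ρ‖σ)`, with the natural logarithm (on the kernel, `log 0 = 0`).
-/
def relEntropy {H : Type*} [Fintype H] [DecidableEq H] (ρ σ : Matrix H H ℂ) : EReal :=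
  if SuppLE ρ σ then (((ρ * (cfc Real.log ρ - cfc Real.log σ)).trace.re : ℝ) : EReal) else ⊤

/-- The power `σ ^ p` of a positive semidefinite operator, taken on its support if `p < 0`
(for real numbers, `0 ^ p = 0` whenever `p ≠ 0`). -/
def psdPow {H : Type*} [Fintype H] [DecidableEq H] (σ : Matrix H H ℂ) (p : ℝ) : Matrix H H ℂ :=
  cfc (fun x : ℝ => x ^ p) σ

/-- `Q̃_α(ρ‖σ) = tr (σ^((1-α)/(2α)) ρ σ^((1-α)/(2α)))^α`. -/
def sandwichedQ {H : Type*} [Fintype H] [DecidableEq H] (α : ℝ) (ρ σ : Matrix H H ℂ) : ℝ :=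
  (psdPow (psdPow σ ((1 - α) / (2 * α)) * ρ * psdPow σ ((1 - α) / (2 * α))) α).trace.re

open Classical in
/-- The sandwiched Rényi divergence of order `α ∈ (0,1) ∪ (1,∞)`, in bits. Two positive
semidefinite operators have orthogonal supports exactly if their product vanishes. -/
def sandwichedDiv {H : Type*} [Fintype H] [DecidableEq H] (α : ℝ) (ρ σ : Matrix H H ℂ) : EReal :=
  if (1 < α ∧ SuppLE ρ σ) ∨ (α < 1 ∧ ρ * σ ≠ 0) then
    ((1 / (α - 1) * Real.logb 2 (sandwichedQ α ρ σ)
      - 1 / (α - 1) * Real.logb 2 ρ.trace.re : ℝ) : EReal)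
  else ⊤

/-- The sandwiched conditional Rényi entropy `H̃_α(A|B)_ρ = - D̃_α(ρ_{AB} ‖ I_A ⊗ ρ_B)`. -/
def sandwichedCondEntropy {A B : Type*} [Fintype A] [DecidableEq A] [Fintype B] [DecidableEq B]
    (α : ℝ) (ρ : Matrix (A × B) (A × B) ℂ) : EReal :=
  - sandwichedDiv α ρ ((1 : Matrix A A ℂ) ⊗ₖ marginalSnd ρ)

/-! ### Haar measure on the unitary group -/

instance unitaryGroupMeasurableSpace (A : Type*) [Fintype A] [DecidableEq A] :
    MeasurableSpace (Matrix.unitaryGroup A ℂ) := borel _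

instance unitaryGroupBorelSpace (A : Type*) [Fintype A] [DecidableEq A] :
    BorelSpace (Matrix.unitaryGroup A ℂ) := ⟨rfl⟩

instance unitaryGroupCompactSpace (A : Type*) [Fintype A] [DecidableEq A] :
    CompactSpace (Matrix.unitaryGroup A ℂ) := by
  have hK : IsCompact {M : Matrix A A ℂ | ∀ i j, M i j ∈ Metric.closedBall (0 : ℂ) 1} := by
    have h : IsCompact (Set.univ.pi fun _ : A =>
        (Set.univ.pi fun _ : A => Metric.closedBall (0 : ℂ) 1)) :=
      isCompact_univ_pi fun _ => isCompact_univ_pi fun _ => isCompact_closedBall _ _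
    simp only [Set.pi, Set.mem_univ, forall_true_left, Set.mem_ofPred_eq] at h
    exact h
  have hU : IsCompact ((Matrix.unitaryGroup A ℂ : Set (Matrix A A ℂ))) := by
    refine hK.of_isClosed_subset isClosed_unitary ?_
    intro U hU i j
    simpa using entry_norm_bound_of_unitary hU i j
  exact isCompact_iff_compactSpace.mp hU

/-- The Haar probability measure on the unitary group `𝕌(A)`. -/
def haarUnitary (A : Type*) [Fintype A] [DecidableEq A] :
    MeasureTheory.Measure (Matrix.unitaryGroup A ℂ) :=
  MeasureTheory.Measure.haarMeasure ⊤

/-! ### Decoupling -/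

/-- The operator `T_{A → C}(U_A ρ_{AE} U_A^*)` on `C ⊗ E`. -/
def decoupledState {A C E : Type*} [Fintype A] [DecidableEq A] [Fintype E] [DecidableEq E]
    (T : Matrix A A ℂ →ₗ[ℂ] Matrix C C ℂ) (ρ : Matrix (A × E) (A × E) ℂ)
    (U : Matrix.unitaryGroup A ℂ) : Matrix (C × E) (C × E) ℂ :=
  applyFirst E T
    (((U : Matrix A A ℂ) ⊗ₖ (1 : Matrix E E ℂ)) * ρ *
      ((U : Matrix A A ℂ) ⊗ₖ (1 : Matrix E E ℂ)).conjTranspose)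

/-- The divergence `D(T(U ρ U^*) ‖ ω_C ⊗ ρ_E)` for a fixed unitary. -/
def decouplingDiv {A C E : Type*} [Fintype A] [DecidableEq A] [Fintype C] [DecidableEq C]
    [Fintype E] [DecidableEq E]
    (T : Matrix A A ℂ →ₗ[ℂ] Matrix C C ℂ) (ρ : Matrix (A × E) (A × E) ℂ)
    (U : Matrix.unitaryGroup A ℂ) : EReal :=
  relEntropy (decoupledState T ρ U) (imageOfMixed T ⊗ₖ marginalSnd ρ)

/-- The decoupling error: the Haar average of `D(T(U ρ U^*) ‖ ω_C ⊗ ρ_E)`. -/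
def decouplingError {A C E : Type*} [Fintype A] [DecidableEq A] [Fintype C] [DecidableEq C]
    [Fintype E] [DecidableEq E]
    (T : Matrix A A ℂ →ₗ[ℂ] Matrix C C ℂ) (ρ : Matrix (A × E) (A × E) ℂ) : ℝ :=
  ∫ U, (decouplingDiv T ρ U).toReal ∂(haarUnitary A)

end

/-! Write d = |A|, ω for the Choi operator of T, Z = ρ ⊗ ω, σ = (1 ⊗ ρ_E) ⊗ (1 ⊗ ω_C), and τ for the
decoupled state at U. The proof has two halves: a Haar average giving E D(τ‖ω_C ⊗ ρ_E) ≤ tr Z (log(σ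
+ Z) - log σ), and a deterministic bound of the right-hand side by the sandwiched quasi-entropy Q of
order 1+s. Singular operators are handled by adding ζ·1 and letting ζ tend to 0.

Averaging. Teleportation writes τ = Vᴴ Z V with V linear in the conjugate of U
(`decoupledState_eq`), so tr τ log τ = tr Z V (log τ) Vᴴ. Since -log is an integral of resolvents,
it satisfies a tangent inequality at every fixed Y > 0 which is affine in V Vᴴ and V τ Vᴴ
(`IsResolventPair.trace_tangent`). Hence only E V Vᴴ = 1 and E V τ Vᴴ are needed, that is, second
and fourth Haar moments. The latter average is (d² (σ + Z) - d · cross terms)/(d² - 1). With Y = σ +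
Z + ζ, the excess over σ + Z is absorbed by the cross terms (`schurForm_secondMoment_le`): one
dominates Z by pinching, the other compensates σ through a Jensen inequality for the logarithm. The
reference term is linear in τ, and E τ = ω_C ⊗ ρ_E turns it into tr Z log σ.

Bounding the logarithm. Along Y_c = σ + cZ the derivative of tr Z log Y_c is the form φ(c) of Z with
the reciprocal logarithmic mean as kernel. In the eigenbasis of Y_c, a comparison of this kernel
with divided differences of x^(-θ), θ = s/(1+s), and a three-lines interpolation give φ ≤ Q^s
B^(1-s), where Q(c) is the quasi-entropy of Z relative to Y_c and sB ≤ -Q' (`exists_bkm_bound`).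
Integrating φ ≤ Q^s (-Q'/s)^(1-s) over [0,1] by Jensen's inequality produces exactly s^s
(1-s)^(1-s)/s · Q(0) (`trace_log_add_sub_log_le`). Finally Q is multiplicative on tensor products,
and its two factors are the exponentials of the conditional entropies of ρ and ω, the latter times
tr ω. -/

noncomputable section

open MeasureTheory Set Filter Topology

/-! ### Kernels of resolvent type -/

/-- A matrix of integrals `∫ w a_i a_j` with `w ≥ 0` is positive semidefinite. -/
theorem posSemidef_of_integral {n : Type*} [Fintype n] {α : Type*} [MeasurableSpace α]
    {μ : Measure α} (w : α → ℝ) (a : n → α → ℝ) (k : n → n → ℝ)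
    (hw : ∀ᵐ r ∂μ, 0 ≤ w r)
    (hint : ∀ i j, Integrable (fun r => w r * a i r * a j r) μ)
    (hk : ∀ i j, k i j = ∫ r, w r * a i r * a j r ∂μ) :
    (Matrix.of fun i j => ((k i j : ℝ) : ℂ)).PosSemidef := by
  refine Matrix.PosSemidef.of_dotProduct_mulVec_nonneg ?_ ?_
  · ext i j
    simp only [Matrix.conjTranspose_apply, Matrix.of_apply, RCLike.star_def, Complex.conj_ofReal]
    rw [hk, hk]
    congr 1
    refine integral_congr_ae (Eventually.of_forall fun r => ?_)
    simp only; ring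
  · intro x
    have h : star x ⬝ᵥ (Matrix.of fun i j => ((k i j : ℝ) : ℂ)).mulVec x =
        ∫ r, ((w r * ‖∑ i, (a i r : ℂ) * x i‖ ^ 2 : ℝ) : ℂ) ∂μ := by
      have h1 : ∀ r, ((w r * ‖∑ i, (a i r : ℂ) * x i‖ ^ 2 : ℝ) : ℂ) =
          ∑ i, ∑ j, star (x i) * x j * ((w r * a i r * a j r : ℝ) : ℂ) := by
        intro r
        rw [Complex.ofReal_mul, Complex.ofReal_pow, ← Complex.conj_mul', map_sum,
          Finset.sum_mul_sum, Finset.mul_sum]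
        refine Finset.sum_congr rfl fun i _ => ?_
        rw [Finset.mul_sum]
        refine Finset.sum_congr rfl fun j _ => ?_
        simp only [map_mul, Complex.conj_ofReal, Complex.ofReal_mul, RCLike.star_def]
        ring
      simp_rw [h1]
      have hc : ∀ i j, Integrable (fun r => star (x i) * x j * ((w r * a i r * a j r : ℝ) : ℂ)) μ :=
        fun i j => ((hint i j).ofReal).const_mul _
      rw [integral_finsetSum _ (fun i _ => integrable_finsetSum _ fun j _ => hc i j)]
      simp only [dotProduct, Matrix.mulVec, Matrix.of_apply, Pi.star_apply]
      refine Finset.sum_congr rfl fun i _ => ?_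
      rw [integral_finsetSum _ (fun j _ => hc i j), Finset.mul_sum]
      refine Finset.sum_congr rfl fun j _ => ?_
      rw [integral_const_mul, integral_complex_ofReal, ← hk]
      ring
    rw [h, integral_complex_ofReal]
    have : 0 ≤ ∫ r, w r * ‖∑ i, (a i r : ℂ) * x i‖ ^ 2 ∂μ := by
      refine integral_nonneg_of_ae ?_
      filter_upwards [hw] with r hr
      positivity
    exact_mod_cast this

/-- `f` is the Stieltjes-type function `∫ g(r) / (x + r) dr` (up to an additive constant), with
divided differences `-κ`. -/
structure IsResolventPair (f : ℝ → ℝ) (g : ℝ → ℝ) (κ : ℝ → ℝ → ℝ) : Prop where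
  nonneg : ∀ r ∈ Ioi (0 : ℝ), 0 ≤ g r
  integrable : ∀ x y, 0 < x → 0 < y → IntegrableOn (fun r => g r / ((x + r) * (y + r))) (Ioi 0)
  kernel : ∀ x y, 0 < x → 0 < y → κ x y = ∫ r in Ioi 0, g r / ((x + r) * (y + r))
  sub : ∀ x y, 0 < x → 0 < y → f x - f y = (y - x) * κ x y

namespace IsResolventPair

variable {f g : ℝ → ℝ} {κ : ℝ → ℝ → ℝ} (h : IsResolventPair f g κ)
include h

theorem symm {x y : ℝ} (hx : 0 < x) (hy : 0 < y) : κ x y = κ y x := by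
  rw [h.kernel x y hx hy, h.kernel y x hy hx]
  simp only [mul_comm]

theorem kernel_antitone {x y z : ℝ} (hx : 0 < x) (hy : 0 < y) (hyz : y ≤ z) :
    κ x z ≤ κ x y := by
  have hz : 0 < z := hy.trans_le hyz
  rw [h.kernel x y hx hy, h.kernel x z hx hz]
  refine setIntegral_mono_on (h.integrable _ _ hx hz) (h.integrable _ _ hx hy)
    measurableSet_Ioi fun r hr => ?_
  have := h.nonneg r hr
  have : (0 : ℝ) < r := hr
  gcongr

theorem posSemidef {n : Type*} [Fintype n] (y : n → ℝ) (hy : ∀ i, 0 < y i) :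
    (Matrix.of fun i j => ((κ (y i) (y j) : ℝ) : ℂ)).PosSemidef := by
  have e : ∀ i j r, g r * (1 / (y i + r)) * (1 / (y j + r)) = g r / ((y i + r) * (y j + r)) := by
    intro i j r
    rw [mul_assoc, one_div_mul_one_div, mul_one_div]
  refine posSemidef_of_integral (μ := volume.restrict (Ioi (0 : ℝ))) g
    (fun i r => 1 / (y i + r)) _ ?_ ?_ ?_
  · exact (ae_restrict_iff' measurableSet_Ioi).2 (Eventually.of_forall h.nonneg)
  · intro i j
    simp only [e]
    exact h.integrable _ _ (hy i) (hy j)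
  · intro i j
    simp only [e]
    exact h.kernel _ _ (hy i) (hy j)

/-- For a single resolvent 1/(x + r) the matrix is the rank-one (y_i - t)(y_j - t)/((t + r)(y_i +
r)(y_j + r)); integration against g preserves positivity. This is the convexity of f as a Schur
multiplier: y runs over the spectrum of the base point, and t is one eigenvalue of the argument. -/
theorem posSemidef_tangent {n : Type*} [Fintype n] (y : n → ℝ) (hy : ∀ i, 0 < y i) {t : ℝ}
    (ht : 0 < t) :
    (Matrix.of fun i j =>
      ((f t - f (y i) + (t - y i) * κ (y i) (y j) : ℝ) : ℂ)).PosSemidef := by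
  have e : ∀ i j, ∀ r ∈ Ioi (0 : ℝ),
      g r / (t + r) * ((y i - t) / (y i + r)) * ((y j - t) / (y j + r)) =
      (y i - t) * (g r / ((t + r) * (y i + r)) - g r / ((y i + r) * (y j + r))) := by
    intro i j r hr
    have h1 : t + r ≠ 0 := (add_pos ht hr).ne'
    have h2 : y i + r ≠ 0 := (add_pos (hy i) hr).ne'
    have h3 : y j + r ≠ 0 := (add_pos (hy j) hr).ne'
    field_simp
    ring
  refine posSemidef_of_integral (μ := volume.restrict (Ioi (0 : ℝ))) (fun r => g r / (t + r))
    (fun i r => (y i - t) / (y i + r)) _ ?_ ?_ ?_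
  · refine (ae_restrict_iff' measurableSet_Ioi).2 (Eventually.of_forall fun r hr => ?_)
    have := h.nonneg r hr
    have : (0 : ℝ) < r := hr
    positivity
  · intro i j
    refine IntegrableOn.congr_fun ?_ (fun r hr => (e i j r hr).symm) measurableSet_Ioi
    exact ((h.integrable _ _ ht (hy i)).sub (h.integrable _ _ (hy i) (hy j))).const_mul _
  · intro i j
    rw [setIntegral_congr_fun measurableSet_Ioi (e i j), integral_const_mul,
      integral_sub (h.integrable _ _ ht (hy i)) (h.integrable _ _ (hy i) (hy j)),
      ← h.kernel _ _ ht (hy i), ← h.kernel _ _ (hy i) (hy j), h.sub _ _ ht (hy i)]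
    ring

end IsResolventPair

/-! ### The two resolvent pairs: the logarithm and negative powers -/

/-- The reciprocal of the logarithmic mean. -/
def logKernel (x y : ℝ) : ℝ := ∫ r in Ioi (0 : ℝ), 1 / ((x + r) * (y + r))

theorem logKernel_aux {x y : ℝ} (hx : 0 < x) (hy : 0 < y) :
    IntegrableOn (fun r => 1 / ((x + r) * (y + r))) (Ioi (0 : ℝ)) ∧
      (x = y → ∫ r in Ioi (0 : ℝ), 1 / ((x + r) * (y + r)) = 1 / x) ∧
      (x ≠ y → ∫ r in Ioi (0 : ℝ), 1 / ((x + r) * (y + r)) =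
        (Real.log y - Real.log x) / (y - x)) := by
  by_cases hxy : x = y
  · subst hxy
    have hd : ∀ r ∈ Ici (0 : ℝ), HasDerivAt (fun r => -(x + r)⁻¹) (1 / ((x + r) * (x + r))) r := by
      intro r hr
      have h0 : x + r ≠ 0 := (add_pos_of_pos_of_nonneg hx hr).ne'
      have := (((hasDerivAt_id r).const_add x).inv h0).neg
      refine this.congr_deriv ?_
      simp only [id]
      field_simp
    have hpos : ∀ r ∈ Ioi (0 : ℝ), 0 ≤ 1 / ((x + r) * (x + r)) := fun r hr => by
      have : (0 : ℝ) < r := hr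
      positivity
    have hlim : Tendsto (fun r => -(x + r)⁻¹) atTop (𝓝 (-0)) :=
      (tendsto_inv_atTop_zero.comp (tendsto_atTop_add_const_left _ _ tendsto_id)).neg
    refine ⟨integrableOn_Ioi_deriv_of_nonneg' hd hpos hlim, fun _ => ?_, fun h => (h rfl).elim⟩
    rw [integral_Ioi_of_hasDerivAt_of_nonneg' hd hpos hlim]
    simp
  · have hne : y - x ≠ 0 := sub_ne_zero.2 (Ne.symm hxy)
    have hd : ∀ r ∈ Ici (0 : ℝ), HasDerivAt
        (fun r => (Real.log (x + r) - Real.log (y + r)) / (y - x)) (1 / ((x + r) * (y + r))) r := by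
      intro r hr
      have h0 : x + r ≠ 0 := (add_pos_of_pos_of_nonneg hx hr).ne'
      have h1 : y + r ≠ 0 := (add_pos_of_pos_of_nonneg hy hr).ne'
      have := ((((hasDerivAt_id r).const_add x).log h0).sub
        (((hasDerivAt_id r).const_add y).log h1)).div_const (y - x)
      refine this.congr_deriv ?_
      simp only [id]
      field_simp
      ring
    have hpos : ∀ r ∈ Ioi (0 : ℝ), 0 ≤ 1 / ((x + r) * (y + r)) := fun r hr => by
      have : (0 : ℝ) < r := hr
      positivity
    have hlim : Tendsto (fun r => (Real.log (x + r) - Real.log (y + r)) / (y - x)) atTop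
        (𝓝 (0 / (y - x))) := by
      refine Tendsto.div_const ?_ _
      have h1 : Tendsto (fun r : ℝ => (x - y) / (y + r) + 1) atTop (𝓝 (0 + 1)) :=
        (tendsto_const_nhds.div_atTop
          (tendsto_atTop_add_const_left _ _ tendsto_id)).add_const 1
      have h2 := (Real.continuousAt_log (by norm_num : (0 : ℝ) + 1 ≠ 0)).tendsto.comp h1
      simp only [zero_add, Real.log_one] at h2
      refine h2.congr' ?_
      filter_upwards [eventually_gt_atTop 0] with r hr
      have h0 : x + r ≠ 0 := (add_pos hx hr).ne'
      have h1 : y + r ≠ 0 := (add_pos hy hr).ne'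
      simp only [Function.comp]
      rw [← Real.log_div h0 h1]
      congr 1
      field_simp
      ring
    refine ⟨integrableOn_Ioi_deriv_of_nonneg' hd hpos hlim, fun h => (hxy h).elim, fun _ => ?_⟩
    rw [integral_Ioi_of_hasDerivAt_of_nonneg' hd hpos hlim]
    simp only [add_zero, zero_div]
    field_simp
    ring

theorem logKernel_self {x : ℝ} (hx : 0 < x) : logKernel x x = 1 / x := (logKernel_aux hx hx).2.1 rfl

theorem logKernel_of_ne {x y : ℝ} (hx : 0 < x) (hy : 0 < y) (h : x ≠ y) :
    logKernel x y = (Real.log y - Real.log x) / (y - x) := (logKernel_aux hx hy).2.2 h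

theorem isResolventPair_log :
    IsResolventPair (fun x => -Real.log x) (fun _ => 1) logKernel where
  nonneg _ _ := zero_le_one
  integrable x y hx hy := (logKernel_aux hx hy).1
  kernel x y _ _ := rfl
  sub x y hx hy := by
    by_cases h : x = y
    · subst h; simp
    · rw [logKernel_of_ne hx hy h]
      have : y - x ≠ 0 := sub_ne_zero.2 (Ne.symm h)
      field_simp
      ring

/-- The weight in the integral representation of `x ^ (-θ)`. -/
def rpowWeight (θ r : ℝ) : ℝ :=
  (∫ t in Ioi (0 : ℝ), Real.rpowIntegrand₀₁ (1 - θ) t 1)⁻¹ * r ^ (-θ)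

/-- The negated divided difference of `x ^ (-θ)`. -/
def rpowKernel (θ x y : ℝ) : ℝ := ∫ r in Ioi (0 : ℝ), rpowWeight θ r / ((x + r) * (y + r))

/-- The Loewner integral of x^(1-θ), with integrand r^(-θ) x/(x + r) up to normalization, divided by
x. Unlike for the logarithm the integral itself converges, so the divided differences come from
subtracting two resolvents under the integral. -/
theorem isResolventPair_rpow {θ : ℝ} (h0 : 0 < θ) (h1 : θ < 1) :
    IsResolventPair (fun x => x ^ (-θ)) (rpowWeight θ) (rpowKernel θ) := by
  have hp : 1 - θ ∈ Ioo (0 : ℝ) 1 := ⟨by linarith, by linarith⟩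
  set c := (∫ t in Ioi (0 : ℝ), Real.rpowIntegrand₀₁ (1 - θ) t 1)⁻¹ with hc
  have hc0 : 0 < c := inv_pos.2 (Real.integral_rpowIntegrand₀₁_one_pos hp)
  have e1 : ∀ x, 0 < x → ∀ r ∈ Ioi (0 : ℝ), rpowWeight θ r / (x + r) =
      c * x⁻¹ * Real.rpowIntegrand₀₁ (1 - θ) r x := by
    intro x hx r hr
    rw [Real.rpowIntegrand₀₁_eq_pow_div hp (le_of_lt hr) hx.le, rpowWeight, ← hc]
    have : (1 - θ - 1) = -θ := by ring
    rw [this]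
    have h0 : x + r ≠ 0 := (add_pos hx hr).ne'
    rw [add_comm r x]
    field_simp
  have i1 : ∀ x, 0 < x → IntegrableOn (fun r => rpowWeight θ r / (x + r)) (Ioi 0) := by
    intro x hx
    refine IntegrableOn.congr_fun ?_ (fun r hr => (e1 x hx r hr).symm) measurableSet_Ioi
    exact (Real.integrableOn_rpowIntegrand₀₁_Ioi hp hx.le).const_mul _
  have v1 : ∀ x, 0 < x → ∫ r in Ioi 0, rpowWeight θ r / (x + r) = x ^ (-θ) := by
    intro x hx
    rw [setIntegral_congr_fun measurableSet_Ioi (e1 x hx), integral_const_mul, mul_comm c, mul_assoc,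
      ← Real.rpow_eq_const_mul_integral hp hx.le, ← Real.rpow_neg_one, ← Real.rpow_add hx]
    congr 1; ring
  have hi : ∀ x y, 0 < x → 0 < y →
      IntegrableOn (fun r => rpowWeight θ r / ((x + r) * (y + r))) (Ioi 0) := by
    intro x y hx hy
    have := (i1 x hx).mul_bdd (g := fun r => (y + r)⁻¹) (c := y⁻¹) ?_ ?_
    · refine IntegrableOn.congr_fun this (fun r _ => ?_) measurableSet_Ioi
      simp only [div_eq_mul_inv, mul_inv]; ring
    · exact (Measurable.aestronglyMeasurable (by fun_prop))
    · refine (ae_restrict_iff' measurableSet_Ioi).2 (Eventually.of_forall fun r hr => ?_)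
      have hr' : (0 : ℝ) < r := hr
      rw [Real.norm_of_nonneg (by positivity)]
      gcongr
      linarith
  refine ⟨fun r hr => ?_, hi, fun x y _ _ => rfl, fun x y hx hy => ?_⟩
  · have : (0 : ℝ) < r := hr
    unfold rpowWeight
    rw [← hc]
    positivity
  · rw [← v1 x hx, ← v1 y hy, rpowKernel, ← integral_sub (i1 x hx) (i1 y hy), ← integral_const_mul]
    refine setIntegral_congr_fun measurableSet_Ioi fun r hr => ?_
    have h0 : x + r ≠ 0 := (add_pos hx hr).ne'
    have h1 : y + r ≠ 0 := (add_pos hy hr).ne'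
    field_simp
    ring

end

noncomputable section

open Matrix

/-! ### Diagonalization and functional calculus -/

/-- `A = U diag(a) Uᴴ` with `U` unitary. -/
structure Diagonalizes {n : Type*} [Fintype n] [DecidableEq n] (U : Matrix n n ℂ) (a : n → ℝ)
    (A : Matrix n n ℂ) : Prop where
  left : Uᴴ * U = 1
  right : U * Uᴴ = 1
  eq : A = U * diagonal (fun i => (a i : ℂ)) * Uᴴ

theorem exists_polynomial_eq (S : Finset ℝ) (f : ℝ → ℝ) :
    ∃ q : Polynomial ℝ, ∀ x ∈ S, q.eval x = f x :=
  ⟨Lagrange.interpolate S id f, fun _ hx =>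
    Lagrange.eval_interpolate_at_node f Function.injective_id.injOn hx⟩

namespace Diagonalizes

variable {n : Type*} [Fintype n] [DecidableEq n] {U : Matrix n n ℂ} {a : n → ℝ} {A : Matrix n n ℂ}

theorem isHermitian (h : Diagonalizes U a A) : A.IsHermitian := by
  rw [h.eq]
  refine isHermitian_mul_mul_conjTranspose _ ?_
  rw [IsHermitian, diagonal_conjTranspose]
  congr 1; ext i; simp

theorem mul (h : Diagonalizes U a A) {b : n → ℝ} {B : Matrix n n ℂ} (hB : Diagonalizes U b B) :
    Diagonalizes U (a * b) (A * B) := by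
  refine ⟨h.left, h.right, ?_⟩
  rw [h.eq, hB.eq]
  calc U * diagonal (fun i => (a i : ℂ)) * Uᴴ * (U * diagonal (fun i => (b i : ℂ)) * Uᴴ) =
      U * diagonal (fun i => (a i : ℂ)) * (Uᴴ * U) * diagonal (fun i => (b i : ℂ)) * Uᴴ := by
        simp only [Matrix.mul_assoc]
    _ = _ := by
      rw [h.left, Matrix.mul_one, Matrix.mul_assoc U, diagonal_mul_diagonal]
      simp

theorem add (h : Diagonalizes U a A) {b : n → ℝ} {B : Matrix n n ℂ} (hB : Diagonalizes U b B) :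
    Diagonalizes U (a + b) (A + B) := by
  refine ⟨h.left, h.right, ?_⟩
  rw [h.eq, hB.eq, ← Matrix.add_mul, ← Matrix.mul_add, diagonal_add]
  simp

theorem const_one (h : Diagonalizes U a A) (c : ℝ) :
    Diagonalizes U (fun _ => c) ((c : ℂ) • (1 : Matrix n n ℂ)) := by
  refine ⟨h.left, h.right, ?_⟩
  rw [← smul_one_eq_diagonal, Matrix.mul_smul, Matrix.mul_one, Matrix.smul_mul, h.right]

theorem smul (h : Diagonalizes U a A) (c : ℝ) :
    Diagonalizes U (fun i => c * a i) ((c : ℂ) • A) := by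
  have := (h.const_one c).mul h
  rwa [Matrix.smul_mul, Matrix.one_mul] at this

theorem congr (h : Diagonalizes U a A) {b : n → ℝ} (hb : ∀ i, a i = b i) : Diagonalizes U b A := by
  rwa [show a = b from funext hb] at h

theorem aeval (h : Diagonalizes U a A) (q : Polynomial ℝ) :
    Diagonalizes U (fun i => q.eval (a i)) (Polynomial.aeval A q) := by
  induction q using Polynomial.induction_on' with
  | add p q hp hq =>
    rw [map_add]
    exact (hp.add hq).congr fun i => by simp
  | monomial k c =>
    rw [Polynomial.aeval_monomial]
    have h2 : Diagonalizes U (fun i => a i ^ k) (A ^ k) := by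
      induction k with
      | zero => simpa using h.const_one 1
      | succ k ih =>
        rw [pow_succ]
        exact (ih.mul h).congr fun i => by simp [pow_succ]
    have := (h.const_one c).mul h2
    have e : algebraMap ℝ (Matrix n n ℂ) c = (c : ℂ) • (1 : Matrix n n ℂ) := by
      rw [Algebra.algebraMap_eq_smul_one]
      ext i j; simp
    rw [e]
    exact this.congr fun i => by simp

theorem unique (h : Diagonalizes U a A) {B : Matrix n n ℂ} (hB : Diagonalizes U a B) : A = B :=
  h.eq.trans hB.eq.symm

end Diagonalizes

section
variable {n : Type*} [Fintype n] [DecidableEq n] {A B : Matrix n n ℂ}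

theorem Matrix.IsHermitian.exists_diagonalizes (hA : A.IsHermitian) :
    ∃ U a, Diagonalizes U a A := by
  refine ⟨hA.eigenvectorUnitary, hA.eigenvalues, ?_, ?_, ?_⟩
  · exact Unitary.coe_star_mul_self hA.eigenvectorUnitary
  · exact Unitary.coe_mul_star_self hA.eigenvectorUnitary
  · conv_lhs => rw [hA.spectral_theorem]
    rfl

theorem cfc_eq_aeval (hA : A.IsHermitian) {f : ℝ → ℝ} {q : Polynomial ℝ}
    (hq : ∀ x ∈ spectrum ℝ A, q.eval x = f x) : cfc f A = Polynomial.aeval A q := by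
  rw [← cfc_polynomial q A hA.isSelfAdjoint]
  exact cfc_congr fun x hx => (hq x hx).symm

theorem spectrum_finite (hA : A.IsHermitian) : (spectrum ℝ A).Finite := by
  rw [hA.spectrum_real_eq_range_eigenvalues]
  exact Set.finite_range _

/-- Spectra of matrices are finite, so functional calculus is evaluation of an interpolating
polynomial and no continuity of f is involved. A polynomial common to both operators allows
intertwining relations to pass from powers to `cfc`; the extra set S accommodates eigenvalue lists
not yet identified with a spectrum. -/
theorem exists_cfc_eq_aeval (hA : A.IsHermitian) (hB : B.IsHermitian) (f : ℝ → ℝ)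
    (S : Finset ℝ) : ∃ q : Polynomial ℝ, (∀ x ∈ S, q.eval x = f x) ∧
      cfc f A = Polynomial.aeval A q ∧ cfc f B = Polynomial.aeval B q := by
  obtain ⟨q, hq⟩ := exists_polynomial_eq
    ((spectrum_finite hA).toFinset ∪ (spectrum_finite hB).toFinset ∪ S) f
  refine ⟨q, fun x hx => hq x (by simp [hx]), cfc_eq_aeval hA fun x hx => hq x (by simp [hx]),
    cfc_eq_aeval hB fun x hx => hq x (by simp [hx])⟩

theorem Diagonalizes.cfc {U : Matrix n n ℂ} {a : n → ℝ} (h : Diagonalizes U a A) (f : ℝ → ℝ) :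
    Diagonalizes U (fun i => f (a i)) (cfc f A) := by
  obtain ⟨q, hq, e, -⟩ := exists_cfc_eq_aeval h.isHermitian h.isHermitian f
    (Finset.univ.image a)
  rw [e]
  exact (h.aeval q).congr fun i => hq _ (by simp)

namespace Diagonalizes
variable {U : Matrix n n ℂ} {a : n → ℝ}

theorem conj_eq (h : Diagonalizes U a A) : Uᴴ * A * U = diagonal (fun i => (a i : ℂ)) := by
  rw [h.eq]
  calc Uᴴ * (U * diagonal (fun i => (a i : ℂ)) * Uᴴ) * U =
      (Uᴴ * U) * diagonal (fun i => (a i : ℂ)) * (Uᴴ * U) := by simp only [Matrix.mul_assoc]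
    _ = _ := by rw [h.left, Matrix.one_mul, Matrix.mul_one]

theorem nonneg (h : Diagonalizes U a A) (hA : A.PosSemidef) (i : n) : 0 ≤ a i := by
  have := hA.conjTranspose_mul_mul_same U
  rw [h.conj_eq, posSemidef_diagonal_iff] at this
  exact_mod_cast this i

theorem posSemidef (h : Diagonalizes U a A) (ha : ∀ i, 0 ≤ a i) : A.PosSemidef := by
  rw [h.eq]
  refine PosSemidef.mul_mul_conjTranspose_same (posSemidef_diagonal_iff.2 fun i => ?_) U
  exact_mod_cast ha i

theorem trace_eq (h : Diagonalizes U a A) : A.trace = ∑ i, (a i : ℂ) := by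
  rw [h.eq, trace_mul_comm, ← Matrix.mul_assoc, h.left, Matrix.one_mul, trace_diagonal]

theorem pos (h : Diagonalizes U a A) (hA : A.PosDef) (i : n) : 0 < a i := by
  have hU : Function.Injective U.mulVec := by
    intro v w hvw
    have : Uᴴ *ᵥ (U *ᵥ v) = Uᴴ *ᵥ (U *ᵥ w) := by rw [hvw]
    simpa [h.left] using this
  have := hA.conjTranspose_mul_mul_same hU
  rw [h.conj_eq] at this
  have h2 := this.diag_pos (i := i)
  simpa using h2

theorem posDef (h : Diagonalizes U a A) (ha : ∀ i, 0 < a i) : A.PosDef := by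
  have hU : Function.Injective Uᴴ.mulVec := by
    intro v w hvw
    have : U *ᵥ (Uᴴ *ᵥ v) = U *ᵥ (Uᴴ *ᵥ w) := by rw [hvw]
    simpa [h.right] using this
  have h1 : (diagonal (fun i => (a i : ℂ))).PosDef := PosDef.diagonal fun i => by
    exact_mod_cast ha i
  have := h1.conjTranspose_mul_mul_same hU
  rwa [conjTranspose_conjTranspose, ← h.eq] at this

theorem kronecker {m : Type*} [Fintype m] [DecidableEq m] (h : Diagonalizes U a A)
    {V B : Matrix m m ℂ} {b : m → ℝ} (hB : Diagonalizes V b B) :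
    Diagonalizes (U ⊗ₖ V) (fun i => a i.1 * b i.2) (A ⊗ₖ B) := by
  refine ⟨?_, ?_, ?_⟩
  · rw [conjTranspose_kronecker, ← mul_kronecker_mul, h.left, hB.left, one_kronecker_one]
  · rw [conjTranspose_kronecker, ← mul_kronecker_mul, h.right, hB.right, one_kronecker_one]
  · rw [conjTranspose_kronecker, h.eq, hB.eq, mul_kronecker_mul, mul_kronecker_mul,
      diagonal_kronecker_diagonal]
    simp

end Diagonalizes

theorem cfc_posSemidef (hA : A.IsHermitian) {f : ℝ → ℝ} (hf : ∀ x, 0 ≤ f x) :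
    (cfc f A).PosSemidef := by
  obtain ⟨U, a, h⟩ := hA.exists_diagonalizes
  exact (h.cfc f).posSemidef fun i => hf _

theorem cfc_posSemidef_of_nonneg (hA : A.PosSemidef) {f : ℝ → ℝ} (hf : ∀ x, 0 ≤ x → 0 ≤ f x) :
    (cfc f A).PosSemidef := by
  obtain ⟨U, a, h⟩ := hA.isHermitian.exists_diagonalizes
  exact (h.cfc f).posSemidef fun i => hf _ (h.nonneg hA i)

theorem cfc_isHermitian (hA : A.IsHermitian) (f : ℝ → ℝ) : (cfc f A).IsHermitian := by
  obtain ⟨U, a, h⟩ := hA.exists_diagonalizes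
  exact (h.cfc f).isHermitian

theorem cfc_mul_cfc (hA : A.IsHermitian) (f g : ℝ → ℝ) :
    cfc f A * cfc g A = cfc (fun x => f x * g x) A := by
  obtain ⟨U, a, h⟩ := hA.exists_diagonalizes
  exact ((h.cfc f).mul (h.cfc g)).unique (h.cfc fun x => f x * g x)

theorem cfc_comp_cfc (hA : A.IsHermitian) (f g : ℝ → ℝ) :
    cfc f (cfc g A) = cfc (fun x => f (g x)) A := by
  obtain ⟨U, a, h⟩ := hA.exists_diagonalizes
  exact ((h.cfc g).cfc f).unique (h.cfc fun x => f (g x))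

theorem cfc_congr_of_nonneg (hA : A.PosSemidef) {f g : ℝ → ℝ} (hf : ∀ x, 0 ≤ x → f x = g x) :
    cfc f A = cfc g A := by
  obtain ⟨U, a, h⟩ := hA.isHermitian.exists_diagonalizes
  exact (h.cfc f).unique ((h.cfc g).congr fun i => (hf _ (h.nonneg hA i)).symm)

theorem cfc_congr_of_pos (hA : A.PosDef) {f g : ℝ → ℝ} (hf : ∀ x, 0 < x → f x = g x) :
    cfc f A = cfc g A := by
  obtain ⟨U, a, h⟩ := hA.isHermitian.exists_diagonalizes
  exact (h.cfc f).unique ((h.cfc g).congr fun i => (hf _ (h.pos hA i)).symm)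

theorem cfc_id_eq (hA : A.IsHermitian) : cfc (fun x : ℝ => x) A = A := by
  obtain ⟨U, a, h⟩ := hA.exists_diagonalizes
  exact (h.cfc _).unique h

theorem cfc_one_eq (hA : A.IsHermitian) : cfc (fun _ : ℝ => (1 : ℝ)) A = 1 := by
  obtain ⟨U, a, h⟩ := hA.exists_diagonalizes
  have := (h.cfc fun _ => 1).unique (h.const_one 1)
  simpa using this

/-! ### Traces of products -/

theorem trace_mul_re_nonneg (hA : A.PosSemidef) (hB : B.PosSemidef) :
    0 ≤ (A * B).trace.re := by
  obtain ⟨U, b, h⟩ := hB.isHermitian.exists_diagonalizes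
  have hb := h.nonneg hB
  have hd := hA.conjTranspose_mul_mul_same U
  have e : (A * B).trace = ∑ i, (Uᴴ * A * U) i i * (b i : ℂ) := by
    conv_lhs => rw [h.eq]
    rw [show A * (U * diagonal (fun i => (b i : ℂ)) * Uᴴ) =
      A * U * diagonal (fun i => (b i : ℂ)) * Uᴴ by simp only [Matrix.mul_assoc],
      trace_mul_comm, ← Matrix.mul_assoc, ← Matrix.mul_assoc, Matrix.trace]
    simp [mul_diagonal]
  rw [e, Complex.re_sum]
  refine Finset.sum_nonneg fun i _ => ?_
  have h1 := (Complex.nonneg_iff.1 (hd.diag_nonneg (i := i)))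
  rw [Complex.re_mul_ofReal]
  exact mul_nonneg h1.1 (hb i)

/-- The sum is tr ((S ⊙ K) Z), and S ⊙ K is positive by the Schur product theorem. -/
theorem hadamard_sum_nonneg {Z S K : Matrix n n ℂ} (hZ : Z.PosSemidef) (hS : S.PosSemidef)
    (hK : K.PosSemidef) : 0 ≤ (∑ i, ∑ j, Z j i * S i j * K i j).re := by
  have h := trace_mul_re_nonneg (hS.hadamard hK) hZ
  convert h using 2
  simp only [Matrix.trace, diag_apply, Matrix.mul_apply, hadamard_apply]
  exact Finset.sum_congr rfl fun i _ => Finset.sum_congr rfl fun j _ => by ring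

theorem trace_mul_re_mono {Z : Matrix n n ℂ} (hZ : Z.PosSemidef) (hAB : (B - A).PosSemidef) :
    (Z * A).trace.re ≤ (Z * B).trace.re := by
  have := trace_mul_re_nonneg hZ hAB
  rw [Matrix.mul_sub, trace_sub, Complex.sub_re] at this
  linarith

theorem trace_mul_diagonalizes {U V : Matrix n n ℂ} {a b : n → ℝ} (hA : Diagonalizes U a A)
    (hB : Diagonalizes V b B) :
    (A * B).trace.re = ∑ i, ∑ j, a i * b j * ‖(Uᴴ * V) i j‖ ^ 2 := by
  have e : (A * B).trace = ∑ i, ∑ j, ((a i * b j * ‖(Uᴴ * V) i j‖ ^ 2 : ℝ) : ℂ) := by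
    rw [hA.eq, hB.eq]
    rw [show U * diagonal (fun i => (a i : ℂ)) * Uᴴ * (V * diagonal (fun i => (b i : ℂ)) * Vᴴ) =
      U * (diagonal (fun i => (a i : ℂ)) * (Uᴴ * V) * diagonal (fun i => (b i : ℂ)) * Vᴴ) by
        simp only [Matrix.mul_assoc], trace_mul_comm]
    rw [show (diagonal (fun i => (a i : ℂ)) * (Uᴴ * V) * diagonal (fun i => (b i : ℂ)) * Vᴴ) * U =
      diagonal (fun i => (a i : ℂ)) * (Uᴴ * V) * diagonal (fun i => (b i : ℂ)) * (Uᴴ * V)ᴴ by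
        rw [conjTranspose_mul, conjTranspose_conjTranspose]; simp only [Matrix.mul_assoc]]
    rw [Matrix.trace]
    refine Finset.sum_congr rfl fun i _ => ?_
    rw [diag_apply, Matrix.mul_apply]
    refine Finset.sum_congr rfl fun j _ => ?_
    rw [mul_diagonal, diagonal_mul, conjTranspose_apply]
    push_cast
    rw [← Complex.mul_conj']
    simp only [RCLike.star_def]
    ring
  rw [e]
  simp only [← Complex.ofReal_sum, Complex.ofReal_re]

/-- All traces are double sums over the two spectra with the common nonnegative weights |(Uᴴ
V)_ij|², so the scalar tangent inequality can be summed termwise. -/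
theorem klein_inequality {f f' : ℝ → ℝ} {S : Set ℝ}
    (hf : ∀ x ∈ S, ∀ y ∈ S, f y + f' y * (x - y) ≤ f x) {U V : Matrix n n ℂ} {a b : n → ℝ}
    (hA : Diagonalizes U a A) (hB : Diagonalizes V b B) (ha : ∀ i, a i ∈ S) (hb : ∀ i, b i ∈ S) :
    (cfc f B).trace.re + (cfc f' B * (A - B)).trace.re ≤ (cfc f A).trace.re := by
  have hone := trace_mul_diagonalizes (hA.const_one 1) (hB.cfc f)
  have h1 := trace_mul_diagonalizes (hA.cfc f) (hB.const_one 1)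
  have h2 := trace_mul_diagonalizes hA (hB.cfc f')
  have h3 := trace_mul_diagonalizes (hA.const_one 1) ((hB.cfc f').mul hB)
  simp only [Complex.ofReal_one, one_smul, one_mul, mul_one,
    Pi.mul_apply] at hone h1 h2 h3
  rw [Matrix.mul_sub, trace_sub, Complex.sub_re, trace_mul_comm _ A, hone, h1, h2, h3,
    ← Finset.sum_sub_distrib, ← Finset.sum_add_distrib]
  refine Finset.sum_le_sum fun i _ => ?_
  rw [← Finset.sum_sub_distrib, ← Finset.sum_add_distrib]
  refine Finset.sum_le_sum fun j _ => ?_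
  have := mul_le_mul_of_nonneg_right (hf _ (ha i) _ (hb j)) (sq_nonneg ‖(Uᴴ * V) i j‖)
  linarith

theorem Real.rpow_tangent_le {p : ℝ} (hp : 1 ≤ p) {x y : ℝ} (hx : 0 ≤ x) (hy : 0 ≤ y) :
    y ^ p + p * y ^ (p - 1) * (x - y) ≤ x ^ p := by
  rcases hy.eq_or_lt with rfl | hy
  · rcases hp.eq_or_lt with rfl | hp
    · simp
    · rw [Real.zero_rpow (by linarith), Real.zero_rpow (by linarith)]
      simpa using Real.rpow_nonneg hx p
  · have h := one_add_mul_self_le_rpow_one_add (s := x / y - 1) (p := p)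
      (by have := div_nonneg hx hy.le; linarith) hp
    have h2 := mul_le_mul_of_nonneg_right h (Real.rpow_nonneg hy.le p)
    rw [show 1 + (x / y - 1) = x / y by ring, ← Real.mul_rpow (div_nonneg hx hy.le) hy.le,
      div_mul_cancel₀ _ hy.ne'] at h2
    refine le_trans (le_of_eq ?_) h2
    rw [Real.rpow_sub_one hy.ne']
    field_simp

theorem trace_rpow_tangent (hA : A.PosSemidef) (hB : B.PosSemidef) {p : ℝ} (hp : 1 ≤ p) :
    (cfc (fun x : ℝ => x ^ p) B).trace.re +
      p * (cfc (fun x : ℝ => x ^ (p - 1)) B * (A - B)).trace.re ≤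
      (cfc (fun x : ℝ => x ^ p) A).trace.re := by
  obtain ⟨U, a, h⟩ := hA.isHermitian.exists_diagonalizes
  obtain ⟨V, b, h'⟩ := hB.isHermitian.exists_diagonalizes
  have := klein_inequality (S := Set.Ici 0) (f := fun x => x ^ p)
    (f' := fun x => p * x ^ (p - 1)) (fun x hx y hy => Real.rpow_tangent_le hp hx hy) h h'
    (h.nonneg hA) (h'.nonneg hB)
  have e : cfc (fun x : ℝ => p * x ^ (p - 1)) B = (p : ℂ) • cfc (fun x : ℝ => x ^ (p - 1)) B :=
    (h'.cfc _).unique ((h'.cfc fun x : ℝ => x ^ (p - 1)).smul p)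
  rw [e, Matrix.smul_mul, trace_smul, smul_eq_mul, Complex.re_ofReal_mul] at this
  exact this

theorem trace_rpow_mono (hA : A.PosSemidef) (hAB : (B - A).PosSemidef) {p : ℝ} (hp : 1 ≤ p) :
    (cfc (fun x : ℝ => x ^ p) A).trace.re ≤ (cfc (fun x : ℝ => x ^ p) B).trace.re := by
  have hB : B.PosSemidef := by simpa using hAB.add hA
  have h := trace_rpow_tangent hB hA hp
  have h2 := trace_mul_re_nonneg
    (cfc_posSemidef_of_nonneg hA (f := fun x => x ^ (p - 1)) fun x hx => Real.rpow_nonneg hx _) hAB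
  have : 0 ≤ p * (cfc (fun x : ℝ => x ^ (p - 1)) A * (B - A)).trace.re :=
    mul_nonneg (by linarith) h2
  linarith

/-! ### `A Aᴴ` against `Aᴴ A` -/

theorem mul_aeval_comm (X Y : Matrix n n ℂ) (q : Polynomial ℝ) :
    X * Polynomial.aeval (Y * X) q = Polynomial.aeval (X * Y) q * X := by
  induction q using Polynomial.induction_on' with
  | add p q hp hq => simp only [map_add, Matrix.mul_add, Matrix.add_mul, hp, hq]
  | monomial k c =>
    rw [Polynomial.aeval_monomial, Polynomial.aeval_monomial, ← Matrix.mul_assoc,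
      ← Algebra.commutes, Matrix.mul_assoc, Matrix.mul_assoc]
    congr 1
    induction k with
    | zero => simp
    | succ k ih => rw [pow_succ, ← Matrix.mul_assoc, ih, pow_succ]; simp only [Matrix.mul_assoc]

theorem mul_cfc_conjTranspose_mul (X : Matrix n n ℂ) (f : ℝ → ℝ) :
    X * cfc f (Xᴴ * X) = cfc f (X * Xᴴ) * X := by
  obtain ⟨q, -, h1, h2⟩ := exists_cfc_eq_aeval (isHermitian_conjTranspose_mul_self X)
    (isHermitian_mul_conjTranspose_self X) f ∅
  rw [h1, h2, mul_aeval_comm]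

theorem mul_cfc_mul_conjTranspose (X : Matrix n n ℂ) (f : ℝ → ℝ) :
    X * cfc f (Xᴴ * X) * Xᴴ = cfc (fun x => f x * x) (X * Xᴴ) := by
  have h := isHermitian_mul_conjTranspose_self X
  rw [mul_cfc_conjTranspose_mul, Matrix.mul_assoc, ← cfc_mul_cfc h, cfc_id_eq h]

/-- The factorization x^p = x^(p-1) · x moves one factor X around the trace. It is used to pass from
Y^(-θ/2) X Y^(-θ/2) to √X Y^(-θ) √X, where Y occurs only once. -/
theorem trace_rpow_mul_conjTranspose (X : Matrix n n ℂ) {p : ℝ} (hp : 1 < p) :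
    (cfc (fun x : ℝ => x ^ p) (X * Xᴴ)).trace = (cfc (fun x : ℝ => x ^ p) (Xᴴ * X)).trace := by
  have e : ∀ Y : Matrix n n ℂ, Y.PosSemidef → cfc (fun x : ℝ => x ^ p) Y =
      cfc (fun x : ℝ => x ^ (p - 1) * x) Y := fun Y hY => cfc_congr_of_nonneg hY fun x hx => by
    rw [← Real.rpow_add_one' hx (by linarith)]; simp
  rw [e _ (posSemidef_self_mul_conjTranspose X), e _ (posSemidef_conjTranspose_mul_self X),
    ← mul_cfc_mul_conjTranspose, trace_mul_comm, ← Matrix.mul_assoc,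
    ← cfc_mul_cfc (isHermitian_conjTranspose_mul_self X),
    cfc_id_eq (isHermitian_conjTranspose_mul_self X), trace_mul_comm]

end

end

noncomputable section

open Matrix

/-! ### Weighted trace forms in the eigenbasis of a reference operator -/

section
variable {n : Type*} [Fintype n] [DecidableEq n]

/-- `Re ∑ Z_ji S_ij w_ij`, the entries taken in the basis given by the columns of `U`. -/
def schurForm (w : n → n → ℝ) (U Z : Matrix n n ℂ) : Matrix n n ℂ →ₗ[ℝ] ℝ where
  toFun S := (∑ i, ∑ j, (Uᴴ * Z * U) j i * (Uᴴ * S * U) i j * w i j).re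
  map_add' S T := by
    rw [← Complex.add_re, ← Finset.sum_add_distrib]
    congr 1
    refine Finset.sum_congr rfl fun i _ => ?_
    rw [← Finset.sum_add_distrib]
    refine Finset.sum_congr rfl fun j _ => ?_
    rw [Matrix.mul_add, Matrix.add_mul, Matrix.add_apply]
    ring
  map_smul' c S := by
    rw [RingHom.id_apply, smul_eq_mul, ← Complex.re_ofReal_mul, Finset.mul_sum]
    congr 1
    refine Finset.sum_congr rfl fun i _ => ?_
    rw [Finset.mul_sum]
    refine Finset.sum_congr rfl fun j _ => ?_
    rw [Matrix.mul_smul, Matrix.smul_mul, Matrix.smul_apply, Complex.real_smul]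
    ring

omit [DecidableEq n] in
theorem schurForm_apply (w : n → n → ℝ) (U Z S : Matrix n n ℂ) :
    schurForm w U Z S = (∑ i, ∑ j, (Uᴴ * Z * U) j i * (Uᴴ * S * U) i j * w i j).re := rfl

theorem schurForm_nonneg {w : n → n → ℝ} (hw : (Matrix.of fun i j => (w i j : ℂ)).PosSemidef)
    (U : Matrix n n ℂ) {Z S : Matrix n n ℂ} (hZ : Z.PosSemidef) (hS : S.PosSemidef) :
    0 ≤ schurForm w U Z S :=
  hadamard_sum_nonneg (hZ.conjTranspose_mul_mul_same U) (hS.conjTranspose_mul_mul_same U) hw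

theorem schurForm_one (w : n → n → ℝ) {U Z Y : Matrix n n ℂ} {y : n → ℝ}
    (h : Diagonalizes U y Y) :
    schurForm w U Z 1 = (Z * (U * diagonal (fun i => (w i i : ℂ)) * Uᴴ)).trace.re := by
  rw [schurForm_apply, Matrix.mul_one, h.left]
  congr 1
  rw [show Z * (U * diagonal (fun i => (w i i : ℂ)) * Uᴴ) =
    Z * U * diagonal (fun i => (w i i : ℂ)) * Uᴴ by simp only [Matrix.mul_assoc], trace_mul_comm,
    ← Matrix.mul_assoc, ← Matrix.mul_assoc, Matrix.trace]
  simp [mul_diagonal, Matrix.one_apply]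

theorem schurForm_self (w : n → n → ℝ) {U Z Y : Matrix n n ℂ} {y : n → ℝ}
    (h : Diagonalizes U y Y) :
    schurForm w U Z Y = schurForm (fun i j => y i * w i j) U Z 1 := by
  rw [schurForm_apply, schurForm_apply, h.conj_eq, Matrix.mul_one, h.left]
  congr 1
  refine Finset.sum_congr rfl fun i _ => Finset.sum_congr rfl fun j _ => ?_
  by_cases hij : i = j
  · subst hij; simp; ring
  · simp [hij]

omit [DecidableEq n] in
theorem schurForm_add_weight (v w : n → n → ℝ) (U Z S : Matrix n n ℂ) :
    schurForm (fun i j => v i j + w i j) U Z S = schurForm v U Z S + schurForm w U Z S := by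
  simp only [schurForm_apply]
  rw [← Complex.add_re, ← Finset.sum_add_distrib]
  congr 1
  refine Finset.sum_congr rfl fun i _ => ?_
  rw [← Finset.sum_add_distrib]
  refine Finset.sum_congr rfl fun j _ => ?_
  push_cast
  ring

theorem Diagonalizes.trace_mul_eq_sum {U Y : Matrix n n ℂ} {y : n → ℝ} (hY : Diagonalizes U y Y)
    (Z S : Matrix n n ℂ) :
    (Z * S).trace = ∑ i, ∑ j, (Uᴴ * Z * U) j i * (Uᴴ * S * U) i j := by
  have : (Z * S).trace = (Uᴴ * S * U * (Uᴴ * Z * U)).trace := by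
    rw [show Uᴴ * S * U * (Uᴴ * Z * U) = Uᴴ * (S * (U * Uᴴ) * (Z * U)) by
      simp only [Matrix.mul_assoc], hY.right, Matrix.mul_one, trace_mul_comm Uᴴ,
      show S * (Z * U) * Uᴴ = S * Z * (U * Uᴴ) by simp only [Matrix.mul_assoc], hY.right,
      Matrix.mul_one, trace_mul_comm]
  rw [this, Matrix.trace]
  refine Finset.sum_congr rfl fun i _ => ?_
  rw [diag_apply, Matrix.mul_apply]
  exact Finset.sum_congr rfl fun j _ => mul_comm _ _

/-! ### Tangent inequalities for functions of resolvent type -/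

/-- The tangent inequality for a function of resolvent type, compressed by `V`. -/
theorem IsResolventPair.trace_tangent {f g : ℝ → ℝ} {κ : ℝ → ℝ → ℝ} (h : IsResolventPair f g κ)
    {m : Type*} [Fintype m] [DecidableEq m] {U Y Z : Matrix n n ℂ} {y : n → ℝ}
    (hy : ∀ i, 0 < y i) (hZ : Z.PosSemidef) (V : Matrix n m ℂ)
    {τ : Matrix m m ℂ} (hτ : τ.PosDef) (hY : Diagonalizes U y Y) :
    schurForm (fun i j => f (y i) + y i * κ (y i) (y j)) U Z (V * Vᴴ) -
      schurForm (fun i j => κ (y i) (y j)) U Z (V * τ * Vᴴ) ≤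
      (Z * (V * cfc f τ * Vᴴ)).trace.re := by
  obtain ⟨W, t, hW⟩ := hτ.isHermitian.exists_diagonalizes
  have ht := hW.pos hτ
  -- The columns of X are the eigenvectors of τ, mapped by V and read in the eigenbasis of Y.
  set X := Uᴴ * V * W with hX
  set Z' := Uᴴ * Z * U with hZ'
  have hZ'p : Z'.PosSemidef := hZ.conjTranspose_mul_mul_same U
  -- One inequality for each eigenvalue t_k, weighted by the rank-one matrix of the k-th column.
  -- Splitting the weight as f(t_k) - (f(y_i) + y_i κ) + t_k κ and summing over k reproduces V f(τ)
  -- Vᴴ, V Vᴴ and V τ Vᴴ.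
  have key : ∀ k, 0 ≤ (∑ i, ∑ j, Z' j i * (X i k * star (X j k)) *
      ((f (t k) - f (y i) + (t k - y i) * κ (y i) (y j) : ℝ) : ℂ)).re := fun k => by
    have := hadamard_sum_nonneg hZ'p (posSemidef_vecMulVec_self_star fun i => X i k)
      (h.posSemidef_tangent y hy (ht k))
    simpa only [vecMulVec_apply, of_apply, Pi.star_apply] using this
  have hsum : ∀ (c : m → ℝ) {B : Matrix m m ℂ}, Diagonalizes W c B → ∀ i j,
      (Uᴴ * (V * B * Vᴴ) * U) i j = ∑ k, X i k * star (X j k) * c k := by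
    intro c B hB i j
    have : Uᴴ * (V * B * Vᴴ) * U = X * diagonal (fun k => (c k : ℂ)) * Xᴴ := by
      rw [hB.eq, hX, conjTranspose_mul, conjTranspose_mul, conjTranspose_conjTranspose]
      simp only [Matrix.mul_assoc]
    rw [this, Matrix.mul_apply]
    refine Finset.sum_congr rfl fun k _ => ?_
    rw [mul_diagonal, conjTranspose_apply]
    ring
  have h1 := hsum _ (hW.const_one 1)
  have h2 := hsum _ hW
  have h3 := hsum _ (hW.cfc f)
  have e3 : (Z * (V * cfc f τ * Vᴴ)).trace =
      ∑ i, ∑ j, Z' j i * (Uᴴ * (V * cfc f τ * Vᴴ) * U) i j :=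
    hY.trace_mul_eq_sum _ _
  have hfin := Finset.sum_nonneg fun k (_ : k ∈ Finset.univ) => key k
  rw [← Complex.re_sum] at hfin
  simp only [Complex.ofReal_one, one_smul, Matrix.mul_one] at h1
  rw [e3, schurForm_apply, schurForm_apply, ← sub_nonneg, ← Complex.sub_re, ← Complex.sub_re]
  refine le_of_le_of_eq hfin ?_
  congr 1
  rw [Finset.sum_comm, ← Finset.sum_sub_distrib, ← Finset.sum_sub_distrib]
  refine Finset.sum_congr rfl fun i _ => ?_
  rw [Finset.sum_comm, ← Finset.sum_sub_distrib, ← Finset.sum_sub_distrib]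
  refine Finset.sum_congr rfl fun j _ => ?_
  rw [h1, h2, h3]
  simp only [Finset.mul_sum, Finset.sum_mul]
  rw [← Finset.sum_sub_distrib, ← Finset.sum_sub_distrib]
  refine Finset.sum_congr rfl fun k _ => ?_
  push_cast
  ring

/-- The offset weight evaluates to `tr Z f(Y)` up to the kernel form at `Y`. -/
theorem schurForm_offset_one {f : ℝ → ℝ} {κ : ℝ → ℝ → ℝ} {U Y Z : Matrix n n ℂ} {y : n → ℝ}
    (hY : Diagonalizes U y Y) :
    schurForm (fun i j => f (y i) + y i * κ (y i) (y j)) U Z 1 =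
      (Z * cfc f Y).trace.re + schurForm (fun i j => κ (y i) (y j)) U Z Y := by
  rw [schurForm_add_weight, schurForm_self _ hY, schurForm_one _ hY, ← (hY.cfc f).eq]

/-- Operator Jensen in tangent form: the single bound is affine in V Vᴴ and V τ Vᴴ, so summing under
∑ V Vᴴ = 1 replaces the offset by its value at the identity, and only the deviation of ∑ V τ Vᴴ from
Y remains. -/
theorem IsResolventPair.trace_tangent_family {f g : ℝ → ℝ} {κ : ℝ → ℝ → ℝ}
    (h : IsResolventPair f g κ) {ι m : Type*} [Fintype ι] [Fintype m] [DecidableEq m]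
    {U Y Z : Matrix n n ℂ} {y : n → ℝ}
    (hy : ∀ i, 0 < y i) (hZ : Z.PosSemidef) (V : ι → Matrix n m ℂ)
    {τ : ι → Matrix m m ℂ} (hτ : ∀ i, (τ i).PosDef) (hY : Diagonalizes U y Y)
    (hV : ∑ i, V i * (V i)ᴴ = 1) :
    (Z * cfc f Y).trace.re -
      schurForm (fun i j => κ (y i) (y j)) U Z (∑ i, V i * τ i * (V i)ᴴ - Y) ≤
      ∑ i, (Z * (V i * cfc f (τ i) * (V i)ᴴ)).trace.re := by
  have := Finset.sum_le_sum fun i (_ : i ∈ Finset.univ) =>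
    h.trace_tangent hy hZ (V i) (hτ i) hY
  rw [Finset.sum_sub_distrib, ← map_sum, ← map_sum, hV, schurForm_offset_one hY] at this
  rw [map_sub]
  linarith

theorem IsResolventPair.trace_tangent_one {f g : ℝ → ℝ} {κ : ℝ → ℝ → ℝ}
    (h : IsResolventPair f g κ) {U Y Z τ : Matrix n n ℂ} {y : n → ℝ}
    (hy : ∀ i, 0 < y i) (hZ : Z.PosSemidef) (hτ : τ.PosDef) (hY : Diagonalizes U y Y) :
    (Z * cfc f Y).trace.re - schurForm (fun i j => κ (y i) (y j)) U Z (τ - Y) ≤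
      (Z * cfc f τ).trace.re := by
  have := h.trace_tangent_family hy hZ (fun _ : Unit => (1 : Matrix n n ℂ)) (fun _ => hτ) hY
    (by simp)
  simpa using this

theorem cfc_neg_log {τ : Matrix n n ℂ} (hτ : τ.IsHermitian) :
    cfc (fun x => -Real.log x) τ = -cfc Real.log τ := by
  obtain ⟨U, a, h⟩ := hτ.exists_diagonalizes
  have := (h.cfc fun x => -Real.log x).unique
    (((h.cfc Real.log).smul (-1)).congr fun i => by simp)
  simpa using this

/-- The tangent inequality for the logarithm. -/
theorem trace_mul_log_le {U Y Z τ : Matrix n n ℂ} {y : n → ℝ}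
    (hy : ∀ i, 0 < y i) (hZ : Z.PosSemidef) (hτ : τ.PosDef) (hY : Diagonalizes U y Y) :
    (Z * cfc Real.log τ).trace.re ≤ (Z * cfc Real.log Y).trace.re +
      schurForm (fun i j => logKernel (y i) (y j)) U Z (τ - Y) := by
  have := isResolventPair_log.trace_tangent_one hy hZ hτ hY
  rw [cfc_neg_log hτ.isHermitian, cfc_neg_log hY.isHermitian] at this
  simp only [Matrix.mul_neg, trace_neg, Complex.neg_re] at this
  linarith

end

end

noncomputable section

open MeasureTheory Set Filter Topology

/-! ### Comparison of the logarithmic and the power kernel -/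

/-- The geometric mean is at most the logarithmic mean: under the integral, (x + r)(y + r) ≥ (√(xy)
+ r)² by the arithmetic-geometric inequality. -/
theorem logKernel_le_inv_sqrt {x y : ℝ} (hx : 0 < x) (hy : 0 < y) :
    logKernel x y ≤ 1 / √(x * y) := by
  have hm : 0 < √(x * y) := Real.sqrt_pos.2 (mul_pos hx hy)
  rw [← logKernel_self hm]
  have hi := isResolventPair_log.integrable
  refine setIntegral_mono_on (hi _ _ hx hy) (hi _ _ hm hm) measurableSet_Ioi fun r hr => ?_
  have hr' : (0 : ℝ) < r := hr
  have h1 := Real.sq_sqrt (mul_pos hx hy).le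
  have h2 : 2 * √(x * y) ≤ x + y := by
    rw [Real.sqrt_mul hx.le]
    nlinarith [sq_nonneg (√x - √y), Real.sq_sqrt hx.le, Real.sq_sqrt hy.le]
  refine one_div_le_one_div_of_le (by positivity) ?_
  nlinarith

theorem logKernel_pos {x y : ℝ} (hx : 0 < x) (hy : 0 < y) : 0 < logKernel x y := by
  have hz : 0 < max x y := lt_max_of_lt_left hx
  have h := isResolventPair_log
  have h1 := h.kernel_antitone hx hy (le_max_right x y)
  have h2 := h.kernel_antitone hz hx (le_max_left x y)
  rw [h.symm hz hx, logKernel_self hz] at h2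
  have := one_div_pos.2 hz
  linarith

/-- With v = θ log(y/x)/2, the difference x^(-θ) - y^(-θ) equals 2 √(xy)^(-θ) sinh v, and sinh v ≥
v. -/
theorem rpowKernel_ge_of_lt {θ : ℝ} (h0 : 0 < θ) (h1 : θ < 1) {x y : ℝ} (hx : 0 < x)
    (hxy : x < y) : θ * (√(x * y) ^ (-θ) * logKernel x y) ≤ rpowKernel θ x y := by
  have hy := hx.trans hxy
  have hd : 0 < y - x := sub_pos.2 hxy
  have hs := (isResolventPair_rpow h0 h1).sub x y hx hy
  rw [logKernel_of_ne hx hy hxy.ne]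
  have hk : rpowKernel θ x y = (x ^ (-θ) - y ^ (-θ)) / (y - x) := by
    rw [hs]; field_simp
  rw [hk, ← mul_div_assoc, ← mul_div_assoc]
  refine div_le_div_of_nonneg_right ?_ hd.le
  set v := θ * ((Real.log y - Real.log x) / 2) with hv
  have hv0 : 0 ≤ v := by
    have := Real.log_le_log hx hxy.le
    rw [hv]; exact mul_nonneg h0.le (by linarith)
  have hlm : Real.log √(x * y) = (Real.log x + Real.log y) / 2 := by
    rw [Real.log_sqrt (mul_pos hx hy).le, Real.log_mul hx.ne' hy.ne']
  have hm : 0 < √(x * y) := Real.sqrt_pos.2 (mul_pos hx hy)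
  have e1 : x ^ (-θ) = √(x * y) ^ (-θ) * Real.exp v := by
    rw [Real.rpow_def_of_pos hx, Real.rpow_def_of_pos hm, ← Real.exp_add, hlm, hv]
    congr 1; ring
  have e2 : y ^ (-θ) = √(x * y) ^ (-θ) * Real.exp (-v) := by
    rw [Real.rpow_def_of_pos hy, Real.rpow_def_of_pos hm, ← Real.exp_add, hlm, hv]
    congr 1; ring
  have hsinh := Real.self_le_sinh_iff.2 hv0
  rw [Real.sinh_eq] at hsinh
  rw [e1, e2, ← mul_sub]
  have : θ * (√(x * y) ^ (-θ) * (Real.log y - Real.log x)) = √(x * y) ^ (-θ) * (2 * v) := by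
    rw [hv]; ring
  rw [this]
  exact mul_le_mul_of_nonneg_left (by linarith) (Real.rpow_nonneg hm.le _)

theorem rpowKernel_ge {θ : ℝ} (h0 : 0 < θ) (h1 : θ < 1) {x y : ℝ} (hx : 0 < x) (hy : 0 < y) :
    θ * (√(x * y) ^ (-θ) * logKernel x y) ≤ rpowKernel θ x y := by
  have hr := isResolventPair_rpow h0 h1
  have hl := isResolventPair_log
  rcases lt_trichotomy x y with h | h | h
  · exact rpowKernel_ge_of_lt h0 h1 hx h
  · subst h
    -- The diagonal case is the limit z ↓ x. Continuity of the kernels is not needed: by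
    -- monotonicity 1/z ≤ `logKernel x z` and `rpowKernel θ x z` ≤ `rpowKernel θ x x`, so only the
    -- explicit left-hand side has to converge.
    have hlim : Tendsto (fun z : ℝ => θ * (√(x * z) ^ (-θ) * (1 / z))) (𝓝[>] x)
        (𝓝 (θ * (√(x * x) ^ (-θ) * (1 / x)))) := by
      refine Tendsto.mono_left ?_ nhdsWithin_le_nhds
      have hm : √(x * x) ≠ 0 := (Real.sqrt_pos.2 (mul_pos hx hx)).ne'
      have c1 : ContinuousAt (fun z : ℝ => √(x * z)) x := by fun_prop
      have c2 : ContinuousAt (fun z : ℝ => √(x * z) ^ (-θ)) x := c1.rpow_const (Or.inl hm)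
      have c3 : ContinuousAt (fun z : ℝ => 1 / z) x := continuousAt_const.div continuousAt_id hx.ne'
      exact (continuousAt_const.mul (c2.mul c3)).tendsto
    rw [logKernel_self hx]
    refine le_of_tendsto hlim ?_
    filter_upwards [self_mem_nhdsWithin] with z hz
    have hz' : x < z := hz
    have hz0 := hx.trans hz'
    have a1 := rpowKernel_ge_of_lt h0 h1 hx hz'
    have a2 := hr.kernel_antitone hx hx hz'.le
    have a3 := hl.kernel_antitone hz0 hx hz'.le
    rw [logKernel_self hz0, hl.symm hz0 hx] at a3
    refine le_trans ?_ (a1.trans a2)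
    gcongr
  · rw [hr.symm hx hy, hl.symm hx hy, mul_comm x y]
    exact rpowKernel_ge_of_lt h0 h1 hy h

theorem rpowKernel_pos {θ : ℝ} (h0 : 0 < θ) (h1 : θ < 1) {x y : ℝ} (hx : 0 < x) (hy : 0 < y) :
    0 < rpowKernel θ x y := by
  have hm : 0 < √(x * y) := Real.sqrt_pos.2 (mul_pos hx hy)
  exact lt_of_lt_of_le (mul_pos h0 (mul_pos (Real.rpow_pos_of_pos hm _) (logKernel_pos hx hy)))
    (rpowKernel_ge h0 h1 hx hy)

/-- The kernel `(xy)^θ (x^(-θ) - y^(-θ)) / (θ (y - x))`. -/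
def symRpowKernel (θ x y : ℝ) : ℝ := x ^ θ * y ^ θ * rpowKernel θ x y / θ

theorem symRpowKernel_pos {θ : ℝ} (h0 : 0 < θ) (h1 : θ < 1) {x y : ℝ} (hx : 0 < x) (hy : 0 < y) :
    0 < symRpowKernel θ x y := by
  have := rpowKernel_pos h0 h1 hx hy
  unfold symRpowKernel
  positivity

theorem symRpowKernel_symm {θ : ℝ} (h0 : 0 < θ) (h1 : θ < 1) {x y : ℝ} (hx : 0 < x)
    (hy : 0 < y) : symRpowKernel θ x y = symRpowKernel θ y x := by
  unfold symRpowKernel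
  rw [(isResolventPair_rpow h0 h1).symm hx hy, mul_comm (x ^ θ)]

theorem symRpowKernel_posSemidef {θ : ℝ} (h0 : 0 < θ) (h1 : θ < 1) {n : Type*} [Fintype n]
    [DecidableEq n] (y : n → ℝ) (hy : ∀ i, 0 < y i) :
    (Matrix.of fun i j => ((symRpowKernel θ (y i) (y j) : ℝ) : ℂ)).PosSemidef := by
  have h := ((isResolventPair_rpow h0 h1).posSemidef y hy).mul_mul_conjTranspose_same
    (Matrix.diagonal fun i => ((y i ^ θ : ℝ) : ℂ))
  have h2 := h.smul (a := ((1 / θ : ℝ) : ℂ)) (by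
    rw [Complex.zero_le_real]; positivity)
  convert h2 using 1
  ext i j
  simp only [Matrix.of_apply, symRpowKernel, Matrix.smul_apply, Matrix.diagonal_conjTranspose,
    Matrix.mul_diagonal, Matrix.diagonal_mul, smul_eq_mul, Pi.star_apply, RCLike.star_def,
    Complex.conj_ofReal]
  push_cast
  ring

/-- With m = √(xy) and L the logarithmic kernel, split m^(2θ) L into m^(2θ) L^s and L^(1-s). The
first uses L ≤ 1/m, the second m^θ L ≤ `symRpowKernel`; the powers of m match because 2θ - s = θ(1 -
s) for θ = s/(1+s). -/
theorem mul_logKernel_le {s : ℝ} (hs0 : 0 < s) (hs1 : s ≤ 1) {x y : ℝ} (hx : 0 < x) (hy : 0 < y) :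
    x ^ (s / (1 + s)) * y ^ (s / (1 + s)) * logKernel x y ≤
      symRpowKernel (s / (1 + s)) x y ^ (1 - s) := by
  set θ := s / (1 + s) with hθ
  have h0 : 0 < θ := by positivity
  have h1 : θ < 1 := by rw [hθ, div_lt_one (by linarith)]; linarith
  set m := √(x * y) with hm
  have hm0 : 0 < m := Real.sqrt_pos.2 (mul_pos hx hy)
  have hl := logKernel_pos hx hy
  have hxy : x ^ θ * y ^ θ = m ^ (2 * θ) := by
    rw [← Real.mul_rpow hx.le hy.le, Real.rpow_mul hm0.le, hm, Real.rpow_two,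
      Real.sq_sqrt (mul_pos hx hy).le]
  have hk : m ^ θ * logKernel x y ≤ symRpowKernel θ x y := by
    unfold symRpowKernel
    rw [hxy, le_div_iff₀ h0]
    calc m ^ θ * logKernel x y * θ = m ^ (2 * θ) * (θ * (m ^ (-θ) * logKernel x y)) := by
          rw [show θ = 2 * θ + -θ by ring, Real.rpow_add hm0]; ring_nf
      _ ≤ _ := mul_le_mul_of_nonneg_left (rpowKernel_ge h0 h1 hx hy) (Real.rpow_nonneg hm0.le _)
  have hk2 := Real.rpow_le_rpow (by positivity) hk (by linarith : 0 ≤ 1 - s)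
  refine le_trans ?_ hk2
  have hml : logKernel x y ^ s ≤ m ^ (-s) := by
    have := Real.rpow_le_rpow hl.le (logKernel_le_inv_sqrt hx hy) hs0.le
    rwa [one_div, Real.inv_rpow hm0.le, ← Real.rpow_neg hm0.le] at this
  rw [hxy, Real.mul_rpow (by positivity) hl.le, ← Real.rpow_mul hm0.le]
  calc m ^ (2 * θ) * logKernel x y = m ^ (2 * θ) * logKernel x y ^ s * logKernel x y ^ (1 - s) := by
        rw [mul_assoc, ← Real.rpow_add hl]; simp
    _ ≤ m ^ (2 * θ) * m ^ (-s) * logKernel x y ^ (1 - s) := by gcongr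
    _ = _ := by
        rw [← Real.rpow_add hm0]
        congr 2
        rw [hθ]; field_simp; ring

/-! ### Interpolation between Schur-weighted Hilbert-Schmidt norms -/

section
open Matrix
variable {n : Type*} [Fintype n] [DecidableEq n]

/-- T a b is the quadratic form of the positive kernel k at a vector with entries of the form V_ia
times the conjugate of V_ib, up to conjugation, hence nonnegative. It depends on V alone, so
inequalities between weighted norms of functions of one operator reduce to scalar inequalities
between eigenvalues. -/
theorem exists_weight_form {k : n → n → ℝ} (hk : (Matrix.of fun i j => (k i j : ℂ)).PosSemidef)
    (hsymm : ∀ i j, k i j = k j i) (V : Matrix n n ℂ) :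
    ∃ T : n → n → ℝ, (∀ a b, 0 ≤ T a b) ∧ (∀ a b, T a b = T b a) ∧ ∀ e e' : n → ℂ,
      ∑ i, ∑ j, (k i j : ℂ) * (V * diagonal e * Vᴴ) i j * star ((V * diagonal e' * Vᴴ) i j) =
        ∑ a, ∑ b, (T a b : ℂ) * e a * star (e' b) := by
  set T : n → n → ℂ := fun a b => ∑ i, ∑ j, (k i j : ℂ) * (V i a * star (V i b)) *
    star (V j a * star (V j b)) with hT
  have hT0 : ∀ a b, 0 ≤ T a b := by
    intro a b
    have := hk.dotProduct_mulVec_nonneg (fun i => star (V i a * star (V i b)))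
    convert this using 1
    simp only [hT, dotProduct, mulVec, Pi.star_apply, of_apply, star_star, Finset.mul_sum]
    exact Finset.sum_congr rfl fun i _ => Finset.sum_congr rfl fun j _ => by ring
  have hTs : ∀ a b, T a b = T b a := by
    intro a b
    simp only [hT]
    rw [Finset.sum_comm]
    refine Finset.sum_congr rfl fun i _ => Finset.sum_congr rfl fun j _ => ?_
    rw [hsymm j i]
    simp only [star_mul', star_star]
    ring
  refine ⟨fun a b => (T a b).re, fun a b => (Complex.nonneg_iff.1 (hT0 a b)).1,
    fun a b => by simp only [hTs a b], fun e e' => ?_⟩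
  have hre : ∀ a b, ((T a b).re : ℂ) = T a b := fun a b =>
    (Complex.eq_re_of_ofReal_le (r := 0) (by simpa using hT0 a b)).symm
  simp only [hre]
  have hent : ∀ (e : n → ℂ) i j, (V * diagonal e * Vᴴ) i j = ∑ a, V i a * e a * star (V j a) := by
    intro e i j
    rw [Matrix.mul_apply]
    simp [mul_diagonal]
  simp only [hent, hT, Finset.sum_mul, Finset.mul_sum, star_sum]
  have swap : ∀ F : n → n → n → n → ℂ, ∑ i, ∑ j, ∑ b, ∑ a, F i j a b =
      ∑ a, ∑ b, ∑ i, ∑ j, F i j a b := by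
    intro F
    calc ∑ i, ∑ j, ∑ b, ∑ a, F i j a b = ∑ i, ∑ j, ∑ a, ∑ b, F i j a b :=
          Finset.sum_congr rfl fun i _ => Finset.sum_congr rfl fun j _ => Finset.sum_comm
      _ = ∑ i, ∑ a, ∑ j, ∑ b, F i j a b := Finset.sum_congr rfl fun i _ => Finset.sum_comm
      _ = ∑ a, ∑ i, ∑ j, ∑ b, F i j a b := Finset.sum_comm
      _ = ∑ a, ∑ i, ∑ b, ∑ j, F i j a b :=
          Finset.sum_congr rfl fun i _ => Finset.sum_congr rfl fun j _ => Finset.sum_comm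
      _ = ∑ a, ∑ b, ∑ i, ∑ j, F i j a b := Finset.sum_congr rfl fun i _ => Finset.sum_comm
  rw [swap]
  refine Finset.sum_congr rfl fun a _ => Finset.sum_congr rfl fun b _ =>
    Finset.sum_congr rfl fun i _ => Finset.sum_congr rfl fun j _ => ?_
  simp only [star_mul', star_star]
  ring

theorem weight_form_le {k : n → n → ℝ} (hk : (Matrix.of fun i j => (k i j : ℂ)).PosSemidef)
    (hsymm : ∀ i j, k i j = k j i) (V : Matrix n n ℂ) (e : n → ℂ) (r : n → ℝ)
    (hr : ∀ a, ‖e a‖ ≤ r a) :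
    ∑ i, ∑ j, k i j * ‖(V * diagonal e * Vᴴ) i j‖ ^ 2 ≤
      ∑ i, ∑ j, k i j * ‖(V * diagonal (fun a => (r a : ℂ)) * Vᴴ) i j‖ ^ 2 := by
  obtain ⟨T, hT0, -, hT⟩ := exists_weight_form hk hsymm V
  have hre : ∀ e : n → ℂ, ((∑ i, ∑ j, k i j * ‖(V * diagonal e * Vᴴ) i j‖ ^ 2 : ℝ) : ℂ) =
      ∑ a, ∑ b, (T a b : ℂ) * e a * star (e b) := by
    intro e
    rw [← hT]
    push_cast
    refine Finset.sum_congr rfl fun i _ => Finset.sum_congr rfl fun j _ => ?_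
    rw [mul_assoc (k i j : ℂ), RCLike.star_def, Complex.mul_conj']
  have h2 := congrArg Complex.re (hre e)
  have h3 := congrArg Complex.re (hre fun a => (r a : ℂ))
  rw [Complex.ofReal_re] at h2 h3
  rw [h2, h3]
  simp only [Complex.re_sum]
  refine Finset.sum_le_sum fun a _ => Finset.sum_le_sum fun b _ => ?_
  refine (Complex.re_le_norm _).trans ?_
  have h4 : ((T a b : ℂ) * r a * star (r b : ℂ)).re = T a b * r a * r b := by
    simp [RCLike.star_def, Complex.conj_ofReal]
  rw [h4, norm_mul, norm_mul, norm_star, Complex.norm_real, Real.norm_of_nonneg (hT0 a b)]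
  have := (norm_nonneg _).trans (hr a)
  exact mul_le_mul (mul_le_mul_of_nonneg_left (hr a) (hT0 a b)) (hr b) (norm_nonneg _)
    (mul_nonneg (hT0 a b) this)

/-- After symmetrizing in the eigenvalue indices this is the arithmetic-geometric inequality κ_a
κ_b^p + κ_b κ_a^p ≥ 2 (κ_a κ_b)^((p+1)/2). -/
theorem sum_weight_rpow_mul_ge {k : n → n → ℝ}
    (hk : (Matrix.of fun i j => (k i j : ℂ)).PosSemidef)
    (hsymm : ∀ i j, k i j = k j i) (V : Matrix n n ℂ) (κ : n → ℝ) (hκ : ∀ a, 0 ≤ κ a) {p : ℝ}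
    (hp : 0 < p) :
    ∑ i, ∑ j, k i j * ‖(V * diagonal (fun a => ((κ a ^ ((p + 1) / 2) : ℝ) : ℂ)) * Vᴴ) i j‖ ^ 2 ≤
      (∑ i, ∑ j, (k i j : ℂ) * (V * diagonal (fun a => (κ a : ℂ)) * Vᴴ) i j *
        star ((V * diagonal (fun a => ((κ a ^ p : ℝ) : ℂ)) * Vᴴ) i j)).re := by
  obtain ⟨T, hT0, hTs, hT⟩ := exists_weight_form hk hsymm V
  have hre : ∀ e : n → ℂ, ((∑ i, ∑ j, k i j * ‖(V * diagonal e * Vᴴ) i j‖ ^ 2 : ℝ) : ℂ) =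
      ∑ a, ∑ b, (T a b : ℂ) * e a * star (e b) := by
    intro e
    rw [← hT]
    push_cast
    refine Finset.sum_congr rfl fun i _ => Finset.sum_congr rfl fun j _ => ?_
    rw [mul_assoc (k i j : ℂ), RCLike.star_def, Complex.mul_conj']
  have h2 := congrArg Complex.re (hre fun a => ((κ a ^ ((p + 1) / 2) : ℝ) : ℂ))
  rw [Complex.ofReal_re] at h2
  rw [h2, hT]
  simp only [Complex.re_sum, RCLike.star_def, Complex.conj_ofReal, ← Complex.ofReal_mul,
    Complex.ofReal_re]
  have hpt : ∀ a b, 2 * (T a b * κ a ^ ((p + 1) / 2) * κ b ^ ((p + 1) / 2)) ≤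
      T a b * κ a * κ b ^ p + T b a * κ b * κ a ^ p := by
    intro a b
    rw [hTs b a]
    have : 2 * (κ a ^ ((p + 1) / 2) * κ b ^ ((p + 1) / 2)) ≤ κ a * κ b ^ p + κ b * κ a ^ p := by
      have ha := hκ a
      have hb := hκ b
      have e1 : ∀ x : ℝ, 0 ≤ x → x ^ ((p + 1) / 2) = x ^ (p / 2) * x ^ (1 / 2 : ℝ) := fun x hx => by
        rw [← Real.rpow_add_of_nonneg hx (by positivity) (by positivity)]; ring_nf
      have e2 : ∀ x : ℝ, 0 ≤ x → x ^ p = (x ^ (p / 2)) ^ 2 := fun x hx => by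
        rw [← Real.rpow_natCast, ← Real.rpow_mul hx]; norm_num
      have e3 : ∀ x : ℝ, 0 ≤ x → x = (x ^ (1 / 2 : ℝ)) ^ 2 := fun x hx => by
        rw [← Real.rpow_natCast, ← Real.rpow_mul hx]; norm_num
      rw [e1 _ ha, e1 _ hb, e2 _ ha, e2 _ hb]
      nlinarith [sq_nonneg (κ a ^ (1 / 2 : ℝ) * κ b ^ (p / 2) - κ b ^ (1 / 2 : ℝ) * κ a ^ (p / 2)),
        e3 _ ha, e3 _ hb]
    have := mul_le_mul_of_nonneg_left this (hT0 a b)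
    linarith
  have hs := Finset.sum_le_sum fun a (_ : a ∈ Finset.univ) =>
    Finset.sum_le_sum fun b (_ : b ∈ Finset.univ) => hpt a b
  simp only [Finset.sum_add_distrib, ← Finset.mul_sum] at hs
  rw [Finset.sum_comm (f := fun a b => T b a * κ b * κ a ^ p)] at hs
  linarith

open Complex.HadamardThreeLines in
/-- Three lines theorem for Schur-weighted Hilbert-Schmidt norms of powers. -/
theorem weight_form_interpolation {k : n → n → ℝ}
    (hk : (Matrix.of fun i j => (k i j : ℂ)).PosSemidef) (hkpos : ∀ i j, 0 < k i j)
    (hsymm : ∀ i j, k i j = k j i) (V : Matrix n n ℂ) (κ : n → ℝ) (hκ : ∀ a, 0 ≤ κ a) {s : ℝ}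
    (hs0 : 0 < s) (hs1 : s ≤ 1) :
    ∑ i, ∑ j, k i j ^ (1 - s) * ‖(V * diagonal (fun a => (κ a : ℂ)) * Vᴴ) i j‖ ^ 2 ≤
      (∑ i, ∑ j, ‖(V * diagonal (fun a => ((κ a ^ ((1 + s) / 2) : ℝ) : ℂ)) * Vᴴ) i j‖ ^ 2) ^ s *
      (∑ i, ∑ j, k i j * ‖(V * diagonal (fun a => ((κ a ^ ((1 + s + 1) / 2) : ℝ) : ℂ)) * Vᴴ) i j‖
        ^ 2) ^ (1 - s) := by
  -- The exponent has real part (1+s)/2 on the left edge and (2+s)/2 on the right edge, and equals 1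
  -- at z = 1 - s, the point of interpolation.
  set α : ℂ → ℂ := fun z => (1 + s + z) / 2 with hα
  have hαre : ∀ z, (α z).re = (1 + s + z.re) / 2 := by
    intro z
    simp only [hα]
    rw [show ((1 : ℂ) + s + z) / 2 = ((1 / 2 : ℝ) : ℂ) * (1 + s + z) by push_cast; ring,
      Complex.re_ofReal_mul]
    simp; ring
  -- Powers of a zero eigenvalue are put equal to 0. This agrees with real powers, since the real
  -- part of the exponent stays positive on the strip, and keeps the family entire.
  set e : ℂ → n → ℂ := fun z a =>
    if κ a = 0 then 0 else Complex.exp (α z * (Real.log (κ a) : ℂ)) with he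
  have henorm : ∀ z, 0 < (α z).re → ∀ a, ‖e z a‖ = κ a ^ (α z).re := by
    intro z hz a
    simp only [he]
    split_ifs with h
    · rw [h, Real.zero_rpow hz.ne', norm_zero]
    · rw [Complex.norm_exp, Complex.re_mul_ofReal,
        Real.rpow_def_of_pos (lt_of_le_of_ne (hκ a) (Ne.symm h)), mul_comm]
  have hent : ∀ (e : n → ℂ) i j, (V * diagonal e * Vᴴ) i j = ∑ a, V i a * e a * star (V j a) := by
    intro e i j
    rw [Matrix.mul_apply]
    simp [mul_diagonal]
  set A : ℂ → Matrix n n ℂ := fun z => V * diagonal (e z) * Vᴴ with hA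
  -- The product A_ij A_ji is used in place of |A_ij|² to be holomorphic in z; the two agree at real
  -- z, where A is Hermitian.
  set f : ℂ → ℂ := fun z =>
    ∑ i, ∑ j, Complex.exp (z * (Real.log (k i j) : ℂ)) * A z i j * A z j i with hf
  have hed : ∀ a, Differentiable ℂ fun z => e z a := by
    intro a
    simp only [he, hα]
    split_ifs
    · fun_prop
    · fun_prop
  have hAd : ∀ i j, Differentiable ℂ fun z => A z i j := by
    intro i j
    simp only [hA, hent]
    have := hed
    fun_prop
  have hfd : Differentiable ℂ f := by
    simp only [hf]
    fun_prop
  have hknorm : ∀ z i j, ‖Complex.exp (z * (Real.log (k i j) : ℂ))‖ = k i j ^ z.re := by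
    intro z i j
    rw [Complex.norm_exp, Complex.re_mul_ofReal, Real.rpow_def_of_pos (hkpos i j), mul_comm]
  have hpos : ∀ z : ℂ, 0 ≤ z.re → 0 < (α z).re := fun z hz => by rw [hαre]; linarith
  -- On a vertical line the modulus is bounded by a weighted Hilbert-Schmidt norm, using A_ij A_ji ≤
  -- (|A_ij|² + |A_ji|²)/2 in modulus; `weight_form_le` then discards the imaginary parts of the
  -- exponents.
  have hline : ∀ w : n → n → ℝ, (Matrix.of fun i j => (w i j : ℂ)).PosSemidef →
      (∀ i j, 0 ≤ w i j) → (∀ i j, w i j = w j i) → ∀ z : ℂ, 0 ≤ z.re →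
      (∀ i j, ‖Complex.exp (z * (Real.log (k i j) : ℂ))‖ = w i j) → ‖f z‖ ≤
      ∑ i, ∑ j, w i j * ‖(V * diagonal (fun a => ((κ a ^ (α z).re : ℝ) : ℂ)) * Vᴴ) i j‖ ^ 2 := by
    intro w hw hw0 hws z hz hwz
    refine le_trans ?_ (weight_form_le hw hws V (e z) _ fun a => (henorm z (hpos z hz) a).le)
    have h1 : ‖f z‖ ≤ ∑ i, ∑ j, w i j * ‖A z i j‖ * ‖A z j i‖ := by
      refine (norm_sum_le _ _).trans (Finset.sum_le_sum fun i _ => ?_)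
      refine (norm_sum_le _ _).trans (Finset.sum_le_sum fun j _ => ?_)
      rw [norm_mul, norm_mul, hwz]
    have h2 : ∀ i j, 2 * (w i j * ‖A z i j‖ * ‖A z j i‖) ≤
        w i j * ‖A z i j‖ ^ 2 + w j i * ‖A z j i‖ ^ 2 := by
      intro i j
      rw [← hws i j]
      nlinarith [mul_nonneg (hw0 i j) (sq_nonneg (‖A z i j‖ - ‖A z j i‖))]
    have hs := Finset.sum_le_sum fun a (_ : a ∈ Finset.univ) =>
      Finset.sum_le_sum fun b (_ : b ∈ Finset.univ) => h2 a b
    simp only [Finset.sum_add_distrib, ← Finset.mul_sum] at hs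
    rw [Finset.sum_comm (f := fun i j => w j i * ‖A z j i‖ ^ 2)] at hs
    linarith
  have hone : (Matrix.of fun _ _ : n => ((1 : ℝ) : ℂ)).PosSemidef := by
    convert posSemidef_vecMulVec_self_star (fun _ : n => (1 : ℂ)) using 1
    ext i j; simp [vecMulVec_apply]
  have hbdd : BddAbove ((norm ∘ f) '' verticalClosedStrip 0 1) := by
    refine ⟨∑ i, ∑ j, Real.exp |Real.log (k i j)| *
      (∑ a, ‖V i a‖ * Real.exp (2 * |Real.log (κ a)|) * ‖V j a‖) *
      (∑ a, ‖V j a‖ * Real.exp (2 * |Real.log (κ a)|) * ‖V i a‖), ?_⟩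
    rintro _ ⟨z, hz, rfl⟩
    have hz0 : 0 ≤ z.re := hz.1
    have hz1 : z.re ≤ 1 := hz.2
    have b1 : ∀ a, ‖e z a‖ ≤ Real.exp (2 * |Real.log (κ a)|) := by
      intro a
      simp only [he]
      split_ifs
      · rw [norm_zero]; positivity
      · rw [Complex.norm_exp, Complex.re_mul_ofReal, hαre]
        refine Real.exp_le_exp.2 (le_trans (le_abs_self _) ?_)
        rw [abs_mul]
        refine mul_le_mul_of_nonneg_right ?_ (abs_nonneg _)
        rw [abs_of_nonneg (by linarith)]
        linarith
    have b2 : ∀ i j, ‖A z i j‖ ≤ ∑ a, ‖V i a‖ * Real.exp (2 * |Real.log (κ a)|) * ‖V j a‖ := by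
      intro i j
      simp only [hA, hent]
      refine (norm_sum_le _ _).trans (Finset.sum_le_sum fun a _ => ?_)
      rw [norm_mul, norm_mul, norm_star]
      have := b1 a
      gcongr
    have b3 : ∀ i j, ‖Complex.exp (z * (Real.log (k i j) : ℂ))‖ ≤
        Real.exp |Real.log (k i j)| := by
      intro i j
      rw [Complex.norm_exp, Complex.re_mul_ofReal]
      refine Real.exp_le_exp.2 (le_trans (le_abs_self _) ?_)
      rw [abs_mul, abs_of_nonneg hz0]
      exact mul_le_of_le_one_left (abs_nonneg _) hz1
    simp only [Function.comp]
    refine (norm_sum_le _ _).trans (Finset.sum_le_sum fun i _ => ?_)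
    refine (norm_sum_le _ _).trans (Finset.sum_le_sum fun j _ => ?_)
    rw [norm_mul, norm_mul]
    have h1 := b2 i j
    have h2 := b2 j i
    have h3 := b3 i j
    have := (norm_nonneg _).trans h1
    gcongr
  have hmem : ((1 - s : ℝ) : ℂ) ∈ verticalClosedStrip 0 1 := by
    refine ⟨?_, ?_⟩
    · rw [Complex.ofReal_re]; linarith
    · rw [Complex.ofReal_re]; linarith
  have hmain := norm_le_interp_of_mem_verticalClosedStrip₀₁' f hmem hfd.diffContOnCl hbdd
    (a := ∑ i, ∑ j, ‖(V * diagonal (fun a => ((κ a ^ ((1 + s) / 2) : ℝ) : ℂ)) * Vᴴ) i j‖ ^ 2)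
    (b := ∑ i, ∑ j, k i j *
      ‖(V * diagonal (fun a => ((κ a ^ ((1 + s + 1) / 2) : ℝ) : ℂ)) * Vᴴ) i j‖ ^ 2)
    (fun z hz => by
      have hz' : z.re = 0 := hz
      have := hline (fun _ _ => 1) hone (fun _ _ => zero_le_one) (fun _ _ => rfl) z hz'.ge
        (fun i j => by rw [hknorm, hz', Real.rpow_zero])
      rw [hαre, hz', add_zero] at this
      simpa only [one_mul] using this)
    (fun z hz => by
      have hz' : z.re = 1 := hz
      have := hline k hk (fun i j => (hkpos i j).le) hsymm z (by rw [hz']; exact zero_le_one)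
        (fun i j => by rw [hknorm, hz', Real.rpow_one])
      rwa [hαre, hz'] at this)
  have hα1 : α ((1 - s : ℝ) : ℂ) = 1 := by simp only [hα]; push_cast; ring
  have he1 : e ((1 - s : ℝ) : ℂ) = fun a => (κ a : ℂ) := by
    ext a
    simp only [he, hα1, one_mul]
    split_ifs with h
    · rw [h, Complex.ofReal_zero]
    · rw [← Complex.ofReal_exp, Real.exp_log (lt_of_le_of_ne (hκ a) (Ne.symm h))]
  rw [Complex.ofReal_re, sub_sub_cancel] at hmain
  refine le_trans (le_of_eq ?_) hmain
  have hval : f ((1 - s : ℝ) : ℂ) = ((∑ i, ∑ j, k i j ^ (1 - s) *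
      ‖(V * diagonal (fun a => (κ a : ℂ)) * Vᴴ) i j‖ ^ 2 : ℝ) : ℂ) := by
    simp only [hf, hA, he1]
    push_cast
    refine Finset.sum_congr rfl fun i _ => Finset.sum_congr rfl fun j _ => ?_
    have hstar : (V * diagonal (fun a => (κ a : ℂ)) * Vᴴ) j i =
        star ((V * diagonal (fun a => (κ a : ℂ)) * Vᴴ) i j) := by
      simp only [hent, star_sum, star_mul', Complex.conj_conj, RCLike.star_def, Complex.conj_ofReal]
      exact Finset.sum_congr rfl fun a _ => by ring
    rw [hstar, RCLike.star_def, mul_assoc (Complex.exp _), Complex.mul_conj',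
      Real.rpow_def_of_pos (hkpos i j), Complex.ofReal_exp]
    congr 2
    push_cast
    ring
  rw [hval, Complex.norm_real, Real.norm_of_nonneg]
  exact Finset.sum_nonneg fun i _ => Finset.sum_nonneg fun j _ =>
    mul_nonneg (Real.rpow_nonneg (hkpos i j).le _) (sq_nonneg _)

end

end

noncomputable section

open Matrix

section
variable {n : Type*} [Fintype n] [DecidableEq n]

/-! ### Monotonicity of the sandwiched quasi-entropy along a segment -/

theorem sandwichedQ_one_add {s : ℝ} (hs : 0 < s) (X Y : Matrix n n ℂ) :
    sandwichedQ (1 + s) X Y = (cfc (fun x : ℝ => x ^ (1 + s))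
      (cfc (fun x : ℝ => x ^ (-(s / (1 + s) / 2))) Y * X *
        cfc (fun x : ℝ => x ^ (-(s / (1 + s) / 2))) Y)).trace.re := by
  have : (1 - (1 + s)) / (2 * (1 + s)) = -(s / (1 + s) / 2) := by
    field_simp; ring
  simp only [sandwichedQ, psdPow, this]

theorem Diagonalizes.conj_cfc_mul_mul {U Y : Matrix n n ℂ} {y : n → ℝ} (h : Diagonalizes U y Y)
    (f : ℝ → ℝ) (X : Matrix n n ℂ) (i j : n) :
    (Uᴴ * (_root_.cfc f Y * X * _root_.cfc f Y) * U) i j = f (y i) * f (y j) * (Uᴴ * X * U) i j := by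
  rw [(h.cfc f).eq]
  set D := diagonal (fun i => (f (y i) : ℂ))
  rw [show Uᴴ * (U * D * Uᴴ * X * (U * D * Uᴴ)) * U = (Uᴴ * U) * D * (Uᴴ * X * U) * D * (Uᴴ * U) by
    simp only [Matrix.mul_assoc], h.left, Matrix.one_mul, Matrix.mul_one, mul_diagonal,
    diagonal_mul]
  ring

theorem Matrix.PosSemidef.exists_sqrt {X : Matrix n n ℂ} (hX : X.PosSemidef) :
    ∃ R : Matrix n n ℂ, R.PosSemidef ∧ R * R = X := by
  refine ⟨cfc Real.sqrt X, cfc_posSemidef hX.isHermitian Real.sqrt_nonneg, ?_⟩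
  rw [cfc_mul_cfc hX.isHermitian, cfc_congr_of_nonneg hX (g := fun x => x)
    fun x hx => Real.mul_self_sqrt hx, cfc_id_eq hX.isHermitian]

theorem sandwichedQ_nonneg {s : ℝ} (hs : 0 < s) {X Y : Matrix n n ℂ} (hX : X.PosSemidef)
    (hY : Y.IsHermitian) : 0 ≤ sandwichedQ (1 + s) X Y := by
  rw [sandwichedQ_one_add hs]
  have h := hX.conjTranspose_mul_mul_same (cfc (fun x : ℝ => x ^ (-(s / (1 + s) / 2))) Y)
  rw [(cfc_isHermitian hY _).eq] at h
  exact (Complex.nonneg_iff.1 (cfc_posSemidef_of_nonneg h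
    (f := fun x => x ^ (1 + s)) fun x hx => Real.rpow_nonneg hx _).trace_nonneg).1

/-- Put K = Y^(-θ/2) X Y^(-θ/2) and p = 1 + s. In the eigenbasis of Y, the logarithmic form of X
becomes a weighted Hilbert-Schmidt norm of K whose weight is at most k^(1-s), with k =
`symRpowKernel`. Interpolation bounds it by the powers s and 1-s of ∑ |K^(p/2)|² = Q and ∑ k
|K^((p+1)/2)|² = B. The same B bounds from below the growth of Q when δX is subtracted from Y, which
makes B comparable with the negative derivative along the segment. -/
theorem exists_bkm_bound {s : ℝ} (hs0 : 0 < s) (hs1 : s ≤ 1) {U X Y : Matrix n n ℂ} {y : n → ℝ}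
    (hX : X.PosSemidef) (hy : ∀ i, 0 < y i) (hY : Diagonalizes U y Y) :
    ∃ B : ℝ, 0 ≤ B ∧ schurForm (fun i j => logKernel (y i) (y j)) U X X ≤
      sandwichedQ (1 + s) X Y ^ s * B ^ (1 - s) ∧
      ∀ δ : ℝ, 0 ≤ δ → (Y - (δ : ℂ) • X).PosDef →
        s * δ * B ≤ sandwichedQ (1 + s) X (Y - (δ : ℂ) • X) - sandwichedQ (1 + s) X Y := by
  set θ := s / (1 + s) with hθ
  have h0 : 0 < θ := by positivity
  have h1 : θ < 1 := by rw [hθ, div_lt_one (by linarith)]; linarith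
  have hpθ : (1 + s) * θ = s := by rw [hθ]; field_simp
  set p := 1 + s with hp
  have hp1 : 1 < p := by linarith
  obtain ⟨R, hR, hRR⟩ := hX.exists_sqrt
  set g : ℝ → ℝ := fun x => x ^ (-(θ / 2)) with hg
  have hgpos : ∀ x, 0 < x → 0 < g x := fun x hx => Real.rpow_pos_of_pos hx _
  have hgg : ∀ x, 0 < x → g x * g x = x ^ (-θ) := fun x hx => by
    simp only [hg]; rw [← Real.rpow_add hx]; ring_nf
  set K := cfc g Y * X * cfc g Y with hK
  have hAA : ∀ {Y' : Matrix n n ℂ}, Y'.IsHermitian →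
      cfc g Y' * X * cfc g Y' = (cfc g Y' * R) * (cfc g Y' * R)ᴴ := fun {Y'} hY' => by
    rw [conjTranspose_mul, hR.isHermitian.eq, (cfc_isHermitian hY' _).eq, ← hRR]
    simp only [Matrix.mul_assoc]
  have hAA2 : ∀ {Y' : Matrix n n ℂ}, Y'.PosDef →
      (cfc g Y' * R)ᴴ * (cfc g Y' * R) = R * cfc (fun x => x ^ (-θ)) Y' * R := fun {Y'} hY' => by
    rw [conjTranspose_mul, hR.isHermitian.eq, (cfc_isHermitian hY'.isHermitian _).eq,
      ← cfc_congr_of_pos hY' hgg, ← cfc_mul_cfc hY'.isHermitian]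
    simp only [Matrix.mul_assoc]
  have hYpd := hY.posDef hy
  have hKp : K.PosSemidef := by
    rw [hK, hAA hY.isHermitian]; exact posSemidef_self_mul_conjTranspose _
  obtain ⟨G, κ, hG⟩ := hKp.isHermitian.exists_diagonalizes
  have hκ := hG.nonneg hKp
  set V := Uᴴ * G with hV
  have hVd : ∀ (c : n → ℝ) (S : Matrix n n ℂ), Diagonalizes G c S →
      Uᴴ * S * U = V * diagonal (fun a => (c a : ℂ)) * Vᴴ := by
    intro c S hS
    rw [hS.eq, hV, conjTranspose_mul, conjTranspose_conjTranspose]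
    simp only [Matrix.mul_assoc]
  set k : n → n → ℝ := fun i j => symRpowKernel θ (y i) (y j) with hk
  have hkp : (Matrix.of fun i j => (k i j : ℂ)).PosSemidef := symRpowKernel_posSemidef h0 h1 y hy
  have hk0 : ∀ i j, 0 < k i j := fun i j => symRpowKernel_pos h0 h1 (hy i) (hy j)
  have hks : ∀ i j, k i j = k j i := fun i j => symRpowKernel_symm h0 h1 (hy i) (hy j)
  have hKent : ∀ i j, (V * diagonal (fun a => (κ a : ℂ)) * Vᴴ) i j =
      g (y i) * g (y j) * (Uᴴ * X * U) i j := fun i j => by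
    rw [← hVd _ _ hG, hK, hY.conj_cfc_mul_mul]
  have hXent : ∀ i j, (Uᴴ * X * U) i j = ((g (y i))⁻¹ * (g (y j))⁻¹ : ℝ) *
      (V * diagonal (fun a => (κ a : ℂ)) * Vᴴ) i j := fun i j => by
    rw [hKent]
    have a1 : (g (y i) : ℂ) ≠ 0 := by exact_mod_cast (hgpos _ (hy i)).ne'
    have a2 : (g (y j) : ℂ) ≠ 0 := by exact_mod_cast (hgpos _ (hy j)).ne'
    push_cast
    field_simp
  have hginv : ∀ i j, ((g (y i))⁻¹ * (g (y j))⁻¹) * ((g (y i))⁻¹ * (g (y j))⁻¹) =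
      y i ^ θ * y j ^ θ := fun i j => by
    have a1 : ∀ i, (g (y i))⁻¹ * (g (y i))⁻¹ = y i ^ θ := fun i => by
      rw [← mul_inv, hgg _ (hy i), Real.rpow_neg (hy i).le, inv_inv]
    rw [← a1, ← a1]; ring
  have hXher : ∀ i j, (Uᴴ * X * U) j i = star ((Uᴴ * X * U) i j) := fun i j =>
    ((isHermitian_conjTranspose_mul_mul U hX.isHermitian).apply j i).symm
  set B := ∑ i, ∑ j, k i j *
    ‖(V * diagonal (fun a => ((κ a ^ ((p + 1) / 2) : ℝ) : ℂ)) * Vᴴ) i j‖ ^ 2 with hB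
  have hQ : sandwichedQ p X Y = ∑ i, ∑ j,
      ‖(V * diagonal (fun a => ((κ a ^ (p / 2) : ℝ) : ℂ)) * Vᴴ) i j‖ ^ 2 := by
    have e1 : cfc (fun x : ℝ => x ^ p) K =
        cfc (fun x : ℝ => x ^ (p / 2)) K * cfc (fun x : ℝ => x ^ (p / 2)) K := by
      rw [cfc_mul_cfc hKp.isHermitian]
      exact cfc_congr_of_nonneg hKp fun x hx => by
        rw [← Real.rpow_add_of_nonneg hx (by positivity) (by positivity)]; ring_nf
    have hS := hG.cfc fun x : ℝ => x ^ (p / 2)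
    have hher := isHermitian_conjTranspose_mul_mul U hS.isHermitian
    rw [hp, sandwichedQ_one_add hs0, ← hp, ← hθ, ← hg, ← hK, e1, hY.trace_mul_eq_sum,
      Complex.re_sum]
    refine Finset.sum_congr rfl fun i _ => ?_
    rw [Complex.re_sum]
    refine Finset.sum_congr rfl fun j _ => ?_
    rw [← hher.apply j i, hVd _ _ hS, RCLike.star_def, Complex.conj_mul', ← Complex.ofReal_pow,
      Complex.ofReal_re]
  refine ⟨B, ?_, ?_, ?_⟩
  · exact Finset.sum_nonneg fun i _ => Finset.sum_nonneg fun j _ =>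
      mul_nonneg (hk0 i j).le (sq_nonneg _)
  · rw [hQ]
    refine le_trans ?_ (weight_form_interpolation hkp hk0 hks V κ hκ hs0 hs1)
    rw [schurForm_apply, Complex.re_sum]
    refine Finset.sum_le_sum fun i _ => ?_
    rw [Complex.re_sum]
    refine Finset.sum_le_sum fun j _ => ?_
    rw [hXher i j, RCLike.star_def, Complex.conj_mul', hXent, norm_mul, ← Complex.ofReal_pow,
      ← Complex.ofReal_mul, Complex.ofReal_re, mul_pow, Complex.norm_real, Real.norm_eq_abs, sq_abs,
      sq (_ * _), hginv, mul_right_comm]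
    exact mul_le_mul_of_nonneg_right (mul_logKernel_le hs0 hs1 (hy i) (hy j)) (sq_nonneg _)
  · intro δ hδ hYδ
    have hA := hAA hY.isHermitian
    have hA2 := hAA2 hYpd
    have hA' := hAA hYδ.isHermitian
    have hA2' := hAA2 hYδ
    set Y' := Y - (δ : ℂ) • X with hY'
    -- Q is also tr M^p, where Y enters only through Y^(-θ). The tangent inequality for tr M^p
    -- followed by the one for Y^(-θ) therefore bounds the finite difference of Q without
    -- differentiating it.
    set M := R * cfc (fun x : ℝ => x ^ (-θ)) Y * R with hM
    set M' := R * cfc (fun x : ℝ => x ^ (-θ)) Y' * R with hM'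
    have hMp : M.PosSemidef := by rw [← hA2]; exact posSemidef_conjTranspose_mul_self _
    have hMp' : M'.PosSemidef := by rw [← hA2']; exact posSemidef_conjTranspose_mul_self _
    have q1 : sandwichedQ p X Y = (cfc (fun x : ℝ => x ^ p) M).trace.re := by
      rw [hp, sandwichedQ_one_add hs0, ← hp, ← hθ, ← hg, hA, trace_rpow_mul_conjTranspose _ hp1, hA2]
    have q2 : sandwichedQ p X Y' = (cfc (fun x : ℝ => x ^ p) M').trace.re := by
      rw [hp, sandwichedQ_one_add hs0, ← hp, ← hθ, ← hg, hA', trace_rpow_mul_conjTranspose _ hp1,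
        hA2']
    have htan := trace_rpow_tangent hMp' hMp hp1.le
    set N := cfc (fun x : ℝ => x ^ (p - 1)) M with hN
    have hNp : N.PosSemidef := cfc_posSemidef_of_nonneg hMp fun x hx => Real.rpow_nonneg hx _
    set W := R * N * R with hW
    have hWp : W.PosSemidef := by
      have := hNp.conjTranspose_mul_mul_same R
      rwa [hR.isHermitian.eq] at this
    have hcyc : ∀ S : Matrix n n ℂ, (N * (R * S * R)).trace = (W * S).trace := fun S => by
      rw [hW, show N * (R * S * R) = N * R * S * R by simp only [Matrix.mul_assoc], trace_mul_comm]
      simp only [Matrix.mul_assoc]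
    have hres := (isResolventPair_rpow h0 h1).trace_tangent_one hy hWp hYδ hY
    rw [Matrix.mul_sub, trace_sub, Complex.sub_re, hM, hM', hcyc, hcyc] at htan
    have hdiff : Y' - Y = (-δ) • X := by
      rw [hY', neg_smul, Complex.coe_smul]; abel
    rw [hdiff, map_smul, smul_eq_mul] at hres
    -- Since Y^(-θ/2) W Y^(-θ/2) = K^p, the form is θ ∑ k_ij K_ij (K^p)_ji, to which the
    -- arithmetic-geometric bound applies.
    have hform : θ * B ≤ schurForm (fun i j => rpowKernel θ (y i) (y j)) U W X := by
      have hge := sum_weight_rpow_mul_ge hkp hks V κ hκ (by linarith : 0 < p)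
      have hP : cfc g Y * W * cfc g Y = cfc (fun x : ℝ => x ^ p) K := by
        have := mul_cfc_mul_conjTranspose (cfc g Y * R) fun x => x ^ (p - 1)
        rw [hA2, ← hA, ← hK] at this
        rw [cfc_congr_of_nonneg hKp (g := fun x => x ^ (p - 1) * x) fun x hx => by
          rw [← Real.rpow_add_one' hx (by linarith)]; simp, ← this, conjTranspose_mul,
          hR.isHermitian.eq, (cfc_isHermitian hY.isHermitian _).eq, hW, hN]
        simp only [Matrix.mul_assoc]
      refine (mul_le_mul_of_nonneg_left hge h0.le).trans (le_of_eq ?_)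
      rw [schurForm_apply, ← Complex.re_ofReal_mul, Finset.mul_sum]
      congr 1
      refine Finset.sum_congr rfl fun i _ => ?_
      rw [Finset.mul_sum]
      refine Finset.sum_congr rfl fun j _ => ?_
      have hWj : (Uᴴ * W * U) j i = ((g (y i))⁻¹ * (g (y j))⁻¹ : ℝ) *
          star ((V * diagonal (fun a => ((κ a ^ p : ℝ) : ℂ)) * Vᴴ) i j) := by
        rw [← hVd _ _ (hG.cfc fun x => x ^ p), ← hP,
          (isHermitian_conjTranspose_mul_mul U (hP ▸ (hG.cfc fun x => x ^ p).isHermitian)).apply,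
          hY.conj_cfc_mul_mul]
        have a1 : (g (y i) : ℂ) ≠ 0 := by exact_mod_cast (hgpos _ (hy i)).ne'
        have a2 : (g (y j) : ℂ) ≠ 0 := by exact_mod_cast (hgpos _ (hy j)).ne'
        push_cast
        field_simp
      rw [hWj, hXent]
      have e1 : (θ : ℂ) * (k i j : ℂ) = ((((g (y i))⁻¹ * (g (y j))⁻¹) *
          ((g (y i))⁻¹ * (g (y j))⁻¹) * rpowKernel θ (y i) (y j) : ℝ) : ℂ) := by
        rw [hginv, ← Complex.ofReal_mul]
        congr 1
        simp only [hk, symRpowKernel]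
        field_simp
      rw [← mul_assoc, ← mul_assoc, e1]
      push_cast
      ring
    rw [q1, q2]
    have hfin : p * δ * (θ * B) ≤ p * (δ * schurForm (fun i j => rpowKernel θ (y i) (y j)) U W X) := by
      rw [mul_assoc]
      gcongr
    -- The constant s is pθ: p comes from differentiating the p-th power, θ from the power kernel.
    have e2 : s * δ * B = p * δ * (θ * B) := by rw [← hpθ]; ring
    have hres2 : p * (δ * schurForm (fun i j => rpowKernel θ (y i) (y j)) U W X) ≤
        p * ((W * cfc (fun x : ℝ => x ^ (-θ)) Y').trace.re -
          (W * cfc (fun x : ℝ => x ^ (-θ)) Y).trace.re) := by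
      refine mul_le_mul_of_nonneg_left ?_ (by linarith)
      linarith
    rw [e2]
    linarith

end

end

/-! ### From the differential inequality to the logarithmic increment -/

noncomputable section

open Matrix

/-- A discretized integration of the differential inequality `φ ≤ Φ^s (-Φ'/s)^(1-s)`. -/
theorem sum_rpow_mul_rpow_le {s : ℝ} (hs0 : 0 < s) (hs1 : s < 1) {N : ℕ} (hN : 0 < N)
    (Φ B : ℕ → ℝ) (hΦ : ∀ k ≤ N, 0 ≤ Φ k) (hB : ∀ k ≤ N, 0 ≤ B k)
    (hstep : ∀ k, k + 1 ≤ N → s * (1 / N) * B (k + 1) ≤ Φ k - Φ (k + 1)) :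
    ∑ k ∈ Finset.range N, (1 / N : ℝ) * (Φ (k + 1) ^ s * B (k + 1) ^ (1 - s)) ≤
      s ^ s * (1 - s) ^ (1 - s) / s * Φ 0 := by
  have hs1' : 0 < 1 - s := by linarith
  have hN' : (0 : ℝ) < N := Nat.cast_pos.2 hN
  -- With this exponent m - 1 = s/(1-s), so Φ^s B^(1-s) = (Φ^(m-1) B)^(1-s). The inner factor is, up
  -- to a constant, at most a difference quotient of Φ^m, and these telescope.
  set m := 1 / (1 - s) with hm
  have hm1 : 1 ≤ m := by rw [hm, le_div_iff₀ hs1']; linarith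
  set D : ℕ → ℝ := fun k => (1 - s) / s * N * (Φ k ^ m - Φ (k + 1) ^ m) with hD
  have hle : ∀ k ∈ Finset.range N, 0 ≤ Φ (k + 1) ^ (m - 1) * B (k + 1) ∧
      Φ (k + 1) ^ (m - 1) * B (k + 1) ≤ D k := by
    intro k hk
    have hk' : k + 1 ≤ N := Finset.mem_range.1 hk
    have p1 := hΦ k (by omega)
    have p2 := hΦ (k + 1) hk'
    have p3 := hB (k + 1) hk'
    refine ⟨by positivity, ?_⟩
    have h1 := Real.rpow_tangent_le hm1 p1 p2
    have h2 := mul_le_mul_of_nonneg_left (hstep k hk') (Real.rpow_nonneg p2 (m - 1))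
    have h3 : m * (Φ (k + 1) ^ (m - 1) * (s * (1 / N) * B (k + 1))) ≤
        Φ k ^ m - Φ (k + 1) ^ m := by
      have := mul_le_mul_of_nonneg_left h2 (by linarith : 0 ≤ m)
      linarith
    have h4 := mul_le_mul_of_nonneg_left h3
      (by positivity : 0 ≤ (1 - s) / s * N)
    refine le_trans (le_of_eq ?_) h4
    rw [hm]
    field_simp
  have hterm : ∀ k ∈ Finset.range N, (1 / N : ℝ) * (Φ (k + 1) ^ s * B (k + 1) ^ (1 - s)) ≤
      (1 / N : ℝ) * D k ^ (1 - s) := by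
    intro k hk
    obtain ⟨a1, a2⟩ := hle k hk
    have hk' : k + 1 ≤ N := Finset.mem_range.1 hk
    have p2 := hΦ (k + 1) hk'
    have p3 := hB (k + 1) hk'
    refine mul_le_mul_of_nonneg_left ?_ (by positivity)
    refine le_trans (le_of_eq ?_) (Real.rpow_le_rpow a1 a2 hs1'.le)
    rw [Real.mul_rpow (Real.rpow_nonneg p2 _) p3, ← Real.rpow_mul p2]
    congr 2
    rw [hm]; field_simp; ring
  refine (Finset.sum_le_sum hterm).trans ?_
  -- Jensen's inequality for the concave power 1-s with uniform weights 1/N moves the sum inside the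
  -- power, where it telescopes.
  have hjen := (Real.concaveOn_rpow hs1'.le (by linarith : 1 - s ≤ 1)).le_map_sum
    (t := Finset.range N) (w := fun _ => (1 / N : ℝ)) (p := D) (fun _ _ => by positivity)
    (by rw [Finset.sum_const, Finset.card_range, nsmul_eq_mul]; field_simp)
    (fun k hk => (hle k hk).1.trans (hle k hk).2)
  simp only [smul_eq_mul] at hjen
  refine hjen.trans ?_
  have hsum : ∑ k ∈ Finset.range N, (1 / N : ℝ) * D k = (1 - s) / s * (Φ 0 ^ m - Φ N ^ m) := by
    rw [← Finset.sum_range_sub' (fun k => Φ k ^ m), Finset.mul_sum]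
    refine Finset.sum_congr rfl fun k _ => ?_
    simp only [hD]
    field_simp
  rw [hsum]
  have p0 := hΦ 0 (Nat.zero_le _)
  have pN := Real.rpow_nonneg (hΦ N le_rfl) m
  have hnn : 0 ≤ (1 - s) / s * (Φ 0 ^ m - Φ N ^ m) := by
    rw [← hsum]
    exact Finset.sum_nonneg fun k hk =>
      mul_nonneg (by positivity) ((hle k hk).1.trans (hle k hk).2)
  have h5 : ((1 - s) / s * (Φ 0 ^ m - Φ N ^ m)) ^ (1 - s) ≤ ((1 - s) / s * Φ 0 ^ m) ^ (1 - s) := by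
    refine Real.rpow_le_rpow hnn ?_ hs1'.le
    refine mul_le_mul_of_nonneg_left (by linarith) (by positivity)
  refine h5.trans (le_of_eq ?_)
  rw [Real.mul_rpow (by positivity) (Real.rpow_nonneg p0 _), ← Real.rpow_mul p0, hm,
    one_div_mul_cancel hs1'.ne', Real.rpow_one, Real.div_rpow hs1'.le hs0.le,
    Real.rpow_sub hs0, Real.rpow_one]
  field_simp

section
variable {n : Type*} [Fintype n] [DecidableEq n]

omit [Fintype n] [DecidableEq n] in
theorem Matrix.PosDef.add_smul_posSemidef {σ X : Matrix n n ℂ} (hσ : σ.PosDef) (hX : X.PosSemidef)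
    {c : ℝ} (hc : 0 ≤ c) : (σ + (c : ℂ) • X).PosDef :=
  hσ.add_posSemidef (hX.smul (by exact_mod_cast hc))

/-- The key estimate of the logarithmic increment by the sandwiched quasi-entropy. -/
theorem trace_log_add_sub_log_le {s : ℝ} (hs0 : 0 < s) (hs1 : s ≤ 1) {σ X : Matrix n n ℂ}
    (hσ : σ.PosDef) (hX : X.PosSemidef) :
    (X * cfc Real.log (σ + X)).trace.re - (X * cfc Real.log σ).trace.re ≤
      s ^ s * (1 - s) ^ (1 - s) / s * sandwichedQ (1 + s) X σ := by
  have hlog : ∀ {U Y : Matrix n n ℂ} {y : n → ℝ} (_ : Diagonalizes U y Y) (_ : ∀ i, 0 < y i)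
      {δ : ℝ} (_ : 0 ≤ δ), (X * cfc Real.log (Y + (δ : ℂ) • X)).trace.re ≤
        (X * cfc Real.log Y).trace.re +
          δ * schurForm (fun i j => logKernel (y i) (y j)) U X X := by
    intro U Y y hY hy δ hδ
    have := trace_mul_log_le hy hX ((hY.posDef hy).add_smul_posSemidef hX hδ) hY
    rwa [add_sub_cancel_left, Complex.coe_smul, map_smul, smul_eq_mul, ← Complex.coe_smul] at this
  rcases hs1.eq_or_lt with rfl | hs1'
  -- At s = 1 the factor B^(1-s) and the constant are 1 (with 0^0 = 1); a single tangent step at σ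
  -- suffices.
  · obtain ⟨U, y, hY⟩ := hσ.isHermitian.exists_diagonalizes
    have hy := hY.pos hσ
    obtain ⟨B, -, h1, -⟩ := exists_bkm_bound one_pos le_rfl hX hy hY
    have h2 := hlog hY hy zero_le_one
    simp only [Complex.ofReal_one, one_smul, one_mul] at h2
    simp only [Real.rpow_one, sub_self, Real.rpow_zero, mul_one, div_one, one_mul] at h1 ⊢
    linarith
  · have hchoice : ∀ c : ℝ, 0 ≤ c → ∃ (U : Matrix n n ℂ) (y : n → ℝ),
        Diagonalizes U y (σ + (c : ℂ) • X) ∧ ∀ i, 0 < y i := by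
      intro c hc
      have hp := hσ.add_smul_posSemidef hX hc
      obtain ⟨U, y, hY⟩ := hp.isHermitian.exists_diagonalizes
      exact ⟨U, y, hY, hY.pos hp⟩
    choose! U y hY hy using hchoice
    set φ : ℝ → ℝ := fun c => schurForm (fun i j => logKernel (y c i) (y c j)) (U c) X X with hφ
    have hb : ∀ c : ℝ, 0 ≤ c → _ := fun c hc =>
      exists_bkm_bound hs0 hs1 hX (hy c hc) (hY c hc)
    choose! B hB0 hB1 hB2 using hb
    set Q : ℝ → ℝ := fun c => sandwichedQ (1 + s) X (σ + (c : ℂ) • X) with hQ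
    have hbound : ∀ N : ℕ, 0 < N →
        (X * cfc Real.log (σ + X)).trace.re - (X * cfc Real.log σ).trace.re ≤
        (1 / N : ℝ) * φ 0 + s ^ s * (1 - s) ^ (1 - s) / s * sandwichedQ (1 + s) X σ := by
      intro N hN
      have hN' : (0 : ℝ) < N := Nat.cast_pos.2 hN
      set L : ℕ → ℝ := fun k => (X * cfc Real.log (σ + ((k * (1 / N) : ℝ) : ℂ) • X)).trace.re
        with hL
      have hL0 : L 0 = (X * cfc Real.log σ).trace.re := by simp [hL]
      have hLN : L N = (X * cfc Real.log (σ + X)).trace.re := by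
        have : (N : ℝ) * (1 / N) = 1 := by field_simp
        simp only [hL, this, Complex.ofReal_one, one_smul]
      have hc0 : ∀ k : ℕ, (0 : ℝ) ≤ k * (1 / N) := fun k => by positivity
      have hshift : ∀ k : ℕ, σ + (((k + 1 : ℕ) * (1 / N) : ℝ) : ℂ) • X =
          σ + ((k * (1 / N) : ℝ) : ℂ) • X + ((1 / N : ℝ) : ℂ) • X := fun k => by
        rw [add_assoc, ← add_smul]
        congr 2
        push_cast; ring
      -- Concavity of the logarithm bounds each increment by the slope at its left endpoint, whereas
      -- the decrease of Q is controlled below by B at the right endpoint.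
      have hLstep : ∀ k, L (k + 1) - L k ≤ (1 / N : ℝ) * φ (k * (1 / N)) := fun k => by
        have := hlog (hY _ (hc0 k)) (hy _ (hc0 k)) (δ := 1 / N) (by positivity)
        rw [← hshift] at this
        simp only [hL]
        linarith
      have hQstep : ∀ k : ℕ, s * (1 / N) * B ((k + 1 : ℕ) * (1 / N)) ≤
          Q (k * (1 / N)) - Q ((k + 1 : ℕ) * (1 / N)) := fun k => by
        have e : σ + (((k + 1 : ℕ) * (1 / N) : ℝ) : ℂ) • X - ((1 / N : ℝ) : ℂ) • X =
            σ + ((k * (1 / N) : ℝ) : ℂ) • X := by rw [hshift, add_sub_cancel_right]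
        have := hB2 _ (hc0 (k + 1)) (1 / N) (by positivity)
          (by rw [e]; exact hσ.add_smul_posSemidef hX (hc0 k))
        rwa [e] at this
      have hsum := sum_rpow_mul_rpow_le hs0 hs1' hN (fun k => Q (k * (1 / N)))
        (fun k => B (k * (1 / N)))
        (fun k _ => sandwichedQ_nonneg hs0 hX (hσ.add_smul_posSemidef hX (hc0 k)).isHermitian)
        (fun k _ => hB0 _ (hc0 k)) (fun k _ => hQstep k)
      have hQ0 : Q ((0 : ℕ) * (1 / N)) = sandwichedQ (1 + s) X σ := by simp [hQ]
      rw [hQ0] at hsum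
      rw [← hL0, ← hLN, ← Finset.sum_range_sub L N]
      refine (Finset.sum_le_sum fun k _ => hLstep k).trans ?_
      have hφ0 : ∀ c : ℝ, 0 ≤ c → 0 ≤ φ c := fun c hc =>
        schurForm_nonneg (isResolventPair_log.posSemidef (y c) (hy c hc)) _ hX hX
      -- Adding a nonnegative last term allows the sum to be split into its zeroth term and a sum
      -- over right endpoints. The leftover φ(0)/N vanishes in the limit.
      have hext : ∑ k ∈ Finset.range N, (1 / N : ℝ) * φ (k * (1 / N)) ≤
          ∑ k ∈ Finset.range (N + 1), (1 / N : ℝ) * φ (k * (1 / N)) :=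
        Finset.sum_le_sum_of_subset_of_nonneg (Finset.range_mono (Nat.le_succ N))
          fun k _ _ => mul_nonneg (by positivity) (hφ0 _ (hc0 k))
      refine hext.trans ?_
      rw [Finset.sum_range_succ', add_comm]
      refine add_le_add (by simp) (le_trans (Finset.sum_le_sum fun k _ => ?_) hsum)
      exact mul_le_mul_of_nonneg_left (hB1 _ (hc0 (k + 1))) (by positivity)
    have hlim : Filter.Tendsto (fun N : ℕ => (1 / N : ℝ) * φ 0 +
        s ^ s * (1 - s) ^ (1 - s) / s * sandwichedQ (1 + s) X σ) Filter.atTop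
        (nhds (0 * φ 0 + s ^ s * (1 - s) ^ (1 - s) / s * sandwichedQ (1 + s) X σ)) :=
      (tendsto_one_div_atTop_nhds_zero_nat.mul_const _).add_const _
    rw [zero_mul, zero_add] at hlim
    refine ge_of_tendsto hlim ?_
    filter_upwards [Filter.eventually_gt_atTop 0] with N hN
    exact hbound N hN

end

end

noncomputable section

open Matrix MeasureTheory

/-! ### Moments of the Haar measure -/

section
variable {A : Type*} [Fintype A] [DecidableEq A]

instance haarUnitary_isHaarMeasure : (haarUnitary A).IsHaarMeasure := by
  unfold haarUnitary; infer_instance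

instance haarUnitary_isProbabilityMeasure : IsProbabilityMeasure (haarUnitary A) := by
  refine ⟨?_⟩
  have := Measure.haarMeasure_self (K₀ := (⊤ : TopologicalSpace.PositiveCompacts
    (Matrix.unitaryGroup A ℂ)))
  simpa [haarUnitary] using this

theorem haarUnitary_integrable {F : Type*} [NormedAddCommGroup F] [SecondCountableTopology F]
    {f : Matrix.unitaryGroup A ℂ → F}
    (hf : Continuous f) : Integrable f (haarUnitary A) := by
  have := hf.continuousOn.integrableOn_compact (μ := haarUnitary A) isCompact_univ
  rwa [integrableOn_univ] at this

@[fun_prop]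
theorem continuous_unitary_apply (i a : A) :
    Continuous fun U : Matrix.unitaryGroup A ℂ => (U : Matrix A A ℂ) i a :=
  (continuous_subtype_val).matrix_elem i a

theorem unitary_sum_mul_star (U : Matrix.unitaryGroup A ℂ) (a c : A) :
    ∑ i, (U : Matrix A A ℂ) i a * star ((U : Matrix A A ℂ) i c) = if a = c then 1 else 0 := by
  have h := congrFun (congrFun (Unitary.coe_star_mul_self U) c) a
  rw [Matrix.mul_apply, Matrix.one_apply] at h
  simp only [eq_comm (a := c)] at h
  rw [← h]
  exact Finset.sum_congr rfl fun i _ => by rw [star_apply, mul_comm]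

/-- The diagonal unitary with entry `I` at `x` and `1` elsewhere. -/
def phaseUnitary (x : A) : Matrix.unitaryGroup A ℂ :=
  ⟨diagonal fun i => if i = x then Complex.I else 1, by
    rw [mem_unitaryGroup_iff, star_eq_conjTranspose, diagonal_conjTranspose, diagonal_mul_diagonal,
      ← diagonal_one]
    congr 1
    ext i
    by_cases h : i = x <;> simp [h]⟩

theorem phaseUnitary_mul_apply (x : A) (U : Matrix.unitaryGroup A ℂ) (i a : A) :
    ((phaseUnitary x * U : Matrix.unitaryGroup A ℂ) : Matrix A A ℂ) i a =
      (if i = x then Complex.I else 1) * (U : Matrix A A ℂ) i a := by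
  rw [Submonoid.coe_mul, phaseUnitary, diagonal_mul]

/-- The unitary permuting the basis. -/
def permUnitary (π : Equiv.Perm A) : Matrix.unitaryGroup A ℂ :=
  ⟨(1 : Matrix A A ℂ).submatrix π id, by
    rw [mem_unitaryGroup_iff, star_eq_conjTranspose, conjTranspose_submatrix, conjTranspose_one]
    ext i j
    simp [Matrix.mul_apply, Matrix.one_apply]⟩

theorem permUnitary_mul_apply (π : Equiv.Perm A) (U : Matrix.unitaryGroup A ℂ) (i a : A) :
    ((permUnitary π * U : Matrix.unitaryGroup A ℂ) : Matrix A A ℂ) i a =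
      (U : Matrix A A ℂ) (π i) a := by
  rw [Submonoid.coe_mul, permUnitary]
  simp [Matrix.mul_apply, Matrix.one_apply]

/-- The rotation by `45` degrees in the plane of the basis vectors `p` and `q`. -/
def rotUnitary {p q : A} (h : p ≠ q) : Matrix.unitaryGroup A ℂ :=
  ⟨Matrix.of fun i j => if i = p then (if j = p ∨ j = q then ((√2)⁻¹ : ℂ) else 0) else
    if i = q then (if j = p then -((√2)⁻¹ : ℂ) else if j = q then ((√2)⁻¹ : ℂ) else 0) else
    if i = j then 1 else 0, by
    have h2 : ((√2)⁻¹ : ℂ) * ((√2)⁻¹ : ℂ) = 1 / 2 := by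
      rw [← mul_inv, ← Complex.ofReal_mul, Real.mul_self_sqrt (by norm_num)]; norm_num
    have key : ∀ f : A → ℂ, (∀ j, j ≠ p → j ≠ q → f j = 0) → ∑ j, f j = f p + f q := by
      intro f hf
      rw [← Finset.sum_pair h]
      refine (Finset.sum_subset (Finset.subset_univ _) fun j _ hj => ?_).symm
      simp only [Finset.mem_insert, Finset.mem_singleton, not_or] at hj
      exact hf j hj.1 hj.2
    have hs : star ((√2)⁻¹ : ℂ) = ((√2)⁻¹ : ℂ) := by
      rw [← Complex.ofReal_inv, RCLike.star_def, Complex.conj_ofReal]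
    rw [mem_unitaryGroup_iff, star_eq_conjTranspose]
    ext i k
    rw [Matrix.mul_apply]
    simp only [conjTranspose_apply, of_apply]
    by_cases hip : i = p
    · subst hip
      rw [key _ (fun j hj hj' => by simp [hj, hj'])]
      by_cases hki : k = i
      · subst hki
        simp [-star_inv₀, hs, h2]; norm_num
      · by_cases hkq : k = q
        · subst hkq
          simp [-star_inv₀, hs, h2, hki, h]
        · simp [hki, hkq, Ne.symm hki]
    · by_cases hiq : i = q
      · subst hiq
        rw [key _ (fun j hj hj' => by simp [hj, hj', hip])]
        by_cases hkp : k = p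
        · subst hkp
          simp [-star_inv₀, hs, h2, hip]
        · by_cases hki : k = i
          · subst hki
            simp [-star_inv₀, hs, h2, hip]; norm_num
          · simp [hkp, hki, hip, Ne.symm hki]
      · rw [Finset.sum_eq_single i]
        · by_cases hkp : k = p
          · subst hkp; simp [hip, hiq]
          · by_cases hkq : k = q
            · subst hkq; simp [hip, hiq]
            · simp [hip, hiq, hkp, hkq, Matrix.one_apply, eq_comm]
        · intro j _ hj; simp [hip, hiq, Ne.symm hj]
        · simp⟩

theorem rotUnitary_mul_apply {p q : A} (h : p ≠ q) (U : Matrix.unitaryGroup A ℂ) (a : A) :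
    ((rotUnitary h * U : Matrix.unitaryGroup A ℂ) : Matrix A A ℂ) p a =
      ((√2)⁻¹ : ℂ) * ((U : Matrix A A ℂ) p a + (U : Matrix A A ℂ) q a) := by
  rw [Submonoid.coe_mul, rotUnitary, Matrix.mul_apply]
  simp only [of_apply, if_true]
  rw [mul_add, ← Finset.sum_pair (f := fun j => ((√2)⁻¹ : ℂ) * (U : Matrix A A ℂ) j a) h]
  refine (Finset.sum_subset_zero_on_sdiff (Finset.subset_univ _) (fun j hj => ?_)
    fun j hj => ?_).symm
  · simp only [Finset.mem_sdiff, Finset.mem_insert, Finset.mem_singleton, not_or] at hj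
    simp [hj.2.1, hj.2.2]
  · simp only [Finset.mem_insert, Finset.mem_singleton] at hj
    simp [hj]

/-- The mixed second moments of two columns. -/
def haarMoment₂ (i k a c : A) : ℂ :=
  ∫ U : Matrix.unitaryGroup A ℂ, (U : Matrix A A ℂ) i a * star ((U : Matrix A A ℂ) k c)
    ∂(haarUnitary A)

/-- The mixed fourth moments. -/
def haarMoment₄ (i j k l a b c d : A) : ℂ :=
  ∫ U : Matrix.unitaryGroup A ℂ, (U : Matrix A A ℂ) i a * (U : Matrix A A ℂ) j b *
    star ((U : Matrix A A ℂ) k c) * star ((U : Matrix A A ℂ) l d) ∂(haarUnitary A)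

/-- A phase on row i kills the moment for i ≠ k, permutations of rows equalize the case i = k, and
summation over rows evaluates it by unitarity. -/
theorem haarMoment₂_eq (i k a c : A) :
    (Fintype.card A : ℂ) * haarMoment₂ i k a c =
      (if i = k then 1 else 0) * (if a = c then 1 else 0) := by
  by_cases hik : i = k
  · subst hik
    have hperm : ∀ j, haarMoment₂ j j a c = haarMoment₂ i i a c := by
      intro j
      have := integral_mul_left_eq_self (μ := haarUnitary A)
        (fun U : Matrix.unitaryGroup A ℂ =>
          (U : Matrix A A ℂ) j a * star ((U : Matrix A A ℂ) j c)) (permUnitary (Equiv.swap i j))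
      simp only [permUnitary_mul_apply, Equiv.swap_apply_right] at this
      exact this.symm
    have hsum : ∑ j, haarMoment₂ j j a c = if a = c then 1 else 0 := by
      unfold haarMoment₂
      rw [← integral_finsetSum _ fun j _ => haarUnitary_integrable (by fun_prop)]
      simp only [unitary_sum_mul_star]
      simp
    simp only [hperm, Finset.sum_const, Finset.card_univ, nsmul_eq_mul] at hsum
    rw [hsum]; simp
  · have := integral_mul_left_eq_self (μ := haarUnitary A)
      (fun U : Matrix.unitaryGroup A ℂ =>
        (U : Matrix A A ℂ) i a * star ((U : Matrix A A ℂ) k c)) (phaseUnitary i)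
    simp only [phaseUnitary_mul_apply, if_true, if_neg (Ne.symm hik), one_mul, mul_assoc,
      integral_const_mul] at this
    have h0 : haarMoment₂ i k a c = 0 := by
      have h1 : (Complex.I - 1) * haarMoment₂ i k a c = 0 := by
        unfold haarMoment₂
        rw [sub_mul, this, one_mul, sub_self]
      refine (mul_eq_zero.1 h1).resolve_left fun h => ?_
      have := congrArg Complex.re h
      simp at this
    simp [h0, hik]

/-! ### Fourth moments from phases, permutations and one rotation -/

section
variable (a b c d : A)

theorem haarMoment₄_phase (x i j k l : A) :
    haarMoment₄ i j k l a b c d = (if i = x then Complex.I else 1) * (if j = x then Complex.I else 1)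
      * star (if k = x then Complex.I else 1) * star (if l = x then Complex.I else 1) *
      haarMoment₄ i j k l a b c d := by
  have := integral_mul_left_eq_self (μ := haarUnitary A)
    (fun U : Matrix.unitaryGroup A ℂ => (U : Matrix A A ℂ) i a * (U : Matrix A A ℂ) j b *
      star ((U : Matrix A A ℂ) k c) * star ((U : Matrix A A ℂ) l d)) (phaseUnitary x)
  simp only [phaseUnitary_mul_apply] at this
  unfold haarMoment₄
  rw [← integral_const_mul]
  rw [← this]
  refine integral_congr_ae (Filter.Eventually.of_forall fun U => ?_)
  simp only [star_mul']
  ring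

theorem haarMoment₄_perm (π : Equiv.Perm A) (i j k l : A) :
    haarMoment₄ (π i) (π j) (π k) (π l) a b c d = haarMoment₄ i j k l a b c d := by
  have := integral_mul_left_eq_self (μ := haarUnitary A)
    (fun U : Matrix.unitaryGroup A ℂ => (U : Matrix A A ℂ) i a * (U : Matrix A A ℂ) j b *
      star ((U : Matrix A A ℂ) k c) * star ((U : Matrix A A ℂ) l d)) (permUnitary π)
  simp only [permUnitary_mul_apply] at this
  exact this

/-- Invariance under a phase at x multiplies the moment by I to the power of the difference of the
two counts. That difference is ±1 or ±2, so the factor is not 1. -/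
theorem haarMoment₄_eq_zero (x i j k l : A)
    (h : (if i = x then 1 else 0) + (if j = x then 1 else 0) ≠
      ((if k = x then 1 else 0) + (if l = x then 1 else 0) : ℕ)) :
    haarMoment₄ i j k l a b c d = 0 := by
  have h1 := haarMoment₄_phase a b c d x i j k l
  have hI : Complex.I - 1 ≠ 0 := fun h => by simpa using congrArg Complex.re h
  have hI' : -Complex.I - 1 ≠ 0 := fun h => by simpa using congrArg Complex.re h
  have hI2 : (-1 : ℂ) - 1 ≠ 0 := by norm_num
  have fin : ∀ z : ℂ, z - 1 ≠ 0 →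
      haarMoment₄ i j k l a b c d = z * haarMoment₄ i j k l a b c d →
      haarMoment₄ i j k l a b c d = 0 := fun z hz h => by
    refine (mul_eq_zero.1 (?_ : (z - 1) * _ = 0)).resolve_left hz
    rw [sub_mul, one_mul, ← h, sub_self]
  revert h h1
  split_ifs <;> intro h h1 <;> first | exact (h rfl).elim | skip
  all_goals
    simp only [RCLike.star_def, Complex.conj_I, map_one, mul_one, one_mul, Complex.I_mul_I, mul_neg,
      neg_mul, neg_neg] at h1
    first
    | exact fin _ hI h1
    | exact fin _ hI' (by simpa using h1)
    | exact fin _ hI2 (by simpa using h1)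

/-- Rotating all four entries of row p gives sixteen moments with the factor (1/√2)⁴ = 1/4, of which
phase invariance leaves six. This is the one relation not supplied by monomial matrices. -/
theorem haarMoment₄_rot {p q : A} (h : p ≠ q) :
    4 * haarMoment₄ p p p p a b c d = haarMoment₄ p p p p a b c d + haarMoment₄ q q q q a b c d +
      haarMoment₄ p q p q a b c d + haarMoment₄ q p q p a b c d +
      haarMoment₄ p q q p a b c d + haarMoment₄ q p p q a b c d := by
  have h0 := integral_mul_left_eq_self (μ := haarUnitary A)
    (fun U : Matrix.unitaryGroup A ℂ => (U : Matrix A A ℂ) p a * (U : Matrix A A ℂ) p b *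
      star ((U : Matrix A A ℂ) p c) * star ((U : Matrix A A ℂ) p d)) (rotUnitary h)
  simp only [rotUnitary_mul_apply] at h0
  set w : Bool → A := fun x => if x then p else q with hw
  have hI : ∀ i j k l, Integrable (fun U : Matrix.unitaryGroup A ℂ =>
      (U : Matrix A A ℂ) i a * (U : Matrix A A ℂ) j b *
      star ((U : Matrix A A ℂ) k c) * star ((U : Matrix A A ℂ) l d)) (haarUnitary A) :=
    fun i j k l => haarUnitary_integrable (by fun_prop)
  have h2 : ((√2)⁻¹ : ℂ) * ((√2)⁻¹ : ℂ) = 1 / 2 := by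
    rw [← mul_inv, ← Complex.ofReal_mul, Real.mul_self_sqrt (by norm_num)]; norm_num
  have hs : star ((√2)⁻¹ : ℂ) = ((√2)⁻¹ : ℂ) := by
    rw [← Complex.ofReal_inv, RCLike.star_def, Complex.conj_ofReal]
  have hexp : ∑ i : Bool, ∑ j : Bool, ∑ k : Bool, ∑ l : Bool,
      haarMoment₄ (w i) (w j) (w k) (w l) a b c d = 4 * haarMoment₄ p p p p a b c d := by
    unfold haarMoment₄
    rw [← h0]
    have hI1 := fun i j k => integrable_finsetSum Finset.univ
      fun (l : Bool) _ => hI (w i) (w j) (w k) (w l)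
    have hI2 := fun i j => integrable_finsetSum Finset.univ fun (k : Bool) _ => hI1 i j k
    have hI3 := fun i => integrable_finsetSum Finset.univ fun (j : Bool) _ => hI2 i j
    simp only [← integral_finsetSum Finset.univ fun (l : Bool) _ => hI (w _) (w _) (w _) (w l)]
    simp only [← integral_finsetSum Finset.univ fun (k : Bool) _ => hI1 _ _ k]
    simp only [← integral_finsetSum Finset.univ fun (k : Bool) _ => hI2 _ k]
    simp only [← integral_finsetSum Finset.univ fun (k : Bool) _ => hI3 k]
    rw [← integral_const_mul]
    refine integral_congr_ae (Filter.Eventually.of_forall fun U => ?_)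
    simp only [star_mul', hs, Fintype.sum_bool, hw, if_true, Bool.false_eq_true, if_false, star_add]
    generalize ((√2)⁻¹ : ℂ) = r at h2
    have h4 : r * r * (r * r) = 1 / 4 := by rw [h2]; norm_num
    linear_combination (-4 * (((U : Matrix A A ℂ) p a + (U : Matrix A A ℂ) q a) *
      ((U : Matrix A A ℂ) p b + (U : Matrix A A ℂ) q b) *
      (star ((U : Matrix A A ℂ) p c) + star ((U : Matrix A A ℂ) q c)) *
      (star ((U : Matrix A A ℂ) p d) + star ((U : Matrix A A ℂ) q d)))) * h4
  have hz : ∀ x y : A, x ≠ y → haarMoment₄ x x x y a b c d = 0 ∧ haarMoment₄ x x y x a b c d = 0 ∧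
      haarMoment₄ x y x x a b c d = 0 ∧ haarMoment₄ y x x x a b c d = 0 ∧
      haarMoment₄ x x y y a b c d = 0 := by
    intro x y hxy
    refine ⟨?_, ?_, ?_, ?_, ?_⟩ <;>
    exact haarMoment₄_eq_zero a b c d x _ _ _ _ (by simp [hxy.symm])
  rw [← hexp]
  obtain ⟨z1, z2, z3, z4, z5⟩ := hz p q h
  obtain ⟨w1, w2, w3, w4, w5⟩ := hz q p h.symm
  simp only [Fintype.sum_bool, hw, if_true, Bool.false_eq_true, if_false, z1, z2, z3, z4, z5, w1,
    w2, w3, w4, w5]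
  ring

omit [Fintype A] in
theorem exists_perm_pair {i j i' j' : A} (h : i ≠ j) (h' : i' ≠ j') :
    ∃ π : Equiv.Perm A, π i = i' ∧ π j = j' := by
  refine ⟨Equiv.swap j' (Equiv.swap i i' j) * Equiv.swap i i', ?_, ?_⟩
  · rw [Equiv.Perm.mul_apply, Equiv.swap_apply_left]
    refine Equiv.swap_apply_of_ne_of_ne h' ?_
    intro he
    have := congrArg (Equiv.swap i i') he
    rw [Equiv.swap_apply_right, Equiv.swap_apply_self] at this
    exact h this
  · rw [Equiv.Perm.mul_apply, Equiv.swap_apply_right]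

/-- Phases and permutations leave three free values: the two pairings of distinct rows and the
moment with all rows equal. The rotation forces the third to be the sum of the other two. -/
theorem exists_haarMoment₄_eq {i₀ j₀ : A} (h₀ : i₀ ≠ j₀) : ∃ α β : ℂ, ∀ i j k l : A,
    haarMoment₄ i j k l a b c d = α * ((if i = k then 1 else 0) * (if j = l then 1 else 0)) +
      β * ((if i = l then 1 else 0) * (if j = k then 1 else 0)) := by
  refine ⟨haarMoment₄ i₀ j₀ i₀ j₀ a b c d, haarMoment₄ i₀ j₀ j₀ i₀ a b c d, ?_⟩
  have hα : ∀ i j, i ≠ j → haarMoment₄ i j i j a b c d = haarMoment₄ i₀ j₀ i₀ j₀ a b c d := by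
    intro i j h
    obtain ⟨π, h1, h2⟩ := exists_perm_pair h₀ h
    rw [← h1, ← h2, haarMoment₄_perm a b c d π]
  have hβ : ∀ i j, i ≠ j → haarMoment₄ i j j i a b c d = haarMoment₄ i₀ j₀ j₀ i₀ a b c d := by
    intro i j h
    obtain ⟨π, h1, h2⟩ := exists_perm_pair h₀ h
    rw [← h1, ← h2, haarMoment₄_perm a b c d π]
  have hγ : ∀ i, haarMoment₄ i i i i a b c d =
      haarMoment₄ i₀ j₀ i₀ j₀ a b c d + haarMoment₄ i₀ j₀ j₀ i₀ a b c d := by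
    intro i
    obtain ⟨q, hq⟩ : ∃ q, i ≠ q := by
      by_cases h : i = i₀
      · exact ⟨j₀, h ▸ h₀⟩
      · exact ⟨i₀, h⟩
    have h1 := haarMoment₄_rot a b c d hq
    have h2 := haarMoment₄_perm a b c d (Equiv.swap i q) i i i i
    rw [Equiv.swap_apply_left] at h2
    rw [h2, hα _ _ hq, hα _ _ hq.symm, hβ _ _ hq, hβ _ _ hq.symm] at h1
    linear_combination h1 / 2
  intro i j k l
  by_cases hij : i = j
  · subst hij
    by_cases hik : i = k
    · subst hik
      by_cases hil : i = l
      · subst hil; simp [hγ]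
      · rw [haarMoment₄_eq_zero a b c d i _ _ _ _ (by simp [Ne.symm hil])]
        simp [hil]
    · rw [haarMoment₄_eq_zero a b c d i _ _ _ _ (by
        simp only [if_true, if_neg (Ne.symm hik)]; split_ifs <;> omega)]
      simp [hik]
  · by_cases hik : i = k
    · subst hik
      by_cases hjl : j = l
      · subst hjl; simp [hα _ _ hij, hij]
      · rw [haarMoment₄_eq_zero a b c d j _ _ _ _ (by simp [hij, Ne.symm hjl])]
        simp [hjl, Ne.symm hij]
    · by_cases hil : i = l
      · subst hil
        by_cases hjk : j = k
        · subst hjk; simp [hβ _ _ hij, hij]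
        · rw [haarMoment₄_eq_zero a b c d j _ _ _ _ (by simp [hij, Ne.symm hjk])]
          simp [hjk, hik]
      · rw [haarMoment₄_eq_zero a b c d i _ _ _ _ (by
          simp only [if_true, if_neg (Ne.symm hik), if_neg (Ne.symm hil)]; split_ifs <;> omega)]
        simp [hik, hil]

/-- The two unitarity contractions evaluate d²α + dβ and dα + d²β, which determine α and β when d >
1. Keeping the factor d² - 1 on the left makes the identity valid, as 0 = 0, also for d = 1. -/
theorem haarMoment₄_eq (i j k l : A) :
    ((Fintype.card A : ℂ) ^ 2 - 1) * haarMoment₄ i j k l a b c d =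
      (if i = k then 1 else 0) * (if j = l then 1 else 0) *
        ((if a = c then 1 else 0) * (if b = d then 1 else 0) -
          (if a = d then 1 else 0) * (if b = c then 1 else 0) / Fintype.card A) +
      (if i = l then 1 else 0) * (if j = k then 1 else 0) *
        ((if a = d then 1 else 0) * (if b = c then 1 else 0) -
          (if a = c then 1 else 0) * (if b = d then 1 else 0) / Fintype.card A) := by
  rcases Nat.lt_or_ge 1 (Fintype.card A) with h1 | h1
  · obtain ⟨i₀, j₀, h₀⟩ := Fintype.one_lt_card_iff.1 h1
    obtain ⟨α, β, h⟩ := exists_haarMoment₄_eq a b c d h₀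
    have hc0 : (Fintype.card A : ℂ) ≠ 0 := by exact_mod_cast (by omega : Fintype.card A ≠ 0)
    have hI : ∀ i j k l, Integrable (fun U : Matrix.unitaryGroup A ℂ =>
        (U : Matrix A A ℂ) i a * (U : Matrix A A ℂ) j b *
        star ((U : Matrix A A ℂ) k c) * star ((U : Matrix A A ℂ) l d)) (haarUnitary A) :=
      fun i j k l => haarUnitary_integrable (by fun_prop)
    have s1 : ∑ i, ∑ j, haarMoment₄ i j i j a b c d =
        (if a = c then 1 else 0) * (if b = d then 1 else 0) := by
      unfold haarMoment₄
      simp only [← integral_finsetSum Finset.univ fun l _ => hI _ l _ l]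
      rw [← integral_finsetSum Finset.univ fun k _ =>
        integrable_finsetSum Finset.univ fun l _ => hI k l k l]
      rw [integral_congr_ae (g := fun _ => (if a = c then 1 else 0) * (if b = d then 1 else 0))
        (Filter.Eventually.of_forall fun U => ?_)]
      · simp
      · simp only [← unitary_sum_mul_star U, Finset.sum_mul_sum]
        exact Finset.sum_congr rfl fun i _ => Finset.sum_congr rfl fun j _ => by ring
    have s2 : ∑ i, ∑ j, haarMoment₄ i j j i a b c d =
        (if a = d then 1 else 0) * (if b = c then 1 else 0) := by
      unfold haarMoment₄
      simp only [← integral_finsetSum Finset.univ fun l _ => hI _ l l _]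
      rw [← integral_finsetSum Finset.univ fun k _ =>
        integrable_finsetSum Finset.univ fun l _ => hI k l l k]
      rw [integral_congr_ae (g := fun _ => (if a = d then 1 else 0) * (if b = c then 1 else 0))
        (Filter.Eventually.of_forall fun U => ?_)]
      · simp
      · simp only [← unitary_sum_mul_star U, Finset.sum_mul_sum]
        exact Finset.sum_congr rfl fun i _ => Finset.sum_congr rfl fun j _ => by ring
    have e1 : ∑ i, ∑ j, haarMoment₄ i j i j a b c d =
        α * (Fintype.card A : ℂ) ^ 2 + β * Fintype.card A := by
      simp [h, Finset.sum_add_distrib]; ring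
    have e2 : ∑ i, ∑ j, haarMoment₄ i j j i a b c d =
        α * (Fintype.card A : ℂ) + β * Fintype.card A ^ 2 := by
      simp [h, Finset.sum_add_distrib]; ring
    rw [← s1, ← s2, e1, e2, h]
    field_simp
    ring
  · have hc : Fintype.card A = 1 := le_antisymm h1 (Fintype.card_pos_iff.2 ⟨a⟩)
    have hsub : Subsingleton A := Fintype.card_le_one_iff_subsingleton.1 h1
    have : ∀ x y : A, (x = y) = True := fun x y => eq_true (Subsingleton.elim x y)
    simp only [this]
    simp [hc]

end

end

end

noncomputable section

open Matrix MeasureTheory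

section
variable {A C E : Type*} [Fintype A] [DecidableEq A] [Fintype C] [DecidableEq C] [Fintype E]
  [DecidableEq E]

/-! ### The decoupled state as a compression of `ρ ⊗ ω` -/

/-- The operator `V` with `Vᴴ (ρ ⊗ ω) V = T(U ρ Uᴴ)`, where `ω` is the Choi operator of `T`. -/
def teleportOp (C E : Type*) [DecidableEq C] [DecidableEq E] (U : Matrix A A ℂ) :
    Matrix ((A × E) × (A × C)) (C × E) ℂ :=
  Matrix.of fun x y => (√(Fintype.card A) : ℂ) * star (U x.2.1 x.1.1) *
    ((if x.2.2 = y.1 then 1 else 0) * (if x.1.2 = y.2 then 1 else 0))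

/-- The compression of `ρ ⊗ ω` by the teleportation operator of `U`. -/
def compressedState (ρ : Matrix (A × E) (A × E) ℂ) (ω : Matrix (A × C) (A × C) ℂ)
    (U : Matrix A A ℂ) : Matrix (C × E) (C × E) ℂ :=
  (teleportOp C E U)ᴴ * (ρ ⊗ₖ ω) * teleportOp C E U

theorem sum_comm_pairs {I J K L : Type*} [Fintype I] [Fintype J] [Fintype K] [Fintype L]
    (F : I → J → K → L → ℂ) :
    ∑ i, ∑ j, ∑ k, ∑ l, F i j k l = ∑ k, ∑ l, ∑ i, ∑ j, F i j k l := by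
  have := Finset.sum_comm (s := (Finset.univ : Finset (I × J))) (t := (Finset.univ : Finset (K × L)))
    (f := fun x y => F x.1 x.2 y.1 y.2)
  simpa only [Fintype.sum_prod_type] using this

omit [DecidableEq A] in
theorem sqrt_card_mul_self : (√(Fintype.card A) : ℂ) * (√(Fintype.card A) : ℂ) =
    (Fintype.card A : ℂ) := by
  rw [← Complex.ofReal_mul, Real.mul_self_sqrt (Nat.cast_nonneg _), Complex.ofReal_natCast]

omit [DecidableEq A] in
theorem teleportOp_conj_apply (U : Matrix A A ℂ) (M : Matrix (C × E) (C × E) ℂ)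
    (x y : (A × E) × (A × C)) :
    (teleportOp C E U * M * (teleportOp C E U)ᴴ) x y =
      (Fintype.card A : ℂ) * (star (U x.2.1 x.1.1) * U y.2.1 y.1.1) *
        M (x.2.2, x.1.2) (y.2.2, y.1.2) := by
  rw [← sqrt_card_mul_self, Matrix.mul_apply]
  simp only [Matrix.mul_apply, teleportOp, of_apply, conjTranspose_apply, Fintype.sum_prod_type,
    star_mul', star_star]
  simp only [mul_ite, ite_mul, mul_one, mul_zero, zero_mul, apply_ite star, star_one,
    star_zero, Finset.sum_ite_eq, Finset.mem_univ, if_true]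
  rw [RCLike.star_def, Complex.conj_ofReal]
  simp only [← RCLike.star_def]
  ring

omit [DecidableEq A] in
theorem compressedState_apply (ρ : Matrix (A × E) (A × E) ℂ) (ω : Matrix (A × C) (A × C) ℂ)
    (U : Matrix A A ℂ) (p q : C × E) :
    compressedState ρ ω U p q = (Fintype.card A : ℂ) * ∑ a, ∑ a', ∑ b, ∑ b',
      ρ (a, p.2) (b, q.2) * ω (a', p.1) (b', q.1) * (U a' a * star (U b' b)) := by
  rw [← sqrt_card_mul_self, compressedState, Matrix.mul_apply]
  simp only [Matrix.mul_apply, teleportOp, of_apply, conjTranspose_apply, Fintype.sum_prod_type,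
    star_mul', star_star, kroneckerMap_apply]
  simp only [mul_ite, ite_mul, mul_one, mul_zero, zero_mul, apply_ite star, star_one,
    star_zero, Finset.sum_ite_eq', Finset.sum_const_zero, Finset.mem_univ,
    if_true, RCLike.star_def, Complex.conj_ofReal, Finset.sum_ite_irrel]
  simp only [Finset.sum_mul, Finset.mul_sum]
  rw [sum_comm_pairs]
  refine Finset.sum_congr rfl fun a _ => Finset.sum_congr rfl fun a' _ =>
    Finset.sum_congr rfl fun b _ => Finset.sum_congr rfl fun b' _ => ?_
  ring

omit [DecidableEq A] in
theorem compressedState_posSemidef {ρ : Matrix (A × E) (A × E) ℂ} {ω : Matrix (A × C) (A × C) ℂ}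
    (hρ : ρ.PosSemidef) (hω : ω.PosSemidef) (U : Matrix A A ℂ) :
    (compressedState ρ ω U).PosSemidef :=
  (hρ.kronecker hω).conjTranspose_mul_mul_same _

theorem maxEntangled_apply (i a j b : A) : maxEntangled A (i, a) (j, b) =
    (Fintype.card A : ℂ)⁻¹ * ((if i = a then 1 else 0) * (if j = b then 1 else 0)) := by
  simp only [maxEntangled, Matrix.smul_apply, Matrix.sum_apply, kroneckerMap_apply, single_apply,
    smul_eq_mul]
  congr 1
  rw [Finset.sum_eq_single i (fun k _ hk => by simp [hk]) (by simp),
    Finset.sum_eq_single j (fun k _ hk => by simp [hk]) (by simp)]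
  by_cases h1 : i = a <;> by_cases h2 : j = b <;> simp [h1, h2]

omit [Fintype C] [DecidableEq C] in
theorem choi_apply (T : Matrix A A ℂ →ₗ[ℂ] Matrix C C ℂ) (a b : A) (c c' : C) :
    choi T (a, c) (b, c') = (Fintype.card A : ℂ)⁻¹ * T (Matrix.single a b 1) c c' := by
  have : (Matrix.of fun i j => maxEntangled A (i, a) (j, b)) =
      (Fintype.card A : ℂ)⁻¹ • Matrix.single a b (1 : ℂ) := by
    ext i j
    simp only [of_apply, maxEntangled_apply, Matrix.smul_apply, single_apply, smul_eq_mul]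
    by_cases h1 : i = a <;> by_cases h2 : j = b <;> simp [h1, h2, Ne.symm]
  simp only [choi, applyFirst, submatrix_apply, Prod.swap_prod_mk, of_apply]
  rw [this, map_smul, Matrix.smul_apply, smul_eq_mul]

/-- The teleportation identity: T is recovered from its Choi operator by contraction with an
unnormalized maximally entangled vector, into which the unitary is absorbed. All dependence on U
then sits in the compression, with ρ ⊗ ω fixed. -/
theorem decoupledState_eq (T : Matrix A A ℂ →ₗ[ℂ] Matrix C C ℂ) (ρ : Matrix (A × E) (A × E) ℂ)
    (U : Matrix.unitaryGroup A ℂ) :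
    decoupledState T ρ U = compressedState ρ (choi T) (U : Matrix A A ℂ) := by
  ext p q
  have hcard : ∀ a : A, (Fintype.card A : ℂ) ≠ 0 := fun a =>
    Nat.cast_ne_zero.2 (Fintype.card_pos_iff.2 ⟨a⟩).ne'
  have hT : ∀ X : Matrix A A ℂ, T X p.1 q.1 = ∑ a', ∑ b', X a' b' *
      ((Fintype.card A : ℂ) * choi T (a', p.1) (b', q.1)) := by
    intro X
    conv_lhs => rw [matrix_eq_sum_single X]
    simp only [map_sum, Matrix.sum_apply]
    refine Finset.sum_congr rfl fun a _ => Finset.sum_congr rfl fun b _ => ?_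
    rw [choi_apply, mul_inv_cancel_left₀ (hcard a), ← mul_one (X a b), ← smul_eq_mul,
      ← smul_single, map_smul, Matrix.smul_apply, smul_eq_mul, smul_eq_mul, mul_one]
  rw [decoupledState, applyFirst, of_apply, hT, compressedState_apply, Finset.mul_sum]
  simp only [of_apply, Matrix.mul_apply, kroneckerMap_apply, conjTranspose_apply,
    Fintype.sum_prod_type, Matrix.one_apply]
  simp only [mul_ite, ite_mul, mul_one, mul_zero, zero_mul, apply_ite star,
    star_zero, Finset.sum_ite_eq, Finset.mem_univ,
    if_true]
  simp only [Finset.sum_mul, Finset.mul_sum]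
  calc _ = ∑ a', ∑ b', ∑ b, ∑ a, (Fintype.card A : ℂ) * (ρ (a, p.2) (b, q.2) *
        choi T (a', p.1) (b', q.1) *
        ((U : Matrix A A ℂ) a' a * star ((U : Matrix A A ℂ) b' b))) :=
        Finset.sum_congr rfl fun a' _ => Finset.sum_congr rfl fun b' _ =>
          Finset.sum_congr rfl fun b _ => Finset.sum_congr rfl fun a _ => by ring
    _ = ∑ b, ∑ a, ∑ a', ∑ b', (Fintype.card A : ℂ) * (ρ (a, p.2) (b, q.2) *
        choi T (a', p.1) (b', q.1) *
        ((U : Matrix A A ℂ) a' a * star ((U : Matrix A A ℂ) b' b))) := sum_comm_pairs _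
    _ = _ := by
        rw [Finset.sum_comm]
        exact Finset.sum_congr rfl fun a _ => Finset.sum_comm

omit [Fintype C] [DecidableEq C] in
theorem marginalSnd_choi (T : Matrix A A ℂ →ₗ[ℂ] Matrix C C ℂ) :
    marginalSnd (choi T) = imageOfMixed T := by
  ext c c'
  simp only [marginalSnd, of_apply, choi_apply, imageOfMixed]
  rw [← Finset.mul_sum, map_smul, Matrix.smul_apply, smul_eq_mul]
  congr 1
  have : (1 : Matrix A A ℂ) = ∑ a, Matrix.single a a 1 := by
    rw [← diagonal_one, ← Matrix.sum_single_eq_diagonal]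
  rw [this, map_sum, Matrix.sum_apply]

omit [DecidableEq C] in
theorem choi_posSemidef {T : Matrix A A ℂ →ₗ[ℂ] Matrix C C ℂ} (hT : IsCompletelyPositive T) :
    (choi T).PosSemidef := by
  have hmax : (maxEntangled A).PosSemidef := by
    have h := (posSemidef_vecMulVec_self_star
      (fun x : A × A => if x.1 = x.2 then (1 : ℂ) else 0)).smul
      (a := (Fintype.card A : ℂ)⁻¹) (by positivity)
    convert h using 1
    ext ⟨i, a⟩ ⟨j, b⟩
    rw [maxEntangled_apply, Matrix.smul_apply, vecMulVec_apply, Pi.star_apply, smul_eq_mul]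
    by_cases h1 : i = a <;> by_cases h2 : j = b <;> simp [h1, h2]
  -- Complete positivity is formulated with reference systems `Fin k`, so the copy of A is
  -- relabelled.
  let e := Fintype.equivFin A
  have h := hT _ _ (hmax.submatrix fun x : A × Fin (Fintype.card A) => (x.1, e.symm x.2))
  have h2 := h.submatrix fun x : A × C => (x.2, e x.1)
  convert h2 using 1
  ext x y
  simp [choi, applyFirst]

/-! ### Averages over the unitary group -/

theorem integral_compressedState (ρ : Matrix (A × E) (A × E) ℂ) (ω : Matrix (A × C) (A × C) ℂ)
    (p q : C × E) :
    ∫ U : Matrix.unitaryGroup A ℂ, compressedState ρ ω (U : Matrix A A ℂ) p q ∂(haarUnitary A) =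
      (marginalSnd ω ⊗ₖ marginalSnd ρ) p q := by
  have hI : ∀ i k a c, Integrable (fun U : Matrix.unitaryGroup A ℂ =>
      (U : Matrix A A ℂ) i a * star ((U : Matrix A A ℂ) k c)) (haarUnitary A) :=
    fun i k a c => haarUnitary_integrable (by fun_prop)
  simp only [compressedState_apply]
  rw [integral_const_mul]
  have i1 := fun a a' b b' => (hI a' b' a b).const_mul
    (ρ (a, p.2) (b, q.2) * ω (a', p.1) (b', q.1))
  have i2 := fun a a' b => integrable_finsetSum Finset.univ fun b' _ => i1 a a' b b'
  have i3 := fun a a' => integrable_finsetSum Finset.univ fun b _ => i2 a a' b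
  have i4 := fun a => integrable_finsetSum Finset.univ fun a' _ => i3 a a'
  rw [integral_finsetSum _ fun a _ => i4 a, Finset.mul_sum]
  simp only [kroneckerMap_apply, marginalSnd, of_apply]
  rw [mul_comm (∑ a, ω _ _), Finset.sum_mul_sum]
  refine Finset.sum_congr rfl fun a _ => ?_
  rw [integral_finsetSum _ fun a' _ => i3 a a', Finset.mul_sum]
  refine Finset.sum_congr rfl fun a' _ => ?_
  rw [integral_finsetSum _ fun b _ => i2 a a' b, Finset.mul_sum]
  rw [Finset.sum_eq_single a]
  · rw [integral_finsetSum _ fun b' _ => i1 a a' a b', Finset.mul_sum,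
      Finset.sum_eq_single a']
    · rw [integral_const_mul, ← haarMoment₂, mul_left_comm, haarMoment₂_eq]
      simp
    · intro b' _ hb'
      rw [integral_const_mul, ← haarMoment₂, mul_left_comm, haarMoment₂_eq]
      simp [hb'.symm]
    · simp
  · intro b _ hb
    rw [integral_finsetSum _ fun b' _ => i1 a a' b b', Finset.mul_sum]
    refine Finset.sum_eq_zero fun b' _ => ?_
    rw [integral_const_mul, ← haarMoment₂, mul_left_comm, haarMoment₂_eq]
    simp [hb.symm]
  · simp

/-- The average plays the role of ∑ V Vᴴ = 1 in Jensen's inequality: the offset of the tangent bound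
averages to its value at the identity. -/
theorem integral_teleportOp_mul (x y : (A × E) × (A × C)) :
    ∫ U : Matrix.unitaryGroup A ℂ,
      (teleportOp C E (U : Matrix A A ℂ) * (teleportOp C E (U : Matrix A A ℂ))ᴴ) x y
      ∂(haarUnitary A) = (1 : Matrix ((A × E) × (A × C)) ((A × E) × (A × C)) ℂ) x y := by
  have h : ∀ U : Matrix.unitaryGroup A ℂ,
      (teleportOp C E (U : Matrix A A ℂ) * (teleportOp C E (U : Matrix A A ℂ))ᴴ) x y =
      (Fintype.card A : ℂ) * (1 : Matrix (C × E) (C × E) ℂ) (x.2.2, x.1.2) (y.2.2, y.1.2) *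
        ((U : Matrix A A ℂ) y.2.1 y.1.1 * star ((U : Matrix A A ℂ) x.2.1 x.1.1)) := by
    intro U
    have := teleportOp_conj_apply (U : Matrix A A ℂ) (1 : Matrix (C × E) (C × E) ℂ) x y
    rw [Matrix.mul_one] at this
    rw [this]; ring
  simp only [h]
  rw [integral_const_mul, ← haarMoment₂, mul_right_comm, haarMoment₂_eq]
  obtain ⟨⟨x1, x2⟩, x3, x4⟩ := x
  obtain ⟨⟨y1, y2⟩, y3, y4⟩ := y
  simp only [Matrix.one_apply, Prod.mk.injEq, eq_comm (a := y1), eq_comm (a := y3)]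
  by_cases h1 : x1 = y1 <;> by_cases h2 : x2 = y2 <;> by_cases h3 : x3 = y3 <;>
    by_cases h4 : x4 = y4 <;> simp [h1, h2, h3, h4]

theorem sum_haar_weights (r w : A → A → ℂ) (x y x' y' : A) (P Q d : ℂ) :
    ∑ a, ∑ a', ∑ b, ∑ b', r a b * w a' b' *
      (P * (if a' = b' then 1 else 0) * (Q * (if a = b then 1 else 0) -
        (if y = b then 1 else 0) * (if a = x then 1 else 0) / d) +
      (if y' = b' then 1 else 0) * (if a' = x' then 1 else 0) *
        ((if y = b then 1 else 0) * (if a = x then 1 else 0) -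
          Q * (if a = b then 1 else 0) / d)) =
      P * (∑ a, w a a) * (Q * ∑ a, r a a - r x y / d) +
        w x' y' * (r x y - Q * (∑ a, r a a) / d) := by
  have h : ∀ (f g : A → A → ℂ), ∑ a, ∑ a', ∑ b, ∑ b', f a b * g a' b' =
      (∑ a, ∑ b, f a b) * (∑ a', ∑ b', g a' b') := by
    intro f g
    simp only [Finset.sum_mul_sum]
  have e1 : ∑ a, ∑ b, w a b * (if a = b then 1 else 0) = ∑ a, w a a := by simp
  have e2 : ∑ a, ∑ b, w a b * ((if y' = b then 1 else 0) * (if a = x' then 1 else 0)) =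
      w x' y' := by
    simp
  have e3 : ∑ a, ∑ b, r a b * (Q * (if a = b then 1 else 0) -
      (if y = b then 1 else 0) * (if a = x then 1 else 0) / d) = Q * ∑ a, r a a - r x y / d := by
    simp [mul_sub, Finset.sum_sub_distrib, Finset.mul_sum, mul_div_assoc', ← Finset.sum_div,
      mul_comm]
  have e4 : ∑ a, ∑ b, r a b * ((if y = b then 1 else 0) * (if a = x then 1 else 0) -
      Q * (if a = b then 1 else 0) / d) = r x y - Q * (∑ a, r a a) / d := by
    simp [mul_sub, Finset.sum_sub_distrib, Finset.mul_sum, mul_div_assoc', ← Finset.sum_div,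
      mul_comm]
  rw [← e3, ← e4, ← e2, ← e1, mul_assoc P, mul_comm (∑ a, ∑ b, w a b * _),
    mul_comm (∑ a, ∑ b, w a b * _), ← h, ← h]
  simp only [Finset.mul_sum, ← Finset.sum_add_distrib]
  refine Finset.sum_congr rfl fun a _ => Finset.sum_congr rfl fun a' _ =>
    Finset.sum_congr rfl fun b _ => Finset.sum_congr rfl fun b' _ => ?_
  ring

/-- The four contraction patterns of the fourth moment give σ, ρ ⊗ ω and the two cross terms pairing
one operator with the marginal product of the other. The cross terms carry the negative Weingarten
coefficient. -/
theorem integral_teleportOp_conj (ρ : Matrix (A × E) (A × E) ℂ) (ω : Matrix (A × C) (A × C) ℂ)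
    (x y : (A × E) × (A × C)) :
    ((Fintype.card A : ℂ) ^ 2 - 1) * ∫ U : Matrix.unitaryGroup A ℂ,
      (teleportOp C E (U : Matrix A A ℂ) * compressedState ρ ω (U : Matrix A A ℂ) *
        (teleportOp C E (U : Matrix A A ℂ))ᴴ) x y ∂(haarUnitary A) =
      ((Fintype.card A : ℂ) ^ 2 •
        ((1 : Matrix A A ℂ) ⊗ₖ marginalSnd ρ ⊗ₖ ((1 : Matrix A A ℂ) ⊗ₖ marginalSnd ω) + ρ ⊗ₖ ω) -
      (Fintype.card A : ℂ) • (ρ ⊗ₖ ((1 : Matrix A A ℂ) ⊗ₖ marginalSnd ω) +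
        ((1 : Matrix A A ℂ) ⊗ₖ marginalSnd ρ) ⊗ₖ ω)) x y := by
  have hI : ∀ i j k l a b c d, Integrable (fun U : Matrix.unitaryGroup A ℂ =>
      (U : Matrix A A ℂ) i a * (U : Matrix A A ℂ) j b *
      star ((U : Matrix A A ℂ) k c) * star ((U : Matrix A A ℂ) l d)) (haarUnitary A) :=
    fun i j k l a b c d => haarUnitary_integrable (by fun_prop)
  have h1 : ∫ U : Matrix.unitaryGroup A ℂ,
      (teleportOp C E (U : Matrix A A ℂ) * compressedState ρ ω (U : Matrix A A ℂ) *
        (teleportOp C E (U : Matrix A A ℂ))ᴴ) x y ∂(haarUnitary A) =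
      (Fintype.card A : ℂ) ^ 2 * ∑ a, ∑ a', ∑ b, ∑ b',
        ρ (a, x.1.2) (b, y.1.2) * ω (a', x.2.2) (b', y.2.2) *
        haarMoment₄ y.2.1 a' x.2.1 b' y.1.1 a x.1.1 b := by
    have : ∀ U : Matrix.unitaryGroup A ℂ, (teleportOp C E (U : Matrix A A ℂ) *
        compressedState ρ ω (U : Matrix A A ℂ) * (teleportOp C E (U : Matrix A A ℂ))ᴴ) x y =
        (Fintype.card A : ℂ) ^ 2 * ∑ a, ∑ a', ∑ b, ∑ b',
        ρ (a, x.1.2) (b, y.1.2) * ω (a', x.2.2) (b', y.2.2) *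
        ((U : Matrix A A ℂ) y.2.1 y.1.1 * (U : Matrix A A ℂ) a' a *
          star ((U : Matrix A A ℂ) x.2.1 x.1.1) * star ((U : Matrix A A ℂ) b' b)) := by
      intro U
      rw [teleportOp_conj_apply, compressedState_apply]
      simp only [Finset.mul_sum]
      refine Finset.sum_congr rfl fun a _ => Finset.sum_congr rfl fun a' _ =>
        Finset.sum_congr rfl fun b _ => Finset.sum_congr rfl fun b' _ => ?_
      ring
    simp only [this]
    rw [integral_const_mul]
    congr 1
    have i1 := fun a a' b b' => (hI y.2.1 a' x.2.1 b' y.1.1 a x.1.1 b).const_mul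
      (ρ (a, x.1.2) (b, y.1.2) * ω (a', x.2.2) (b', y.2.2))
    have i2 := fun a a' b => integrable_finsetSum Finset.univ fun b' _ => i1 a a' b b'
    have i3 := fun a a' => integrable_finsetSum Finset.univ fun b _ => i2 a a' b
    have i4 := fun a => integrable_finsetSum Finset.univ fun a' _ => i3 a a'
    rw [integral_finsetSum _ fun a _ => i4 a]
    refine Finset.sum_congr rfl fun a _ => ?_
    rw [integral_finsetSum _ fun a' _ => i3 a a']
    refine Finset.sum_congr rfl fun a' _ => ?_
    rw [integral_finsetSum _ fun b _ => i2 a a' b]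
    refine Finset.sum_congr rfl fun b _ => ?_
    rw [integral_finsetSum _ fun b' _ => i1 a a' b b']
    refine Finset.sum_congr rfl fun b' _ => ?_
    rw [integral_const_mul, haarMoment₄]
  have h2 : ∀ a a' b b' : A, ((Fintype.card A : ℂ) ^ 2 - 1) *
      (ρ (a, x.1.2) (b, y.1.2) * ω (a', x.2.2) (b', y.2.2) *
        haarMoment₄ y.2.1 a' x.2.1 b' y.1.1 a x.1.1 b) = ρ (a, x.1.2) (b, y.1.2) *
        ω (a', x.2.2) (b', y.2.2) * (((if y.2.1 = x.2.1 then 1 else 0) *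
        (if a' = b' then 1 else 0) * ((if y.1.1 = x.1.1 then 1 else 0) * (if a = b then 1 else 0) -
        (if y.1.1 = b then 1 else 0) * (if a = x.1.1 then 1 else 0) / Fintype.card A) +
      (if y.2.1 = b' then 1 else 0) * (if a' = x.2.1 then 1 else 0) *
        ((if y.1.1 = b then 1 else 0) * (if a = x.1.1 then 1 else 0) -
          (if y.1.1 = x.1.1 then 1 else 0) * (if a = b then 1 else 0) / Fintype.card A))) := by
    intro a a' b b'
    rw [mul_left_comm, haarMoment₄_eq]
  rw [h1, mul_left_comm]
  have h3 := sum_haar_weights (fun a b => ρ (a, x.1.2) (b, y.1.2))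
    (fun a' b' => ω (a', x.2.2) (b', y.2.2)) x.1.1 y.1.1 x.2.1 y.2.1
    (if y.2.1 = x.2.1 then 1 else 0) (if y.1.1 = x.1.1 then 1 else 0) (Fintype.card A)
  simp only [← h2, ← Finset.mul_sum] at h3
  have hc : (Fintype.card A : ℂ) ≠ 0 := Nat.cast_ne_zero.2 (Fintype.card_pos_iff.2 ⟨x.1.1⟩).ne'
  rw [h3]
  simp only [Matrix.sub_apply, Matrix.smul_apply, Matrix.add_apply, kroneckerMap_apply,
    Matrix.one_apply, marginalSnd, of_apply, smul_eq_mul, eq_comm (a := x.1.1),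
    eq_comm (a := x.2.1)]
  field_simp
  ring

end

end

noncomputable section

open Matrix MeasureTheory

/-! ### Averaging linear functionals; continuity of the functional calculus -/

section
variable {A : Type*} [Fintype A] [DecidableEq A] {m : Type*} [Fintype m] [DecidableEq m]

open scoped Matrix.Norms.L2Operator in
theorem continuous_cfc_matrix {α : Type*} [TopologicalSpace α] {F : α → Matrix m m ℂ}
    (hF : Continuous F) (hs : ∀ x, (F x).IsHermitian) {h : ℝ → ℝ} (hh : Continuous h) :
    Continuous fun x => cfc h (F x) :=
  Continuous.cfc_of_mem_nhdsSet h (s := Set.univ) Filter.univ_mem hF hs hh.continuousOn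

open scoped Matrix.Norms.L2Operator in
theorem integral_linearMap_eq (φ : Matrix m m ℂ →ₗ[ℝ] ℝ)
    {F : Matrix.unitaryGroup A ℂ → Matrix m m ℂ} (hF : Continuous F) {M : Matrix m m ℂ}
    (hM : ∀ x y, ∫ U, F U x y ∂(haarUnitary A) = M x y) :
    Integrable (fun U => φ (F U)) (haarUnitary A) ∧ ∫ U, φ (F U) ∂(haarUnitary A) = φ M := by
  have hi : Integrable F (haarUnitary A) := haarUnitary_integrable hF
  have h1 : ∫ U, F U ∂(haarUnitary A) = M := by
    ext x y
    rw [← hM]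
    exact (((LinearMap.toContinuousLinearMap
      ((entryLinearMap ℂ ℂ x y).restrictScalars ℝ)).integral_comp_comm hi).symm)
  refine ⟨(LinearMap.toContinuousLinearMap φ).integrable_comp hi, ?_⟩
  rw [← h1]
  exact (LinearMap.toContinuousLinearMap φ).integral_comp_comm hi

end

/-! ### The pinching inequality -/

section
variable {A B : Type*} [Fintype A] [DecidableEq A] [Fintype B] [DecidableEq B]

omit [DecidableEq A] [Fintype B] [DecidableEq B] in
theorem marginalSnd_posSemidef {X : Matrix (A × B) (A × B) ℂ} (hX : X.PosSemidef) :
    (marginalSnd X).PosSemidef := by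
  have : marginalSnd X = ∑ a, X.submatrix (fun b => (a, b)) (fun b => (a, b)) := by
    ext b b'
    simp [marginalSnd, Matrix.sum_apply]
  rw [this]
  exact posSemidef_sum _ fun a _ => hX.submatrix _

theorem card_smul_one_sub_ones_posSemidef :
    ((Fintype.card A : ℂ) • (1 : Matrix A A ℂ) - Matrix.of fun _ _ => 1).PosSemidef := by
  rcases isEmpty_or_nonempty A with hA | hA
  · convert PosSemidef.zero (n := A) (R := ℂ)
    ext i; exact isEmptyElim i
  · have hc : (Fintype.card A : ℂ) ≠ 0 := Nat.cast_ne_zero.2 Fintype.card_ne_zero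
    set J : Matrix A A ℂ := Matrix.of fun _ _ => 1 with hJ
    have hJJ : J * J = (Fintype.card A : ℂ) • J := by
      ext i j; simp [hJ, Matrix.mul_apply]
    have hJh : Jᴴ = J := by ext i j; simp [hJ]
    have h := (posSemidef_conjTranspose_mul_self ((Fintype.card A : ℂ) • (1 : Matrix A A ℂ) - J)).smul
      (a := (Fintype.card A : ℂ)⁻¹) (by positivity)
    convert h using 1
    rw [conjTranspose_sub, conjTranspose_smul, conjTranspose_one, hJh, star_natCast,
      Matrix.sub_mul, Matrix.mul_sub, Matrix.mul_sub, hJJ, smul_mul_smul_comm, Matrix.one_mul,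
      Matrix.smul_mul, Matrix.mul_smul, Matrix.mul_one, Matrix.one_mul, sub_self, sub_zero, smul_sub,
      smul_smul, smul_smul, ← mul_assoc, inv_mul_cancel₀ hc, one_mul, one_smul]

omit [Fintype B] [DecidableEq B] in
-- The Schur multiplier d·1 - J is positive, where J has all entries 1, so d times the block
-- diagonal of X dominates X. The remaining blocks of d (1 ⊗ X_B) place d X_cc at positions a ≠ c,
-- which is again positive.
theorem pinching {X : Matrix (A × B) (A × B) ℂ} (hX : X.PosSemidef) :
    ((Fintype.card A : ℂ) • ((1 : Matrix A A ℂ) ⊗ₖ marginalSnd X) - X).PosSemidef := by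
  have h1 := ((card_smul_one_sub_ones_posSemidef (A := A)).submatrix
    (Prod.fst : A × B → A)).hadamard hX
  have h2 : ∀ c : A, ((diagonal fun a => if a = c then (0 : ℂ) else (Fintype.card A : ℂ)).submatrix
      (Prod.fst : A × B → A) Prod.fst ⊙
      X.submatrix (fun x : A × B => (c, x.2)) fun x => (c, x.2)).PosSemidef := fun c => by
    refine PosSemidef.hadamard (PosSemidef.submatrix ?_ _) (hX.submatrix _)
    refine posSemidef_diagonal_iff.2 fun a => ?_
    split_ifs <;> positivity
  have h3 := (posSemidef_sum Finset.univ fun c _ => h2 c).add h1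
  convert h3 using 1
  ext ⟨a, b⟩ ⟨a', b'⟩
  simp only [Matrix.sub_apply, Matrix.smul_apply, kroneckerMap_apply, marginalSnd, of_apply,
    smul_eq_mul, Matrix.add_apply, Matrix.sum_apply, hadamard_apply, submatrix_apply,
    Matrix.one_apply, diagonal_apply]
  by_cases h : a = a'
  · subst h
    simp only [if_true, one_mul, mul_one]
    rw [← Finset.add_sum_erase _ _ (Finset.mem_univ a)]
    rw [← Finset.add_sum_erase _ (fun c => (if a = c then 0 else (Fintype.card A : ℂ)) *
      X (c, b) (c, b')) (Finset.mem_univ a)]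
    have : ∑ c ∈ Finset.univ.erase a, (if a = c then 0 else (Fintype.card A : ℂ)) *
        X (c, b) (c, b') = (Fintype.card A : ℂ) * ∑ c ∈ Finset.univ.erase a, X (c, b) (c, b') := by
      rw [Finset.mul_sum]
      refine Finset.sum_congr rfl fun c hc => ?_
      rw [if_neg (Finset.ne_of_mem_erase hc).symm]
    rw [this]
    simp
    ring
  · simp [h]

/-- Sub-blocks of the first factor, in an orthonormal basis given by the columns of `U`. -/
def blockRow {n : Type*} (m : Type*) [DecidableEq m] (U : Matrix n n ℂ) (i : n) : Matrix m (n × m) ℂ :=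
  Matrix.of fun k x => star (U x.1 i) * if k = x.2 then 1 else 0

end

/-! ### Compressions to eigenvectors of the first factor -/

section
variable {n m : Type*} [Fintype n] [DecidableEq n] [Fintype m] [DecidableEq m]

omit [DecidableEq n] in
theorem blockRow_mul_apply (U : Matrix n n ℂ) (i : n) (M : Matrix (n × m) (n × m) ℂ) (k l : m) :
    (blockRow m U i * M * (blockRow m U i)ᴴ) k l =
      ∑ b, ∑ a, star (U a i) * U b i * M (a, k) (b, l) := by
  rw [Matrix.mul_apply]
  simp only [Matrix.mul_apply, blockRow, of_apply, conjTranspose_apply, Fintype.sum_prod_type,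
    star_mul', star_star]
  simp only [mul_ite, ite_mul, mul_one, mul_zero, zero_mul, apply_ite star, star_one,
    star_zero, Finset.sum_ite_eq, Finset.mem_univ, if_true, Finset.sum_mul]
  refine Finset.sum_congr rfl fun b _ => Finset.sum_congr rfl fun a _ => ?_
  ring

theorem blockRow_mul_conjTranspose {U : Matrix n n ℂ} (hU : Uᴴ * U = 1) (i : n) :
    blockRow m U i * (blockRow m U i)ᴴ = 1 := by
  have h := blockRow_mul_apply U i (1 : Matrix (n × m) (n × m) ℂ)
  rw [Matrix.mul_one] at h
  have hU' := congrFun (congrFun hU i) i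
  rw [Matrix.mul_apply, Matrix.one_apply_eq] at hU'
  ext k l
  rw [h]
  by_cases hkl : k = l
  · subst hkl
    rw [Matrix.one_apply_eq, ← hU']
    simp [Matrix.one_apply]
  · simp [Prod.ext_iff, hkl]

theorem sum_blockRow_conj {U : Matrix n n ℂ} (hU : U * Uᴴ = 1) (M : Matrix (n × m) (n × m) ℂ) :
    ∑ i, blockRow m U i * M * (blockRow m U i)ᴴ = marginalSnd M := by
  ext k l
  have hU' : ∀ a b, ∑ i, U b i * star (U a i) = if b = a then 1 else 0 := fun a b => by
    have := congrFun (congrFun hU b) a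
    rwa [Matrix.mul_apply, Matrix.one_apply] at this
  simp only [Matrix.sum_apply, blockRow_mul_apply, marginalSnd, of_apply]
  rw [Finset.sum_comm]
  refine Finset.sum_congr rfl fun b _ => ?_
  rw [Finset.sum_comm]
  simp only [mul_comm (star _), ← Finset.sum_mul, hU']
  simp

theorem trace_kronecker_mul_eq_sum {U ρ : Matrix n n ℂ} {p : n → ℝ} (h : Diagonalizes U p ρ)
    (ω : Matrix m m ℂ) (M : Matrix (n × m) (n × m) ℂ) :
    ((ρ ⊗ₖ ω) * M).trace.re =
      ∑ i, p i * (ω * (blockRow m U i * M * (blockRow m U i)ᴴ)).trace.re := by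
  have hρ : ∀ a b, ρ a b = ∑ i, U a i * p i * star (U b i) := fun a b => by
    conv_lhs => rw [h.eq]
    rw [Matrix.mul_apply]
    simp [mul_diagonal]
  have hW : ∀ i x y, ((blockRow m U i)ᴴ * ω * blockRow m U i) x y =
      U x.1 i * star (U y.1 i) * ω x.2 y.2 := fun i x y => by
    rw [Matrix.mul_apply]
    simp only [Matrix.mul_apply, blockRow, of_apply, conjTranspose_apply, star_mul', star_star]
    simp only [mul_ite, ite_mul, mul_one, mul_zero, zero_mul, apply_ite star, star_one,
      star_zero, Finset.sum_ite_eq', Finset.mem_univ, if_true]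
    ring
  have hsum : ρ ⊗ₖ ω = ∑ i, (p i : ℂ) • ((blockRow m U i)ᴴ * ω * blockRow m U i) := by
    ext x y
    simp only [kroneckerMap_apply, hρ, Matrix.sum_apply, Matrix.smul_apply, hW, smul_eq_mul,
      Finset.sum_mul]
    exact Finset.sum_congr rfl fun i _ => by ring
  rw [hsum, Finset.sum_mul, trace_sum, Complex.re_sum]
  refine Finset.sum_congr rfl fun i _ => ?_
  rw [Matrix.smul_mul, trace_smul, smul_eq_mul, Complex.re_ofReal_mul]
  congr 2
  rw [Matrix.mul_assoc, Matrix.mul_assoc, trace_mul_comm]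
  simp only [Matrix.mul_assoc]

theorem blockRow_conj_cfc {U ρ : Matrix n n ℂ} {p : n → ℝ} (h : Diagonalizes U p ρ)
    {Ω : Matrix m m ℂ} (hΩ : Ω.IsHermitian) (g : ℝ → ℝ) (i : n) :
    blockRow m U i * cfc g (ρ ⊗ₖ Ω) * (blockRow m U i)ᴴ = cfc (fun x => g (p i * x)) Ω := by
  obtain ⟨W, o, hW⟩ := hΩ.exists_diagonalizes
  have hd := (h.kronecker hW).cfc g
  have hrow : blockRow m U i * (U ⊗ₖ W) = Matrix.of fun k x => if x.1 = i then W k x.2 else 0 := by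
    ext k ⟨j, l⟩
    have hU' := congrFun (congrFun h.left i) j
    rw [Matrix.mul_apply, Matrix.one_apply] at hU'
    simp only [Matrix.mul_apply, blockRow, of_apply, kroneckerMap_apply, Fintype.sum_prod_type]
    simp only [mul_ite, ite_mul, mul_one, mul_zero, zero_mul, Finset.sum_ite_eq, Finset.mem_univ,
      if_true, ← mul_assoc, ← Finset.sum_mul]
    simp only [conjTranspose_apply] at hU'
    rw [hU']
    by_cases hij : i = j
    · simp [hij]
    · simp [hij, Ne.symm hij]
  rw [hd.eq, (hW.cfc fun x => g (p i * x)).eq]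
  rw [show blockRow m U i * ((U ⊗ₖ W) * diagonal (fun x : n × m => ((g (p x.1 * o x.2) : ℝ) : ℂ)) *
      (U ⊗ₖ W)ᴴ) * (blockRow m U i)ᴴ = (blockRow m U i * (U ⊗ₖ W)) *
      diagonal (fun x : n × m => ((g (p x.1 * o x.2) : ℝ) : ℂ)) *
      (blockRow m U i * (U ⊗ₖ W))ᴴ by rw [conjTranspose_mul]; simp only [Matrix.mul_assoc], hrow]
  ext k l
  rw [Matrix.mul_apply, Matrix.mul_apply]
  simp only [mul_diagonal, of_apply, conjTranspose_apply, Fintype.sum_prod_type]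
  rw [Finset.sum_eq_single i]
  · simp
  · intro j _ hj; simp [hj]
  · simp

end

end

noncomputable section

open Matrix MeasureTheory

/-! ### Logarithms of Kronecker products -/

section
variable {n m : Type*} [Fintype n] [DecidableEq n] [Fintype m] [DecidableEq m]

theorem cfc_add_smul_one {M : Matrix n n ℂ} (hM : M.IsHermitian) (f : ℝ → ℝ) (c : ℝ) :
    cfc f (M + (c : ℂ) • (1 : Matrix n n ℂ)) = cfc (fun x => f (x + c)) M := by
  obtain ⟨U, a, h⟩ := hM.exists_diagonalizes
  exact ((h.add (h.const_one c)).cfc f).unique (h.cfc fun x => f (x + c))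

theorem cfc_smul_of_pos {M : Matrix n n ℂ} (hM : M.IsHermitian) (f : ℝ → ℝ) (c : ℝ) :
    cfc f ((c : ℂ) • M) = cfc (fun x => f (c * x)) M := by
  obtain ⟨U, a, h⟩ := hM.exists_diagonalizes
  exact ((h.smul c).cfc f).unique (h.cfc fun x => f (c * x))

theorem cfc_fun_add_const {M : Matrix n n ℂ} (hM : M.IsHermitian) (f : ℝ → ℝ) (c : ℝ) :
    cfc (fun x => f x + c) M = cfc f M + (c : ℂ) • (1 : Matrix n n ℂ) := by
  obtain ⟨U, a, h⟩ := hM.exists_diagonalizes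
  exact (h.cfc fun x => f x + c).unique ((h.cfc f).add (h.const_one c))

theorem cfc_sub_posSemidef {M : Matrix n n ℂ} (hM : M.PosSemidef) {f g : ℝ → ℝ}
    (hfg : ∀ x, 0 ≤ x → f x ≤ g x) : (cfc g M - cfc f M).PosSemidef := by
  obtain ⟨U, a, h⟩ := hM.isHermitian.exists_diagonalizes
  have h1 := (h.cfc g).add ((h.cfc f).smul (-1))
  have : cfc g M - cfc f M = cfc g M + ((-1 : ℝ) : ℂ) • cfc f M := by
    rw [sub_eq_add_neg]; simp
  rw [this]
  refine h1.posSemidef fun i => ?_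
  have := hfg _ (h.nonneg hM i)
  simp only [Pi.add_apply]
  linarith

theorem trace_mul_cfc_mono {Z M : Matrix n n ℂ} (hZ : Z.PosSemidef) (hM : M.PosSemidef)
    {f g : ℝ → ℝ} (hfg : ∀ x, 0 ≤ x → f x ≤ g x) :
    (Z * cfc f M).trace.re ≤ (Z * cfc g M).trace.re :=
  trace_mul_re_mono hZ (cfc_sub_posSemidef hM hfg)

theorem trace_cfc_mono {M : Matrix n n ℂ} (hM : M.PosSemidef)
    {f g : ℝ → ℝ} (hfg : ∀ x, 0 ≤ x → f x ≤ g x) :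
    (cfc f M).trace.re ≤ (cfc g M).trace.re := by
  have := trace_mul_cfc_mono PosSemidef.one hM hfg
  simpa using this

theorem trace_mul_cfc_self {M : Matrix n n ℂ} (hM : M.IsHermitian) (f : ℝ → ℝ) :
    M * cfc f M = cfc (fun x => x * f x) M := by
  conv_lhs => rw [← cfc_id_eq hM]
  rw [cfc_comp_cfc hM, cfc_mul_cfc hM]

omit [Fintype n] in
theorem Matrix.PosSemidef.add_smul_one {M : Matrix n n ℂ} (hM : M.PosSemidef) {c : ℝ}
    (hc : 0 < c) : (M + (c : ℂ) • (1 : Matrix n n ℂ)).PosDef := by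
  rw [add_comm]
  exact (PosDef.one.smul (a := (c : ℂ)) (by exact_mod_cast hc)).add_posSemidef hM

omit [DecidableEq n] in
theorem schurForm_ofReal_smul (w : n → n → ℝ) (U Z S : Matrix n n ℂ) (c : ℝ) :
    schurForm w U Z ((c : ℂ) • S) = c * schurForm w U Z S := by
  rw [Complex.coe_smul, map_smul, smul_eq_mul]

/-- `tr ω Y⁻¹ ≤ dim` for `ω ≤ Y`. -/
theorem schurForm_logKernel_one_le {U Y ω : Matrix n n ℂ} {y : n → ℝ} (hY : Diagonalizes U y Y)
    (hy : ∀ i, 0 < y i) (hω : (Y - ω).PosSemidef) :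
    schurForm (fun i j => logKernel (y i) (y j)) U ω 1 ≤ Fintype.card n := by
  rw [schurForm_one _ hY]
  have hG : Diagonalizes U (fun i => logKernel (y i) (y i))
      (U * diagonal (fun i => (logKernel (y i) (y i) : ℂ)) * Uᴴ) := ⟨hY.left, hY.right, rfl⟩
  have h1 := trace_mul_re_mono (hG.posSemidef fun i => (logKernel_pos (hy i) (hy i)).le) hω
  rw [trace_mul_comm, trace_mul_comm _ Y] at h1
  refine h1.trans (le_of_eq ?_)
  have h2 := (hY.mul hG).congr (b := fun _ => 1) fun i => by
    rw [Pi.mul_apply, logKernel_self (hy i), mul_one_div_cancel (hy i).ne']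
  rw [h2.trace_eq]
  simp

/-- The logarithm of `M` against that of `ρ ⊗ Ω`, if `Ω` dominates the second marginal of `M`. -/
theorem trace_kronecker_mul_log_le {ρ : Matrix n n ℂ} {ω Ω : Matrix m m ℂ} (hρ : IsState ρ)
    (hω : ω.PosSemidef) (hΩω : (Ω - ω).PosSemidef) {M : Matrix (n × m) (n × m) ℂ} (hM : M.PosDef)
    {c ζ : ℝ} (hζ : 0 < ζ)
    (hMΩ : marginalSnd M = Ω + (c : ℂ) • (1 : Matrix m m ℂ)) (hc : 0 ≤ c) :
    ((ρ ⊗ₖ ω) * cfc Real.log M).trace.re ≤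
      ((ρ ⊗ₖ ω) * cfc Real.log (ρ ⊗ₖ Ω + (ζ : ℂ) • (1 : Matrix (n × m) (n × m) ℂ))).trace.re +
        c * Fintype.card m := by
  have hΩ : Ω.PosSemidef := by simpa using hΩω.add hω
  obtain ⟨U, p, hU⟩ := hρ.1.isHermitian.exists_diagonalizes
  have hp := hU.nonneg hρ.1
  have hsum : ∑ i, p i = 1 := by
    have := hU.trace_eq
    rw [hρ.2, ← Complex.ofReal_sum] at this
    exact_mod_cast this.symm
  have hp1 : ∀ i, p i ≤ 1 := fun i => by
    rw [← hsum]; exact Finset.single_le_sum (fun j _ => hp j) (Finset.mem_univ i)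
  have hY := hΩ.add_smul_one hζ
  set Y := Ω + (ζ : ℂ) • (1 : Matrix m m ℂ) with hYdef
  obtain ⟨W, y, hW⟩ := hY.isHermitian.exists_diagonalizes
  have hy := hW.pos hY
  set t := ω.trace.re with ht
  -- lower bound for the product
  have hlow : (ω * cfc Real.log Y).trace.re + ∑ i, p i * (Real.log (p i) * t) ≤
      ((ρ ⊗ₖ ω) *
        cfc Real.log (ρ ⊗ₖ Ω + (ζ : ℂ) • (1 : Matrix (n × m) (n × m) ℂ))).trace.re := by
    rw [cfc_add_smul_one (hρ.1.kronecker hΩ).isHermitian, trace_kronecker_mul_eq_sum hU,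
      ← one_mul (ω * cfc Real.log Y).trace.re, ← hsum, Finset.sum_mul, ← Finset.sum_add_distrib]
    refine Finset.sum_le_sum fun i _ => ?_
    rw [← mul_add, blockRow_conj_cfc hU hΩ.isHermitian]
    rcases (hp i).eq_or_lt with h0 | h0
    · rw [← h0]; simp
    refine mul_le_mul_of_nonneg_left ?_ (hp i)
    have e : (ω * cfc Real.log Y).trace.re + Real.log (p i) * t =
        (ω * cfc (fun x => Real.log (x + ζ) + Real.log (p i)) Ω).trace.re := by
      rw [cfc_fun_add_const hΩ.isHermitian (fun x => Real.log (x + ζ)), hYdef,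
        cfc_add_smul_one hΩ.isHermitian, Matrix.mul_add, trace_add, Complex.add_re, Matrix.mul_smul,
        Matrix.mul_one, trace_smul, smul_eq_mul, Complex.re_ofReal_mul]
    rw [e]
    refine trace_mul_cfc_mono hω hΩ fun x hx => ?_
    rw [← Real.log_mul (by positivity) h0.ne']
    refine Real.log_le_log (by positivity) ?_
    have := mul_le_mul_of_nonneg_right (hp1 i) hζ.le
    linarith
  -- upper bound by the tangent inequality on the second factor
  have hup : ((ρ ⊗ₖ ω) * cfc Real.log M).trace.re ≤ (ω * cfc Real.log Y).trace.re +
      ∑ i, p i * (Real.log (p i) * t) + c * Fintype.card m := by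
    -- The weights √p_i make ∑ V Vᴴ = 1, while M/p_i compensates them so that ∑ V τ Vᴴ collects the
    -- diagonal blocks of M, whose total is the marginal. For p_i = 0 the value of τ is immaterial
    -- because V vanishes.
    set V : n → Matrix m (n × m) ℂ := fun i => ((√(p i) : ℝ) : ℂ) • blockRow m U i with hV
    set τ : n → Matrix (n × m) (n × m) ℂ := fun i =>
      if p i = 0 then 1 else ((p i)⁻¹ : ℂ) • M with hτ
    have hconj : ∀ i (S : Matrix (n × m) (n × m) ℂ), V i * S * (V i)ᴴ =
        (p i : ℂ) • (blockRow m U i * S * (blockRow m U i)ᴴ) := fun i S => by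
      simp only [hV]
      rw [conjTranspose_smul, RCLike.star_def, Complex.conj_ofReal, Matrix.smul_mul,
        Matrix.smul_mul, Matrix.mul_smul, smul_smul, ← Complex.ofReal_mul,
        Real.mul_self_sqrt (hp i)]
    have hVV : ∑ i, V i * (V i)ᴴ = 1 := by
      have : ∀ i, V i * (V i)ᴴ = (p i : ℂ) • (1 : Matrix m m ℂ) := fun i => by
        have := hconj i 1
        rwa [Matrix.mul_one, Matrix.mul_one, blockRow_mul_conjTranspose hU.left] at this
      simp only [this]
      rw [← Finset.sum_smul, ← Complex.ofReal_sum, hsum, Complex.ofReal_one, one_smul]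
    have hτpos : ∀ i, (τ i).PosDef := fun i => by
      simp only [hτ]
      split_ifs with h
      · exact PosDef.one
      · refine hM.smul ?_
        have : 0 < (p i)⁻¹ := inv_pos.2 (lt_of_le_of_ne (hp i) (Ne.symm h))
        exact_mod_cast this
    have htan := isResolventPair_log.trace_tangent_family hy hω V hτpos hW hVV
    have hterm : ∀ i, (ω * (V i * cfc (fun x => -Real.log x) (τ i) * (V i)ᴴ)).trace.re =
        p i * (Real.log (p i) * t) -
          p i * (ω * (blockRow m U i * cfc Real.log M * (blockRow m U i)ᴴ)).trace.re := fun i => by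
      rw [hconj, Matrix.mul_smul, trace_smul, smul_eq_mul, Complex.re_ofReal_mul]
      rcases (hp i).eq_or_lt with h0 | h0
      · rw [← h0]; simp
      have e : cfc (fun x => -Real.log x) (τ i) =
          -cfc Real.log M + ((Real.log (p i) : ℝ) : ℂ) • (1 : Matrix (n × m) (n × m) ℂ) := by
        simp only [hτ, if_neg h0.ne']
        rw [← Complex.ofReal_inv, cfc_smul_of_pos hM.isHermitian, ← cfc_neg_log hM.isHermitian,
          ← cfc_fun_add_const hM.isHermitian]
        refine cfc_congr_of_pos hM fun x hx => ?_
        rw [Real.log_mul (inv_ne_zero h0.ne') hx.ne', Real.log_inv]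
        ring
      rw [e, Matrix.mul_add, Matrix.add_mul, Matrix.mul_add, trace_add, Complex.add_re,
        Matrix.mul_smul, Matrix.smul_mul, Matrix.mul_one, blockRow_mul_conjTranspose hU.left,
        Matrix.mul_smul, Matrix.mul_one, trace_smul, smul_eq_mul, Complex.re_ofReal_mul,
        Matrix.mul_neg, Matrix.neg_mul, Matrix.mul_neg, trace_neg, Complex.neg_re]
      ring
    simp only [hterm, Finset.sum_sub_distrib] at htan
    rw [← trace_kronecker_mul_eq_sum hU, cfc_neg_log hY.isHermitian, Matrix.mul_neg, trace_neg,
      Complex.neg_re] at htan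
    have hS : schurForm (fun i j => logKernel (y i) (y j)) W ω (∑ i, V i * τ i * (V i)ᴴ - Y) ≤
        c * Fintype.card m := by
      -- Blocks with p_i = 0 are lost from ∑ V τ Vᴴ, so it is only dominated by the marginal Ω +
      -- c·1; this direction is the one needed.
      have hle : ((c : ℂ) • (1 : Matrix m m ℂ) - (∑ i, V i * τ i * (V i)ᴴ - Y)).PosSemidef := by
        have e : (c : ℂ) • (1 : Matrix m m ℂ) - (∑ i, V i * τ i * (V i)ᴴ - Y) =
            ∑ i, (blockRow m U i * M * (blockRow m U i)ᴴ - V i * τ i * (V i)ᴴ) +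
              (ζ : ℂ) • (1 : Matrix m m ℂ) := by
          rw [Finset.sum_sub_distrib, sum_blockRow_conj hU.right, hMΩ, hYdef]
          abel
        rw [e]
        refine (posSemidef_sum _ fun i _ => ?_).add
          (PosSemidef.one.smul (by exact_mod_cast hζ.le))
        rw [hconj]
        simp only [hτ]
        rcases (hp i).eq_or_lt with h0 | h0
        · rw [← h0, Complex.ofReal_zero, zero_smul, sub_zero]
          exact hM.posSemidef.mul_mul_conjTranspose_same _
        · rw [if_neg h0.ne', Matrix.mul_smul, Matrix.smul_mul, smul_smul, mul_inv_cancel₀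
            (by exact_mod_cast h0.ne'), one_smul, sub_self]
          exact PosSemidef.zero
      have h1 := schurForm_nonneg (isResolventPair_log.posSemidef y hy) W hω hle
      rw [map_sub, schurForm_ofReal_smul] at h1
      have h2 : (Y - ω).PosSemidef := by
        rw [hYdef, add_sub_right_comm]
        exact hΩω.add (PosSemidef.one.smul (by exact_mod_cast hζ.le))
      have h3 := mul_le_mul_of_nonneg_left (schurForm_logKernel_one_le hW hy h2) hc
      linarith
    linarith
  linarith

end

end

noncomputable section

open Matrix MeasureTheory

/-! ### The averaged entropy of the compressed state -/

section
variable {A C E : Type*} [Fintype A] [DecidableEq A] [Fintype C] [DecidableEq C] [Fintype E]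
  [DecidableEq E]

omit [DecidableEq A] in
theorem trace_compressedState_mul (ρ : Matrix (A × E) (A × E) ℂ) (ω : Matrix (A × C) (A × C) ℂ)
    (U : Matrix A A ℂ) (X : Matrix (C × E) (C × E) ℂ) :
    (compressedState ρ ω U * X).trace =
      ((ρ ⊗ₖ ω) * (teleportOp C E U * X * (teleportOp C E U)ᴴ)).trace := by
  rw [compressedState, Matrix.mul_assoc, Matrix.mul_assoc, trace_mul_comm, Matrix.mul_assoc,
    Matrix.mul_assoc]

omit [Fintype C] [Fintype E] in
theorem continuous_teleportOp :
    Continuous fun U : Matrix.unitaryGroup A ℂ => teleportOp C E (U : Matrix A A ℂ) := by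
  refine continuous_matrix fun x y => ?_
  simp only [teleportOp, of_apply]
  fun_prop

theorem continuous_compressedState (ρ : Matrix (A × E) (A × E) ℂ)
    (ω : Matrix (A × C) (A × C) ℂ) :
    Continuous fun U : Matrix.unitaryGroup A ℂ => compressedState ρ ω (U : Matrix A A ℂ) := by
  have h := continuous_teleportOp (A := A) (C := C) (E := E)
  exact (h.matrix_conjTranspose.matrix_mul continuous_const).matrix_mul h

theorem integrable_trace_mul_log {ρ : Matrix (A × E) (A × E) ℂ} {ω : Matrix (A × C) (A × C) ℂ}
    (hρ : ρ.PosSemidef) (hω : ω.PosSemidef) :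
    Integrable (fun U : Matrix.unitaryGroup A ℂ => (compressedState ρ ω (U : Matrix A A ℂ) *
      cfc Real.log (compressedState ρ ω (U : Matrix A A ℂ))).trace.re) (haarUnitary A) := by
  refine haarUnitary_integrable ?_
  -- The logarithm is discontinuous at 0, but x log x is continuous, so the two factors are merged
  -- before continuity is used.
  have hh := fun U : Matrix.unitaryGroup A ℂ =>
    (compressedState_posSemidef hρ hω (U : Matrix A A ℂ)).isHermitian
  simp only [fun U : Matrix.unitaryGroup A ℂ => trace_mul_cfc_self (hh U) Real.log]
  exact Complex.continuous_re.comp (continuous_cfc_matrix (continuous_compressedState ρ ω) hh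
    Real.continuous_mul_log).matrix_trace

/-- With tr τ log τ = tr Z V (log τ) Vᴴ, the tangent bound at Y makes the right side real-linear in
V τ Vᴴ and V Vᴴ, hence computable on average. Replacing log τ by log(τ + ζ) only increases the trace
and accounts for the extra ζ term. -/
theorem compressedState_mul_log_le {ρ : Matrix (A × E) (A × E) ℂ} {ω : Matrix (A × C) (A × C) ℂ}
    (hρ : ρ.PosSemidef) (hω : ω.PosSemidef) (U : Matrix A A ℂ) {ζ : ℝ} (hζ : 0 < ζ)
    {W Y : Matrix ((A × E) × (A × C)) ((A × E) × (A × C)) ℂ} {y : (A × E) × (A × C) → ℝ}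
    (hW : Diagonalizes W y Y) (hy : ∀ i, 0 < y i) :
    (compressedState ρ ω U * cfc Real.log (compressedState ρ ω U)).trace.re ≤
      schurForm (fun i j => logKernel (y i) (y j)) W (ρ ⊗ₖ ω)
        (teleportOp C E U * compressedState ρ ω U * (teleportOp C E U)ᴴ) +
      ζ * schurForm (fun i j => logKernel (y i) (y j)) W (ρ ⊗ₖ ω)
        (teleportOp C E U * (teleportOp C E U)ᴴ) -
      schurForm (fun i j => -Real.log (y i) + y i * logKernel (y i) (y j)) W (ρ ⊗ₖ ω)
        (teleportOp C E U * (teleportOp C E U)ᴴ) := by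
  have hτ := compressedState_posSemidef hρ hω U
  have h1 := isResolventPair_log.trace_tangent hy (hρ.kronecker hω) (teleportOp C E U)
    (hτ.add_smul_one hζ) hW
  rw [← trace_compressedState_mul, cfc_neg_log (hτ.add_smul_one hζ).isHermitian, Matrix.mul_neg,
    trace_neg, Complex.neg_re, cfc_add_smul_one hτ.isHermitian, Matrix.mul_add, Matrix.add_mul,
    Matrix.mul_smul, Matrix.smul_mul, Matrix.mul_one, map_add, schurForm_ofReal_smul,
    trace_mul_cfc_self hτ.isHermitian] at h1
  have h2 : (compressedState ρ ω U * cfc Real.log (compressedState ρ ω U)).trace.re ≤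
      (cfc (fun x => x * Real.log (x + ζ)) (compressedState ρ ω U)).trace.re := by
    rw [trace_mul_cfc_self hτ.isHermitian]
    refine trace_cfc_mono hτ fun x hx => ?_
    rcases hx.eq_or_lt with h0 | h0
    · rw [← h0]; simp
    · exact mul_le_mul_of_nonneg_left (Real.log_le_log h0 (by linarith)) hx
  linarith

/-- The unnormalized product `I ⊗ ρ_E ⊗ I ⊗ ω_C`. -/
def marginalProduct (ρ : Matrix (A × E) (A × E) ℂ) (ω : Matrix (A × C) (A × C) ℂ) :
    Matrix ((A × E) × (A × C)) ((A × E) × (A × C)) ℂ :=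
  ((1 : Matrix A A ℂ) ⊗ₖ marginalSnd ρ) ⊗ₖ ((1 : Matrix A A ℂ) ⊗ₖ marginalSnd ω)

omit [DecidableEq E] in
theorem one_kronecker_marginalSnd_posSemidef {ρ : Matrix (A × E) (A × E) ℂ}
    (hρ : ρ.PosSemidef) : ((1 : Matrix A A ℂ) ⊗ₖ marginalSnd ρ).PosSemidef :=
  PosSemidef.one.kronecker (marginalSnd_posSemidef hρ)

omit [DecidableEq C] [DecidableEq E] in
theorem marginalProduct_posSemidef {ρ : Matrix (A × E) (A × E) ℂ} {ω : Matrix (A × C) (A × C) ℂ}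
    (hρ : ρ.PosSemidef) (hω : ω.PosSemidef) : (marginalProduct ρ ω).PosSemidef :=
  (one_kronecker_marginalSnd_posSemidef hρ).kronecker (one_kronecker_marginalSnd_posSemidef hω)

omit [DecidableEq A] [DecidableEq E] in
theorem trace_marginalSnd (ρ : Matrix (A × E) (A × E) ℂ) : (marginalSnd ρ).trace = ρ.trace := by
  simp only [Matrix.trace, marginalSnd, of_apply, diag_apply, Fintype.sum_prod_type]
  exact Finset.sum_comm

omit [Fintype C] [DecidableEq C] [DecidableEq E] [DecidableEq A] in
theorem marginalSnd_kronecker (ρ : Matrix (A × E) (A × E) ℂ) (ω : Matrix (A × C) (A × C) ℂ) :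
    marginalSnd (ρ ⊗ₖ ω) = ρ.trace • ω := by
  ext x y
  simp [marginalSnd, Matrix.trace, Finset.sum_mul]

/-- The average of the second-moment operator against the product operator. -/
theorem schurForm_secondMoment_le {ρ : Matrix (A × E) (A × E) ℂ} {ω : Matrix (A × C) (A × C) ℂ}
    (hρ : IsState ρ) (hω : ω.PosSemidef) {ζ : ℝ} (hζ : 0 < ζ)
    {W : Matrix ((A × E) × (A × C)) ((A × E) × (A × C)) ℂ} {y : (A × E) × (A × C) → ℝ}
    (hW : Diagonalizes W y (marginalProduct ρ ω + ρ ⊗ₖ ω +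
      (ζ : ℂ) • (1 : Matrix ((A × E) × (A × C)) ((A × E) × (A × C)) ℂ))) :
    schurForm (fun i j => logKernel (y i) (y j)) W (ρ ⊗ₖ ω) (marginalProduct ρ ω + ρ ⊗ₖ ω -
      (Fintype.card A : ℂ) • (ρ ⊗ₖ ((1 : Matrix A A ℂ) ⊗ₖ marginalSnd ω) +
        ((1 : Matrix A A ℂ) ⊗ₖ marginalSnd ρ) ⊗ₖ ω)) ≤
      ζ * Fintype.card (A × E) * Fintype.card (A × C) := by
  have hZ := hρ.1.kronecker hω
  have hσ := marginalProduct_posSemidef hρ.1 hω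
  have hY := (hσ.add hZ).add_smul_one hζ
  have hy := hW.pos hY
  set ℓ := schurForm (fun i j => logKernel (y i) (y j)) W (ρ ⊗ₖ ω) with hℓ
  set d : ℝ := (Fintype.card A : ℝ) with hd
  -- Up to a multiple of 1 coming from ζ, this is the marginal of the base point on A × C, as tr(1 ⊗
  -- ρ_E) = d and tr ρ = 1.
  set Ω := ω + (d : ℂ) • ((1 : Matrix A A ℂ) ⊗ₖ marginalSnd ω) with hΩ
  have hdω : ((d : ℂ) • ((1 : Matrix A A ℂ) ⊗ₖ marginalSnd ω)).PosSemidef :=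
    (one_kronecker_marginalSnd_posSemidef hω).smul (by positivity)
  have hΩω : (Ω - ω).PosSemidef := by rwa [hΩ, add_sub_cancel_left]
  have hΩp : Ω.PosSemidef := hω.add hdω
  -- the second cross term dominates `ρ ⊗ ω`
  have hb : 0 ≤ ℓ ((d : ℂ) • (((1 : Matrix A A ℂ) ⊗ₖ marginalSnd ρ) ⊗ₖ ω) - ρ ⊗ₖ ω) := by
    refine schurForm_nonneg (isResolventPair_log.posSemidef y hy) W hZ ?_
    have := (pinching hρ.1).kronecker hω
    have e : (d : ℂ) • (((1 : Matrix A A ℂ) ⊗ₖ marginalSnd ρ) ⊗ₖ ω) - ρ ⊗ₖ ω =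
        ((Fintype.card A : ℂ) • ((1 : Matrix A A ℂ) ⊗ₖ marginalSnd ρ) - ρ) ⊗ₖ ω := by
      ext x y
      simp only [hd, Matrix.sub_apply, Matrix.smul_apply, kroneckerMap_apply, smul_eq_mul,
        Complex.ofReal_natCast]
      ring
    rwa [e]
  -- the first cross term
  have hmarg : marginalSnd (marginalProduct ρ ω + ρ ⊗ₖ ω +
      (ζ : ℂ) • (1 : Matrix ((A × E) × (A × C)) ((A × E) × (A × C)) ℂ)) =
      Ω + ((ζ * Fintype.card (A × E) : ℝ) : ℂ) • (1 : Matrix (A × C) (A × C) ℂ) := by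
    have hadd : ∀ X X' : Matrix ((A × E) × (A × C)) ((A × E) × (A × C)) ℂ,
        marginalSnd (X + X') = marginalSnd X + marginalSnd X' := fun X X' => by
      ext; simp [marginalSnd, Finset.sum_add_distrib]
    have hone : marginalSnd ((ζ : ℂ) • (1 : Matrix ((A × E) × (A × C)) ((A × E) × (A × C)) ℂ)) =
        ((ζ * Fintype.card (A × E) : ℝ) : ℂ) • (1 : Matrix (A × C) (A × C) ℂ) := by
      ext x y
      simp [marginalSnd, Matrix.one_apply, Prod.ext_iff]
      try ring_nf
    rw [hadd, hadd, hone, marginalProduct, marginalSnd_kronecker, marginalSnd_kronecker, hρ.2, one_smul,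
      trace_kronecker, trace_one, trace_marginalSnd, hρ.2, mul_one, hΩ, add_comm ω, hd,
      Complex.ofReal_natCast]
  have hp := trace_kronecker_mul_log_le hρ hω hΩω hY hζ hmarg (by positivity)
  have ht := trace_mul_log_le hy hZ ((hρ.1.kronecker hΩp).add_smul_one hζ) hW
  -- The ρ ⊗ ω and ζ terms cancel: the displacement from the base point to ρ ⊗ Ω + ζ is exactly the
  -- first cross term minus σ. Comparing the tangent bound along it with
  -- `trace_kronecker_mul_log_le` shows that the form is at least minus an error of order ζ.
  have e1 : ρ ⊗ₖ Ω + (ζ : ℂ) • (1 : Matrix ((A × E) × (A × C)) ((A × E) × (A × C)) ℂ) -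
      (marginalProduct ρ ω + ρ ⊗ₖ ω +
      (ζ : ℂ) • (1 : Matrix ((A × E) × (A × C)) ((A × E) × (A × C)) ℂ)) =
      (d : ℂ) • (ρ ⊗ₖ ((1 : Matrix A A ℂ) ⊗ₖ marginalSnd ω)) - marginalProduct ρ ω := by
    rw [hΩ, kronecker_add, kronecker_smul]
    abel
  rw [e1] at ht
  have e2 : marginalProduct ρ ω + ρ ⊗ₖ ω -
      (Fintype.card A : ℂ) • (ρ ⊗ₖ ((1 : Matrix A A ℂ) ⊗ₖ marginalSnd ω) +
        ((1 : Matrix A A ℂ) ⊗ₖ marginalSnd ρ) ⊗ₖ ω) =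
      -((d : ℂ) • (ρ ⊗ₖ ((1 : Matrix A A ℂ) ⊗ₖ marginalSnd ω)) - marginalProduct ρ ω) -
      ((d : ℂ) • (((1 : Matrix A A ℂ) ⊗ₖ marginalSnd ρ) ⊗ₖ ω) - ρ ⊗ₖ ω) := by
    rw [smul_add, hd, Complex.ofReal_natCast]
    abel
  rw [e2, map_sub, map_neg]
  linarith

/-- The pointwise tangent bound is integrated. The values of the form at ζ·1 from the regularized
state and from the base point cancel, leaving the logarithm at the base point and the second-moment
excess. -/
theorem integral_compressedState_mul_log_le {ρ : Matrix (A × E) (A × E) ℂ}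
    {ω : Matrix (A × C) (A × C) ℂ} (hρ : IsState ρ) (hω : ω.PosSemidef)
    (hd : 1 < Fintype.card A) {ζ : ℝ} (hζ : 0 < ζ) :
    ∫ U : Matrix.unitaryGroup A ℂ, (compressedState ρ ω (U : Matrix A A ℂ) *
      cfc Real.log (compressedState ρ ω (U : Matrix A A ℂ))).trace.re ∂(haarUnitary A) ≤
    ((ρ ⊗ₖ ω) * cfc Real.log (marginalProduct ρ ω + ρ ⊗ₖ ω +
      (ζ : ℂ) • (1 : Matrix ((A × E) × (A × C)) ((A × E) × (A × C)) ℂ))).trace.re +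
      ζ * Fintype.card (A × E) * Fintype.card (A × C) := by
  have hZ := hρ.1.kronecker hω
  have hY := ((marginalProduct_posSemidef hρ.1 hω).add hZ).add_smul_one hζ
  obtain ⟨W, y, hW⟩ := hY.isHermitian.exists_diagonalizes
  have hy := hW.pos hY
  have hsm := schurForm_secondMoment_le hρ hω hζ hW
  set ℓ := schurForm (fun i j => logKernel (y i) (y j)) W (ρ ⊗ₖ ω) with hℓ
  set o := schurForm (fun i j => -Real.log (y i) + y i * logKernel (y i) (y j)) W (ρ ⊗ₖ ω) with ho
  set R := (Fintype.card A : ℂ) • (ρ ⊗ₖ ((1 : Matrix A A ℂ) ⊗ₖ marginalSnd ω) +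
        ((1 : Matrix A A ℂ) ⊗ₖ marginalSnd ρ) ⊗ₖ ω) with hR
  set c : ℝ := ((Fintype.card A : ℝ) ^ 2 - 1)⁻¹ with hc
  have hd2 : (1 : ℝ) ≤ (Fintype.card A : ℝ) ^ 2 - 1 := by
    have : (2 : ℝ) ≤ Fintype.card A := by exact_mod_cast hd
    nlinarith
  have hV := continuous_teleportOp (A := A) (C := C) (E := E)
  have hVV := hV.matrix_mul hV.matrix_conjTranspose
  have hVτV := (hV.matrix_mul (continuous_compressedState ρ ω)).matrix_mul hV.matrix_conjTranspose
  have I1 := integral_linearMap_eq ℓ hVτV (M := (c : ℂ) •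
    ((((Fintype.card A : ℝ) ^ 2 : ℝ) : ℂ) • (marginalProduct ρ ω + ρ ⊗ₖ ω) - R)) fun x y => by
      have h := integral_teleportOp_conj ρ ω x y
      have hne : ((Fintype.card A : ℂ) ^ 2 - 1) ≠ 0 := by
        have : ((Fintype.card A : ℝ) ^ 2 - 1) ≠ 0 := by linarith
        exact_mod_cast this
      rw [Matrix.smul_apply, hc, smul_eq_mul]
      push_cast
      rw [eq_inv_mul_iff_mul_eq₀ hne]
      exact h
  have I2 := integral_linearMap_eq ℓ hVV integral_teleportOp_mul
  have I3 := integral_linearMap_eq o hVV integral_teleportOp_mul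
  have key := integral_mono (integrable_trace_mul_log hρ.1 hω) ((I1.1.add (I2.1.const_mul ζ)).sub I3.1)
    fun U => compressedState_mul_log_le hρ.1 hω (U : Matrix A A ℂ) hζ hW hy
  refine key.trans ?_
  rw [integral_sub' (I1.1.add (I2.1.const_mul ζ)) I3.1, integral_add' I1.1 (I2.1.const_mul ζ),
    integral_const_mul, I1.2, I2.2, I3.2, ho,
    schurForm_offset_one (f := fun x => -Real.log x) hW, ← hℓ, cfc_neg_log hY.isHermitian,
    Matrix.mul_neg, trace_neg, Complex.neg_re, map_add ℓ _ ((ζ : ℂ) • _), hℓ,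
    schurForm_ofReal_smul, schurForm_ofReal_smul, map_sub, schurForm_ofReal_smul, ← hℓ]
  rw [map_sub] at hsm
  set x := ℓ (marginalProduct ρ ω + ρ ⊗ₖ ω) with hx
  -- As d²/(d² - 1) - 1 = 1/(d² - 1), the excess is c times the quantity bounded in
  -- `schurForm_secondMoment_le`; c ≤ 1 because d ≥ 2.
  have e : c * ((Fintype.card A : ℝ) ^ 2 * x - ℓ R) - x = c * (x - ℓ R) := by
    rw [hc]
    field_simp [show (Fintype.card A : ℝ) ^ 2 - 1 ≠ 0 by linarith]
    ring
  have hcpos : 0 ≤ c := inv_nonneg.2 (by linarith)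
  have hc1 : c ≤ 1 := inv_le_one_of_one_le₀ hd2
  have h0 : 0 ≤ ζ * Fintype.card (A × E) * Fintype.card (A × C) := by positivity
  have h1 := mul_le_mul_of_nonneg_left hsm hcpos
  have h2 := mul_le_mul_of_nonneg_right hc1 h0
  linarith

end

end

noncomputable section

open Matrix MeasureTheory

/-! ### Supports and the sandwiched quasi-entropy -/

section
variable {n m : Type*} [Fintype n] [DecidableEq n] [Fintype m] [DecidableEq m]

omit [DecidableEq n] in
theorem suppLE_of_posSemidef_sub {X Y : Matrix n n ℂ} (hX : X.PosSemidef) {c : ℂ}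
    (h : (c • Y - X).PosSemidef) : SuppLE X Y := by
  intro v hv
  have h1 := h.dotProduct_mulVec_nonneg v
  have h2 := hX.dotProduct_mulVec_nonneg v
  rw [sub_mulVec, smul_mulVec, hv, smul_zero, zero_sub, dotProduct_neg] at h1
  exact (hX.dotProduct_mulVec_zero_iff v).1 (le_antisymm (neg_nonneg.1 h1) h2)

theorem SuppLE.mul_cfc_eq {X Y : Matrix n n ℂ} (hXY : SuppLE X Y) (hY : Y.IsHermitian)
    {f : ℝ → ℝ} (hf : ∀ x, x ≠ 0 → f x = 1) : X * cfc f Y = X := by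
  have h1 : Y * (1 - cfc f Y) = 0 := by
    rw [Matrix.mul_sub, Matrix.mul_one, trace_mul_cfc_self hY]
    have : (fun x => x * f x) = fun x => x := by
      funext x
      rcases eq_or_ne x 0 with h | h
      · simp [h]
      · rw [hf x h, mul_one]
    rw [this, cfc_id_eq hY, sub_self]
  have h2 : X * (1 - cfc f Y) = 0 := by
    ext i j
    have h3 : Y *ᵥ (fun k => (1 - cfc f Y) k j) = 0 := by
      ext k
      exact congrFun (congrFun h1 k) j
    exact congrFun (hXY _ h3) i
  rw [Matrix.mul_sub, Matrix.mul_one, sub_eq_zero] at h2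
  exact h2.symm

/-- On the support of Y, passing to Y + ζ conjugates K = Y^(-t) X Y^(-t) by the contraction (Y +
ζ)^(-t) Y^t. Writing K = L² and exchanging the factors turns this into L c² L ≤ L², so the trace of
the power decreases. -/
theorem sandwichedQ_add_smul_one_le {s : ℝ} (hs : 0 < s) {X Y : Matrix n n ℂ} (hX : X.PosSemidef)
    (hY : Y.PosSemidef) (hXY : SuppLE X Y) {ζ : ℝ} (hζ : 0 < ζ) :
    sandwichedQ (1 + s) X (Y + (ζ : ℂ) • (1 : Matrix n n ℂ)) ≤ sandwichedQ (1 + s) X Y := by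
  have hYh := hY.isHermitian
  set t := s / (1 + s) / 2 with ht
  have ht0 : 0 < t := by positivity
  rw [sandwichedQ_one_add hs, sandwichedQ_one_add hs, ← ht, cfc_add_smul_one hYh]
  set P := cfc (fun x : ℝ => x ^ (-t) * x ^ t) Y with hP
  set G := cfc (fun x : ℝ => x ^ (-t)) Y with hG
  set H := cfc (fun x : ℝ => x ^ t) Y with hH
  set c := cfc (fun x : ℝ => (x + ζ) ^ (-t) * x ^ t) Y with hc
  have hXP : X * (G * H) = X := by
    rw [hG, hH, cfc_mul_cfc hYh, cfc_congr_of_nonneg hY (g := fun x => if x = 0 then 0 else 1)]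
    · exact hXY.mul_cfc_eq hYh fun x hx => if_neg hx
    · intro x hx
      rcases hx.eq_or_lt with h | h
      · rw [← h, Real.zero_rpow ht0.ne']; simp
      · rw [← Real.rpow_add h, if_neg h.ne']; simp
  have hGh : Gᴴ = G := cfc_isHermitian hYh _
  have hHh : Hᴴ = H := cfc_isHermitian hYh _
  have hch : cᴴ = c := cfc_isHermitian hYh _
  have hPX : H * G * X = X := by
    have := congrArg conjTranspose hXP
    rwa [conjTranspose_mul, conjTranspose_mul, hGh, hHh, hX.isHermitian.eq] at this
  have hK : (G * X * G).PosSemidef := by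
    have := hX.conjTranspose_mul_mul_same G
    rwa [hGh] at this
  obtain ⟨L, hL, hLL⟩ := hK.exists_sqrt
  have e1 : cfc (fun x : ℝ => (x + ζ) ^ (-t)) Y * X * cfc (fun x : ℝ => (x + ζ) ^ (-t)) Y =
      (c * L) * (c * L)ᴴ := by
    have e2 : cfc (fun x : ℝ => (x + ζ) ^ (-t)) Y * H = c := cfc_mul_cfc hYh _ _
    have e3 : H * cfc (fun x : ℝ => (x + ζ) ^ (-t)) Y = c := by
      rw [hH, cfc_mul_cfc hYh, hc]; simp only [mul_comm]
    rw [conjTranspose_mul, hch, hL.isHermitian.eq]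
    calc _ = cfc (fun x : ℝ => (x + ζ) ^ (-t)) Y * ((H * G) * X * (G * H)) *
          cfc (fun x : ℝ => (x + ζ) ^ (-t)) Y := by rw [hPX, hXP]
      _ = (cfc (fun x : ℝ => (x + ζ) ^ (-t)) Y * H) * (G * X * G) *
          (H * cfc (fun x : ℝ => (x + ζ) ^ (-t)) Y) := by simp only [Matrix.mul_assoc]
      _ = _ := by rw [e2, e3, ← hLL]; simp only [Matrix.mul_assoc]
  rw [e1, trace_rpow_mul_conjTranspose _ (by linarith), ← hLL]
  refine trace_rpow_mono (posSemidef_conjTranspose_mul_self _) ?_ (by linarith)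
  have e4 : L * L - (c * L)ᴴ * (c * L) = Lᴴ * (1 - c * c) * L := by
    rw [conjTranspose_mul, hch, hL.isHermitian.eq, Matrix.mul_sub, Matrix.sub_mul, Matrix.mul_one]
    simp only [Matrix.mul_assoc]
  rw [e4]
  refine PosSemidef.conjTranspose_mul_mul_same ?_ _
  rw [hc, cfc_mul_cfc hYh, ← cfc_one_eq hYh]
  refine cfc_sub_posSemidef hY fun x hx => ?_
  have h1 : (x + ζ) ^ (-t) * x ^ t ≤ 1 := by
    rw [Real.rpow_neg (by positivity), inv_mul_le_iff₀ (by positivity), mul_one]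
    exact Real.rpow_le_rpow hx (by linarith) ht0.le
  have h0 : 0 ≤ (x + ζ) ^ (-t) * x ^ t := by positivity
  exact mul_le_one₀ h1 h0 h1

theorem cfc_rpow_kronecker {X : Matrix n n ℂ} {Y : Matrix m m ℂ} (hX : X.PosSemidef)
    (hY : Y.PosSemidef) (r : ℝ) : cfc (fun x : ℝ => x ^ r) (X ⊗ₖ Y) =
      cfc (fun x : ℝ => x ^ r) X ⊗ₖ cfc (fun x : ℝ => x ^ r) Y := by
  obtain ⟨U, a, hU⟩ := hX.isHermitian.exists_diagonalizes
  obtain ⟨W, b, hW⟩ := hY.isHermitian.exists_diagonalizes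
  exact ((hU.kronecker hW).cfc fun x : ℝ => x ^ r).unique
    (((hU.cfc _).kronecker (hW.cfc _)).congr fun i =>
      (Real.mul_rpow (hU.nonneg hX _) (hW.nonneg hY _)).symm)

theorem Matrix.PosSemidef.cfc_mul_mul_cfc {X S : Matrix n n ℂ} (hX : X.PosSemidef)
    (hS : S.IsHermitian) (f : ℝ → ℝ) : (cfc f S * X * cfc f S).PosSemidef := by
  have := hX.conjTranspose_mul_mul_same (cfc f S)
  rwa [(cfc_isHermitian hS _).eq] at this

theorem sandwichedQ_kronecker {s : ℝ} (hs : 0 < s) {X S : Matrix n n ℂ} {Y R : Matrix m m ℂ}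
    (hX : X.PosSemidef) (hS : S.PosSemidef) (hY : Y.PosSemidef) (hR : R.PosSemidef) :
    sandwichedQ (1 + s) (X ⊗ₖ Y) (S ⊗ₖ R) = sandwichedQ (1 + s) X S * sandwichedQ (1 + s) Y R := by
  have h := hX.cfc_mul_mul_cfc hS.isHermitian fun x : ℝ => x ^ (-(s / (1 + s) / 2))
  have h' := hY.cfc_mul_mul_cfc hR.isHermitian fun x : ℝ => x ^ (-(s / (1 + s) / 2))
  rw [sandwichedQ_one_add hs, sandwichedQ_one_add hs, sandwichedQ_one_add hs,
    cfc_rpow_kronecker hS hR, ← mul_kronecker_mul, ← mul_kronecker_mul,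
    cfc_rpow_kronecker h h', trace_kronecker, Complex.mul_re]
  have him := (Complex.nonneg_iff.1 (cfc_posSemidef_of_nonneg h'
    (f := fun x => x ^ (1 + s)) fun x hx => Real.rpow_nonneg hx _).trace_nonneg).2
  rw [← him, mul_zero, sub_zero]

/-- A diagonalization is transported along an equivalence of index types. -/
theorem Diagonalizes.submatrix {U M : Matrix n n ℂ} {a : n → ℝ} (h : Diagonalizes U a M)
    (e : m ≃ n) : Diagonalizes (U.submatrix e e) (a ∘ e) (M.submatrix e e) := by
  refine ⟨?_, ?_, ?_⟩
  · rw [conjTranspose_submatrix, submatrix_mul_equiv, h.left, submatrix_one_equiv]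
  · rw [conjTranspose_submatrix, submatrix_mul_equiv, h.right, submatrix_one_equiv]
  · conv_lhs => rw [h.eq]
    rw [conjTranspose_submatrix, ← submatrix_mul_equiv _ _ e e e, ← submatrix_mul_equiv _ _ e e e,
      submatrix_diagonal_equiv]
    rfl

end

/-! ### Reordering tensor factors; support of the decoupled state -/

section
variable {A C E : Type*} [Fintype A] [DecidableEq A] [Fintype C] [DecidableEq C] [Fintype E]
  [DecidableEq E]

/-- The exchange of factors `(A × E) × (A × C) ≃ (A × A) × (C × E)`. -/
def exchangeFactors (A C E : Type*) : (A × E) × (A × C) ≃ (A × A) × (C × E) where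
  toFun x := ((x.1.1, x.2.1), (x.2.2, x.1.2))
  invFun x := ((x.1.1, x.2.2), (x.1.2, x.2.1))
  left_inv _ := rfl
  right_inv _ := rfl

omit [DecidableEq C] [DecidableEq E] [Fintype C] [Fintype E] in
theorem marginalProduct_eq_submatrix (ρ : Matrix (A × E) (A × E) ℂ)
    (ω : Matrix (A × C) (A × C) ℂ) : marginalProduct ρ ω =
      ((1 : Matrix (A × A) (A × A) ℂ) ⊗ₖ (marginalSnd ω ⊗ₖ marginalSnd ρ)).submatrix
        (exchangeFactors A C E) (exchangeFactors A C E) := by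
  ext x y
  simp only [marginalProduct, kroneckerMap_apply, submatrix_apply, exchangeFactors, Equiv.coe_fn_mk,
    ← one_kronecker_one (m := A) (n := A)]
  ring

theorem cfc_marginalProduct {ρ : Matrix (A × E) (A × E) ℂ} {ω : Matrix (A × C) (A × C) ℂ}
    (hσ : (marginalSnd ω ⊗ₖ marginalSnd ρ).IsHermitian) (f : ℝ → ℝ) :
    cfc f (marginalProduct ρ ω) =
      ((1 : Matrix (A × A) (A × A) ℂ) ⊗ₖ cfc f (marginalSnd ω ⊗ₖ marginalSnd ρ)).submatrix
        (exchangeFactors A C E) (exchangeFactors A C E) := by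
  obtain ⟨U, a, h⟩ := hσ.exists_diagonalizes
  have h1 : Diagonalizes (1 : Matrix (A × A) (A × A) ℂ) (fun _ => 1) 1 :=
    ⟨by simp, by simp, by simp⟩
  rw [marginalProduct_eq_submatrix]
  exact (((h1.kronecker h).submatrix (exchangeFactors A C E)).cfc f).unique
    (((h1.kronecker (h.cfc f)).submatrix (exchangeFactors A C E)).congr fun i => by simp)

theorem trace_mul_one_kronecker {n m : Type*} [Fintype n] [DecidableEq n] [Fintype m]
    (M : Matrix (n × m) (n × m) ℂ) (X : Matrix m m ℂ) :
    (M * ((1 : Matrix n n ℂ) ⊗ₖ X)).trace = (marginalSnd M * X).trace := by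
  simp only [Matrix.trace, diag_apply, Matrix.mul_apply, Fintype.sum_prod_type,
    kroneckerMap_apply, marginalSnd, of_apply, Matrix.one_apply, ite_mul, one_mul, zero_mul,
    mul_ite, mul_zero, Finset.sum_mul]
  rw [Finset.sum_comm]
  refine Finset.sum_congr rfl fun i _ => ?_
  rw [Finset.sum_comm]
  simp only [Finset.sum_comm (s := (Finset.univ : Finset n)) (t := (Finset.univ : Finset m)),
    Finset.sum_ite_eq, Finset.mem_univ, if_true]

omit [DecidableEq C] [DecidableEq E] in
theorem trace_kronecker_mul_submatrix (ρ : Matrix (A × E) (A × E) ℂ)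
    (ω : Matrix (A × C) (A × C) ℂ) (X : Matrix (C × E) (C × E) ℂ) :
    ((ρ ⊗ₖ ω) * ((1 : Matrix (A × A) (A × A) ℂ) ⊗ₖ X).submatrix
        (exchangeFactors A C E) (exchangeFactors A C E)).trace =
      ((marginalSnd ω ⊗ₖ marginalSnd ρ) * X).trace := by
  set g := exchangeFactors A C E
  have e : (ρ ⊗ₖ ω) * ((1 : Matrix (A × A) (A × A) ℂ) ⊗ₖ X).submatrix g g =
      (((ρ ⊗ₖ ω).submatrix g.symm g.symm) * ((1 : Matrix (A × A) (A × A) ℂ) ⊗ₖ X)).submatrix g g := by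
    rw [← submatrix_mul_equiv _ _ _ g, submatrix_submatrix]
    simp
  have h : ∀ M : Matrix ((A × A) × (C × E)) ((A × A) × (C × E)) ℂ,
      (M.submatrix g g).trace = M.trace := fun M =>
    Equiv.sum_comp g fun i => M i i
  rw [e, h, trace_mul_one_kronecker]
  congr 2
  ext x y
  simp only [marginalSnd, of_apply, submatrix_apply, kroneckerMap_apply, Fintype.sum_prod_type, g,
    exchangeFactors, Equiv.coe_fn_symm_mk]
  rw [mul_comm, Finset.sum_mul_sum]


omit [DecidableEq C] [DecidableEq E] in
theorem card_sq_smul_marginalProduct_sub_posSemidef {ρ : Matrix (A × E) (A × E) ℂ}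
    {ω : Matrix (A × C) (A × C) ℂ} (hρ : ρ.PosSemidef) (hω : ω.PosSemidef) :
    ((Fintype.card A : ℂ) ^ 2 • marginalProduct ρ ω - ρ ⊗ₖ ω).PosSemidef := by
  have h1 := (pinching hρ).kronecker ((one_kronecker_marginalSnd_posSemidef hω).smul
    (a := (Fintype.card A : ℂ)) (by positivity))
  have h2 := hρ.kronecker (pinching hω)
  have e : (Fintype.card A : ℂ) ^ 2 • marginalProduct ρ ω - ρ ⊗ₖ ω =
      ((Fintype.card A : ℂ) • ((1 : Matrix A A ℂ) ⊗ₖ marginalSnd ρ) - ρ) ⊗ₖ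
        ((Fintype.card A : ℂ) • ((1 : Matrix A A ℂ) ⊗ₖ marginalSnd ω)) +
      ρ ⊗ₖ ((Fintype.card A : ℂ) • ((1 : Matrix A A ℂ) ⊗ₖ marginalSnd ω) - ω) := by
    ext x y
    simp only [marginalProduct, Matrix.sub_apply, Matrix.add_apply, Matrix.smul_apply,
      kroneckerMap_apply, smul_eq_mul]
    ring
  rw [e]
  exact h1.add h2

theorem compressedState_one_kronecker (M : Matrix E E ℂ) (N : Matrix C C ℂ)
    (U : Matrix.unitaryGroup A ℂ) :
    compressedState ((1 : Matrix A A ℂ) ⊗ₖ M) ((1 : Matrix A A ℂ) ⊗ₖ N) (U : Matrix A A ℂ) =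
      (Fintype.card A : ℂ) ^ 2 • (N ⊗ₖ M) := by
  have hU : ∀ a, ∑ b, (U : Matrix A A ℂ) a b * star ((U : Matrix A A ℂ) a b) = 1 := fun a => by
    have := congrFun (congrFun (Unitary.coe_mul_star_self U) a) a
    rwa [Matrix.mul_apply, Matrix.one_apply_eq] at this
  ext p q
  rw [compressedState_apply]
  simp only [kroneckerMap_apply, Matrix.one_apply, ite_mul, one_mul, zero_mul, mul_ite, mul_zero,
    Finset.sum_ite_eq, Finset.mem_univ, if_true, Matrix.smul_apply, smul_eq_mul]
  rw [Finset.sum_comm]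
  simp only [← Finset.mul_sum, hU]
  simp only [mul_one, Finset.sum_const, Finset.card_univ, nsmul_eq_mul]
  ring

/-- The double pinching bound ρ ⊗ ω ≤ d² σ is compressed by V, and σ compresses to a multiple of ω_C
⊗ ρ_E by unitarity. Domination for every U makes the divergence finite everywhere, not merely almost
surely. -/
theorem suppLE_compressedState {ρ : Matrix (A × E) (A × E) ℂ} {ω : Matrix (A × C) (A × C) ℂ}
    (hρ : ρ.PosSemidef) (hω : ω.PosSemidef) (U : Matrix.unitaryGroup A ℂ) :
    SuppLE (compressedState ρ ω (U : Matrix A A ℂ)) (marginalSnd ω ⊗ₖ marginalSnd ρ) := by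
  have h := (card_sq_smul_marginalProduct_sub_posSemidef hρ hω).conjTranspose_mul_mul_same
    (teleportOp C E (U : Matrix A A ℂ))
  rw [Matrix.mul_sub, Matrix.sub_mul, Matrix.mul_smul, Matrix.smul_mul, marginalProduct,
    ← compressedState, ← compressedState, compressedState_one_kronecker, smul_smul] at h
  exact suppLE_of_posSemidef_sub (compressedState_posSemidef hρ hω _) h

/-- The average divergence from the product of the marginals, if `A` is not trivial. -/
theorem integral_divergence_le_of_one_lt_card {ρ : Matrix (A × E) (A × E) ℂ} {ω : Matrix (A × C) (A × C) ℂ}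
    (hρ : IsState ρ) (hω : ω.PosSemidef) (hd : 1 < Fintype.card A) {s : ℝ} (hs0 : 0 < s)
    (hs1 : s ≤ 1) :
    ∫ U : Matrix.unitaryGroup A ℂ, (compressedState ρ ω (U : Matrix A A ℂ) *
      cfc Real.log (compressedState ρ ω (U : Matrix A A ℂ))).trace.re ∂(haarUnitary A) -
      ((marginalSnd ω ⊗ₖ marginalSnd ρ) *
        cfc Real.log (marginalSnd ω ⊗ₖ marginalSnd ρ)).trace.re ≤
    s ^ s * (1 - s) ^ (1 - s) / s *
      (sandwichedQ (1 + s) ρ ((1 : Matrix A A ℂ) ⊗ₖ marginalSnd ρ) *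
        sandwichedQ (1 + s) ω ((1 : Matrix A A ℂ) ⊗ₖ marginalSnd ω)) := by
  have hZ := hρ.1.kronecker hω
  have hσ' := marginalProduct_posSemidef hρ.1 hω
  have hσ := (marginalSnd_posSemidef hω).kronecker (marginalSnd_posSemidef hρ.1)
  have hc : 0 ≤ s ^ s * (1 - s) ^ (1 - s) / s :=
    div_nonneg (mul_nonneg (Real.rpow_nonneg hs0.le _) (Real.rpow_nonneg (by linarith) _)) hs0.le
  set K : ℝ := Fintype.card (C × E) + Fintype.card (A × E) * Fintype.card (A × C) with hK
  have hK0 : 0 ≤ K := by positivity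
  refine le_of_forall_pos_le_add fun ε hε => ?_
  -- K collects the two errors linear in ζ: the dimension terms of the averaged tangent bound, and
  -- |C||E| from regularizing log σ.
  obtain ⟨ζ, hζ, hζε⟩ : ∃ ζ : ℝ, 0 < ζ ∧ ζ * K ≤ ε := by
    refine ⟨ε / (K + 1), by positivity, ?_⟩
    rw [div_mul_eq_mul_div, div_le_iff₀ (by positivity)]
    nlinarith
  have h1 := integral_compressedState_mul_log_le hρ hω hd hζ
  have h2 := trace_log_add_sub_log_le hs0 hs1 (hσ'.add_smul_one hζ) hZ
  have h3 := sandwichedQ_add_smul_one_le hs0 hZ hσ'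
    (suppLE_of_posSemidef_sub hZ (card_sq_smul_marginalProduct_sub_posSemidef hρ.1 hω)) hζ
  -- The reference logarithm lives on C × E, where the trace against Z reduces to the product of
  -- marginals; the scalar input is x log(x + ζ) ≤ x log x + ζ.
  have h4 : ((ρ ⊗ₖ ω) * cfc Real.log (marginalProduct ρ ω +
      (ζ : ℂ) • (1 : Matrix ((A × E) × (A × C)) ((A × E) × (A × C)) ℂ))).trace.re ≤
      ((marginalSnd ω ⊗ₖ marginalSnd ρ) *
        cfc Real.log (marginalSnd ω ⊗ₖ marginalSnd ρ)).trace.re + ζ * Fintype.card (C × E) := by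
    rw [cfc_add_smul_one hσ'.isHermitian, cfc_marginalProduct hσ.isHermitian,
      trace_kronecker_mul_submatrix, trace_mul_cfc_self hσ.isHermitian,
      trace_mul_cfc_self hσ.isHermitian]
    have e : ((cfc (fun x => x * Real.log x) (marginalSnd ω ⊗ₖ marginalSnd ρ)).trace.re +
        ζ * Fintype.card (C × E)) =
        (cfc (fun x => x * Real.log x + ζ) (marginalSnd ω ⊗ₖ marginalSnd ρ)).trace.re := by
      rw [cfc_fun_add_const hσ.isHermitian, trace_add, trace_smul, trace_one, Complex.add_re,
        smul_eq_mul, Complex.re_ofReal_mul, Complex.natCast_re]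
    rw [e]
    refine trace_cfc_mono hσ fun x hx => ?_
    rcases hx.eq_or_lt with h0 | h0
    · rw [← h0]; simpa using hζ.le
    have h5 := Real.log_le_sub_one_of_pos (show 0 < (x + ζ) / x by positivity)
    rw [Real.log_div (by positivity) h0.ne', add_div, div_self h0.ne', add_sub_cancel_left,
      le_div_iff₀ h0] at h5
    linarith
  rw [add_right_comm] at h1
  have h6 := mul_le_mul_of_nonneg_left h3 hc
  rw [marginalProduct, sandwichedQ_kronecker hs0 hρ.1 (one_kronecker_marginalSnd_posSemidef hρ.1) hω
    (one_kronecker_marginalSnd_posSemidef hω), ← marginalProduct] at h6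
  rw [hK, mul_add, ← mul_assoc] at hζε
  linarith

end

end

noncomputable section

open Matrix MeasureTheory

/-! ### The decoupling bound -/

section
variable {A C E : Type*} [Fintype A] [DecidableEq A] [Fintype C] [DecidableEq C] [Fintype E]
  [DecidableEq E]

theorem compressedState_of_unique [Unique A] (ρ : Matrix (A × E) (A × E) ℂ)
    (ω : Matrix (A × C) (A × C) ℂ) (U : Matrix.unitaryGroup A ℂ) :
    compressedState ρ ω (U : Matrix A A ℂ) = marginalSnd ω ⊗ₖ marginalSnd ρ := by
  have hU := congrFun (congrFun (Unitary.coe_mul_star_self U) default) default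
  rw [Matrix.mul_apply, Matrix.one_apply_eq, Fintype.sum_unique] at hU
  ext p q
  rw [compressedState_apply]
  simp only [Fintype.sum_unique, Fintype.card_unique, Nat.cast_one, one_mul, kroneckerMap_apply,
    marginalSnd, of_apply]
  have hU' : (U : Matrix A A ℂ) default default * star ((U : Matrix A A ℂ) default default) = 1 := hU
  rw [hU']
  ring

theorem sandwichedQ_condEntropy_nonneg {ρ : Matrix (A × E) (A × E) ℂ}
    (hρ : ρ.PosSemidef) {s : ℝ} (hs : 0 < s) :
    0 ≤ sandwichedQ (1 + s) ρ ((1 : Matrix A A ℂ) ⊗ₖ marginalSnd ρ) :=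
  sandwichedQ_nonneg hs hρ (one_kronecker_marginalSnd_posSemidef hρ).isHermitian

/-- The average divergence from the product of the marginals. -/
theorem integral_divergence_le {ρ : Matrix (A × E) (A × E) ℂ} {ω : Matrix (A × C) (A × C) ℂ}
    (hρ : IsState ρ) (hω : ω.PosSemidef) {s : ℝ} (hs0 : 0 < s) (hs1 : s ≤ 1) :
    ∫ U : Matrix.unitaryGroup A ℂ, (compressedState ρ ω (U : Matrix A A ℂ) *
      cfc Real.log (compressedState ρ ω (U : Matrix A A ℂ))).trace.re ∂(haarUnitary A) -
      ((marginalSnd ω ⊗ₖ marginalSnd ρ) *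
        cfc Real.log (marginalSnd ω ⊗ₖ marginalSnd ρ)).trace.re ≤
    s ^ s * (1 - s) ^ (1 - s) / s *
      (sandwichedQ (1 + s) ρ ((1 : Matrix A A ℂ) ⊗ₖ marginalSnd ρ) *
        sandwichedQ (1 + s) ω ((1 : Matrix A A ℂ) ⊗ₖ marginalSnd ω)) := by
  rcases lt_or_ge 1 (Fintype.card A) with hd | hd
  · exact integral_divergence_le_of_one_lt_card hρ hω hd hs0 hs1
  -- Trace one excludes an empty A. For d = 1 the unitary is a phase and the state is already the
  -- product of its marginals, so the left side is zero.
  have hA : Nonempty A := by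
    by_contra h
    have := not_nonempty_iff.1 h
    have h2 := hρ.2
    simp [Matrix.trace] at h2
  have := Fintype.card_le_one_iff_subsingleton.1 hd
  have := uniqueOfSubsingleton hA.some
  simp only [compressedState_of_unique]
  rw [integral_const, probReal_univ, one_smul, sub_self]
  exact mul_nonneg (div_nonneg (mul_nonneg (Real.rpow_nonneg hs0.le _)
    (Real.rpow_nonneg (by linarith) _)) hs0.le) (mul_nonneg (sandwichedQ_condEntropy_nonneg hρ.1 hs0)
      (sandwichedQ_condEntropy_nonneg hω hs0))

theorem integral_trace_mul_cfc (ρ : Matrix (A × E) (A × E) ℂ) (ω : Matrix (A × C) (A × C) ℂ)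
    (X : Matrix (C × E) (C × E) ℂ) :
    Integrable (fun U : Matrix.unitaryGroup A ℂ =>
      (compressedState ρ ω (U : Matrix A A ℂ) * X).trace.re) (haarUnitary A) ∧
    ∫ U : Matrix.unitaryGroup A ℂ, (compressedState ρ ω (U : Matrix A A ℂ) * X).trace.re
      ∂(haarUnitary A) = ((marginalSnd ω ⊗ₖ marginalSnd ρ) * X).trace.re :=
  integral_linearMap_eq (Complex.reLm ∘ₗ (Matrix.traceLinearMap (C × E) ℝ ℂ) ∘ₗ
    LinearMap.mulRight ℝ X) (continuous_compressedState ρ ω) (integral_compressedState ρ ω)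

omit [DecidableEq E] in
theorem suppLE_one_kronecker_marginalSnd {ρ : Matrix (A × E) (A × E) ℂ} (hρ : ρ.PosSemidef) :
    SuppLE ρ ((1 : Matrix A A ℂ) ⊗ₖ marginalSnd ρ) :=
  suppLE_of_posSemidef_sub hρ (pinching hρ)

theorem sandwichedCondEntropy_eq {ρ : Matrix (A × E) (A × E) ℂ} (hρ : ρ.PosSemidef) {s : ℝ}
    (hs : 0 < s) : sandwichedCondEntropy (1 + s) ρ =
      ((-(1 / s * (Real.logb 2 (sandwichedQ (1 + s) ρ ((1 : Matrix A A ℂ) ⊗ₖ marginalSnd ρ)) -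
        Real.logb 2 ρ.trace.re)) : ℝ) : EReal) := by
  rw [sandwichedCondEntropy, sandwichedDiv,
    if_pos (Or.inl ⟨by linarith, suppLE_one_kronecker_marginalSnd hρ⟩), ← EReal.coe_neg,
    add_sub_cancel_left, mul_sub]

/-- For Q > 0 this is an equality undoing the logarithms. An inequality is stated because Q = 0
meets the default `Real.logb 2 0 = 0`; there the left side is simply zero. Keeping the trace as a
factor gives the stronger form of the final bound. -/
theorem sandwichedQ_le_trace_mul_rpow {ρ : Matrix (A × E) (A × E) ℂ} (hρ : ρ.PosSemidef) {s : ℝ}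
    (hs : 0 < s) : sandwichedQ (1 + s) ρ ((1 : Matrix A A ℂ) ⊗ₖ marginalSnd ρ) ≤
      ρ.trace.re * (2 : ℝ) ^ (-s * (sandwichedCondEntropy (1 + s) ρ).toReal) := by
  have htr := (Complex.nonneg_iff.1 hρ.trace_nonneg).1
  have hQ0 := sandwichedQ_condEntropy_nonneg hρ hs
  rw [sandwichedCondEntropy_eq hρ hs, EReal.toReal_coe]
  rcases hQ0.eq_or_lt with hQ | hQ
  · rw [← hQ]; positivity
  rcases htr.eq_or_lt with ht | ht
  · exfalso
    have h0 : ρ = 0 := hρ.trace_eq_zero_iff.1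
      (Complex.ext ht.symm (Complex.nonneg_iff.1 hρ.trace_nonneg).2.symm)
    have hz : cfc (fun x : ℝ => x ^ (1 + s)) (0 : Matrix (A × E) (A × E) ℂ) = 0 := by
      rw [cfc_apply_zero, Real.zero_rpow (by positivity), map_zero]
    rw [sandwichedQ_one_add hs, h0, Matrix.mul_zero, Matrix.zero_mul, hz] at hQ
    simp at hQ
  · have e : -s * -(1 / s * (Real.logb 2 (sandwichedQ (1 + s) ρ
        ((1 : Matrix A A ℂ) ⊗ₖ marginalSnd ρ)) - Real.logb 2 ρ.trace.re)) =
        Real.logb 2 (sandwichedQ (1 + s) ρ ((1 : Matrix A A ℂ) ⊗ₖ marginalSnd ρ)) -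
          Real.logb 2 ρ.trace.re := by
      field_simp
    rw [e, Real.rpow_sub two_pos, Real.rpow_logb two_pos (by norm_num) hQ,
      Real.rpow_logb two_pos (by norm_num) ht, mul_div_cancel₀ _ ht.ne']

omit [DecidableEq C] in
theorem trace_choi_le_one (T : Matrix A A ℂ →ₗ[ℂ] Matrix C C ℂ) (hT : IsTraceNonincreasing T) :
    (choi T).trace.re ≤ 1 := by
  rw [← trace_marginalSnd, marginalSnd_choi]
  refine (hT _ (PosSemidef.one.smul (by positivity))).trans ?_
  rw [trace_smul, trace_one, smul_eq_mul]
  rcases Nat.eq_zero_or_pos (Fintype.card A) with h | h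
  · simp [h]
  · rw [inv_mul_cancel₀ (Nat.cast_ne_zero.2 h.ne'), Complex.one_re]

theorem decouplingDiv_eq {T : Matrix A A ℂ →ₗ[ℂ] Matrix C C ℂ} {ρ : Matrix (A × E) (A × E) ℂ}
    (hρ : ρ.PosSemidef) (hT : IsCompletelyPositive T) (U : Matrix.unitaryGroup A ℂ) :
    decouplingDiv T ρ U =
      (((compressedState ρ (choi T) (U : Matrix A A ℂ) *
          cfc Real.log (compressedState ρ (choi T) (U : Matrix A A ℂ))).trace.re -
        (compressedState ρ (choi T) (U : Matrix A A ℂ) *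
          cfc Real.log (marginalSnd (choi T) ⊗ₖ marginalSnd ρ)).trace.re : ℝ) : EReal) := by
  rw [decouplingDiv, decoupledState_eq, ← marginalSnd_choi, relEntropy,
    if_pos (suppLE_compressedState hρ (choi_posSemidef hT) U), Matrix.mul_sub, trace_sub,
    Complex.sub_re]

end

theorem theorem1 {A C E : Type*} [Fintype A] [DecidableEq A] [Fintype C] [DecidableEq C]
    [Fintype E] [DecidableEq E]
    (ρ : Matrix (A × E) (A × E) ℂ) (hρ : IsState ρ)
    (T : Matrix A A ℂ →ₗ[ℂ] Matrix C C ℂ)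
    (hTcp : IsCompletelyPositive T) (hTtr : IsTraceNonincreasing T)
    (s : ℝ) (hs0 : 0 < s) (hs1 : s ≤ 1) :
    -- all quantities are finite, and the Haar average is that of an integrable function
    (∀ U : Matrix.unitaryGroup A ℂ, decouplingDiv T ρ U ≠ ⊤ ∧ decouplingDiv T ρ U ≠ ⊥) ∧
    MeasureTheory.Integrable (fun U => (decouplingDiv T ρ U).toReal) (haarUnitary A) ∧
    (sandwichedCondEntropy (1 + s) ρ ≠ ⊤ ∧ sandwichedCondEntropy (1 + s) ρ ≠ ⊥) ∧
    (sandwichedCondEntropy (1 + s) (choi T) ≠ ⊤ ∧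
      sandwichedCondEntropy (1 + s) (choi T) ≠ ⊥) ∧
    -- the bound
    decouplingError T ρ ≤
      s ^ s * (1 - s) ^ (1 - s) / s *
        (2 : ℝ) ^ (-s * (sandwichedCondEntropy (1 + s) ρ).toReal
          - s * (sandwichedCondEntropy (1 + s) (choi T)).toReal) ∧
    -- the bound, when the Rényi entropy of `ω` is not normalized by `tr ω ≤ 1`
    decouplingError T ρ ≤
      (choi T).trace.re * (s ^ s * (1 - s) ^ (1 - s) / s *
        (2 : ℝ) ^ (-s * (sandwichedCondEntropy (1 + s) ρ).toReal
          - s * (sandwichedCondEntropy (1 + s) (choi T)).toReal)) := by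
  have hω := choi_posSemidef hTcp
  have hfin := decouplingDiv_eq hρ.1 hTcp
  have h1 := integrable_trace_mul_log hρ.1 hω
  have h2 := integral_trace_mul_cfc ρ (choi T)
    (cfc Real.log (marginalSnd (choi T) ⊗ₖ marginalSnd ρ))
  have hc : 0 ≤ s ^ s * (1 - s) ^ (1 - s) / s :=
    div_nonneg (mul_nonneg (Real.rpow_nonneg hs0.le _) (Real.rpow_nonneg (by linarith) _)) hs0.le
  have hbound : decouplingError T ρ ≤
      (choi T).trace.re * (s ^ s * (1 - s) ^ (1 - s) / s *
        (2 : ℝ) ^ (-s * (sandwichedCondEntropy (1 + s) ρ).toReal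
          - s * (sandwichedCondEntropy (1 + s) (choi T)).toReal)) := by
    have h3 := integral_divergence_le hρ hω hs0 hs1
    have h4 := sandwichedQ_le_trace_mul_rpow hρ.1 hs0
    have h5 := sandwichedQ_le_trace_mul_rpow hω hs0
    rw [hρ.2, Complex.one_re, one_mul] at h4
    have h6 := mul_le_mul_of_nonneg_left (mul_le_mul h4 h5 (sandwichedQ_condEntropy_nonneg hω hs0)
      (by positivity)) hc
    rw [decouplingError]
    simp only [hfin, EReal.toReal_coe]
    -- The cross term is linear in the state, so the first moment replaces the average by the
    -- entropy-type term of the product of marginals.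
    rw [integral_sub h1 h2.1, h2.2, sub_eq_add_neg (-s * _), Real.rpow_add two_pos, ← neg_mul]
    refine h3.trans (h6.trans (le_of_eq ?_))
    ring
  refine ⟨fun U => ?_, ?_, ?_, ?_, ?_, hbound⟩
  · rw [hfin]
    exact ⟨EReal.coe_ne_top _, EReal.coe_ne_bot _⟩
  · simp only [hfin, EReal.toReal_coe]
    exact h1.sub h2.1
  · rw [sandwichedCondEntropy_eq hρ.1 hs0]
    exact ⟨EReal.coe_ne_top _, EReal.coe_ne_bot _⟩
  · rw [sandwichedCondEntropy_eq hω hs0]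
    exact ⟨EReal.coe_ne_top _, EReal.coe_ne_bot _⟩
  · refine hbound.trans (mul_le_of_le_one_left (by positivity) (trace_choi_le_one T hTtr))

end
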